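/- **Setting.** Let $U\in\mathbb R^{d\times n}$ have rank $d$, let $z\in\mathbb R^n$ have positive entries, $Z=\mathrm{diag}(z)$, and let $T\subseteq[n]$ (given as a duplicate-free list in any order). $U_S$ denotes the submatrix of the columns in $S$ and $Z_S=\mathrm{diag}(z_j)_{j\in S}$. Let $\mu_1,\dots,\mu_d$ be the eigenvalues, with multiplicity, of $U_TZ_TU_T^{\mathsf T}(UZU^{\mathsf T})^{-1}$; assume $\sum_{i}\mu_i(1-\mu_i)<1/4$, and put $\mu_s:=\sum_{i:\mu_i<1/2}\mu_i$. **Algorithm.** Let $W=(UZU^{\mathsf T})^{-1}$, $X=U_TZ_TU_T^{\mathsf T}W$, and let $p$ be the integer nearest to $\mathrm{tr}\,X$. If $p=\mathrm{rk}(U_T)$, output $0$; otherwise, if $p=0$, output $\mathrm{tr}\,X$. Otherwise write $\Delta(S)=\det(U_S^{\mathsf T}WU_SZ_S)$. Greedy selection: starting from $D=\emptyset$, add $p$ times an element $i\in T\setminus D$ maximizing $\Delta(D+i)$. Local search: let $(i,j)$ maximize $\Delta(D-i+j)$ over $i\in D$, $j\in T\setminus D$; if $\Delta(D-i+j)>2\Delta(D)$,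 replace $D$ by $D-i+j$ and repeat, otherwise stop. Finally output $$\mathrm{tr}\big[(I_d-U_D(U_D^{\mathsf T}WU_D)^{-1}U_D^{\mathsf T}W)\,X\big].$$ Ties in the maximizations are resolved by the order in which the candidates are listed. The algorithm uses exact real arithmetic ($+,-,\times,/$), comparisons, and matrix computations (multiplication, determinant, inverse). **Theorem.** On every such input the algorithm terminates (never dividing by zero or inverting a singular matrix), and its output $\tilde\mu$ satisfies $$\mu_s\le\tilde\mu\le(1+8nd^2)\,\mu_s .$$ If $d\ge1$, all its matrix computations involve only matrices with at most $d$ rows and at most $d$ columns; if moreover $n\ge2$, it uses $O(nd^2\log n)$ such matrix computations, together with $O(nd^2\log n)$ further scalar operations and comparisons, where the constant is absolute. Moreover the algorithm is strongly polynomial: when the matrix computations are themselves carried out by elementary operations (multiplication by the definition, determinant and inverse by the Faddeev–LeVerrier recursion), the output is the same, the total number of arithmetic operations and comparisons is bounded by a fixed polynomial in $n$ and $d$, and if all entries of $U$ and $z$ are rational of bit length at most $b$, then all intermediate quantities are rational of bit length bounded by a fixed polynomial in $n$, $d$ and $b$. -/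

import Mathlib

namespace FrameScaling

/-! ### The model of computation

A program of type `Prog V α` computes on exact scalars of an *abstract* type `V`.  Programs below are
polymorphic in `V` and use no structure on `V`, so the only way in which a program can create or
inspect a scalar is an instruction of the model: a literal, one of the four arithmetic operations,
a comparison, or one of the three matrix computations (product, determinant, inverse). -/

/-- The elementary arithmetic operations. -/
inductive ArithOp where
  | add
  | sub
  | mul
  | div

/-- Programs with exact arithmetic over scalars `V` that return a result of type `α`.
`diverge` is a computation that never returns. -/
inductive Prog (V : Type) (α : Type) : Type where
  | ret (a : α) : Prog V α
  | diverge : Prog V α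
  | lit (c : ℕ) (k : V → Prog V α) : Prog V α
  | arith (o : ArithOp) (x y : V) (k : V → Prog V α) : Prog V α
  | le (x y : V) (k : Bool → Prog V α) : Prog V α
  | matMul {a b c : ℕ} (A : Matrix (Fin a) (Fin b) V) (B : Matrix (Fin b) (Fin c) V)
      (k : Matrix (Fin a) (Fin c) V → Prog V α) : Prog V α
  | matDet {m : ℕ} (A : Matrix (Fin m) (Fin m) V) (k : V → Prog V α) : Prog V α
  | matInv {m : ℕ} (A : Matrix (Fin m) (Fin m) V)
      (k : Matrix (Fin m) (Fin m) V → Prog V α) : Prog V α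

namespace Prog

variable {V α β : Type}

/-- Sequential composition. -/
def bind : Prog V α → (α → Prog V β) → Prog V β
  | ret a, f => f a
  | diverge, _ => diverge
  | lit c k, f => lit c (fun x => (k x).bind f)
  | arith o x y k, f => arith o x y (fun v => (k v).bind f)
  | le x y k, f => le x y (fun b => (k b).bind f)
  | matMul A B k, f => matMul A B (fun C => (k C).bind f)
  | matDet A k, f => matDet A (fun x => (k x).bind f)
  | matInv A k, f => matInv A (fun C => (k C).bind f)

end Prog

instance {V : Type} : Monad (Prog V) where
  pure := Prog.ret
  bind := Prog.bind

/-- What an execution records for each instruction: the scalar produced by a literal or by an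
arithmetic operation, a comparison, or a matrix computation together with the largest dimension of
the matrices involved. -/
inductive Event (K : Type) where
  | scalar (x : K)
  | compare
  | matrix (m : ℕ)

/-- The value of an arithmetic operation; division by zero is undefined. -/
def ArithOp.eval {K : Type} [Field K] [LinearOrder K] : ArithOp → K → K → Option K
  | .add, x, y => some (x + y)
  | .sub, x, y => some (x - y)
  | .mul, x, y => some (x * y)
  | .div, x, y => if y = 0 then none else some (x / y)

/-- Execution over an ordered field: the returned result and the record of all the
instructions executed, one event per instruction.  It is `none` if the program diverges, divides
by zero or inverts a singular matrix. -/
noncomputable def Prog.run {K : Type} [Field K] [LinearOrder K] {α : Type} :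
    Prog K α → Option (α × List (Event K))
  | .ret a => some (a, [])
  | .diverge => none
  | .lit c k => (k (c : K)).run.map (fun r => (r.1, .scalar (c : K) :: r.2))
  | .arith o x y k =>
      match o.eval x y with
      | none => none
      | some v => (k v).run.map (fun r => (r.1, .scalar v :: r.2))
  | .le x y k => (k (decide (x ≤ y))).run.map (fun r => (r.1, .compare :: r.2))
  | .matMul (a := a) (b := b) (c := c) A B k =>
      (k (A * B)).run.map (fun r => (r.1, .matrix (max a (max b c)) :: r.2))
  | .matDet (m := m) A k => (k A.det).run.map (fun r => (r.1, .matrix m :: r.2))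
  | .matInv (m := m) A k =>
      if A.det = 0 then none else (k A⁻¹).run.map (fun r => (r.1, .matrix m :: r.2))

section Programs

variable {V : Type}

/-! ### Single instructions as programs -/

def lit (c : ℕ) : Prog V V := .lit c .ret
def add (x y : V) : Prog V V := .arith .add x y .ret
def sub (x y : V) : Prog V V := .arith .sub x y .ret
def mul (x y : V) : Prog V V := .arith .mul x y .ret
def div (x y : V) : Prog V V := .arith .div x y .ret
def leq (x y : V) : Prog V Bool := .le x y .ret
def matMul {a b c : ℕ} (A : Matrix (Fin a) (Fin b) V) (B : Matrix (Fin b) (Fin c) V) :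
    Prog V (Matrix (Fin a) (Fin c) V) := .matMul A B .ret
def matDet {m : ℕ} (A : Matrix (Fin m) (Fin m) V) : Prog V V := .matDet A .ret
def matInv {m : ℕ} (A : Matrix (Fin m) (Fin m) V) : Prog V (Matrix (Fin m) (Fin m) V) :=
  .matInv A .ret

/-! ### Loops over scalars and matrix entries -/

/-- Run `f 0, …, f (m - 1)` and collect the results. -/
def forFin {β : Type} : (m : ℕ) → (Fin m → Prog V β) → Prog V (Fin m → β)
  | 0, _ => pure Fin.elim0
  | m + 1, f => do
      let x ← f 0
      let g ← forFin m (fun i => f i.succ)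
      pure (Fin.cons x g)

/-- Fill in a matrix entry by entry. -/
def buildMatrix (a b : ℕ) (f : Fin a → Fin b → Prog V V) : Prog V (Matrix (Fin a) (Fin b) V) :=
  forFin a (fun i => forFin b (fun j => f i j))

/-- `acc + f 0 + ⋯ + f (m - 1)`. -/
def sumFrom (acc : V) : (m : ℕ) → (Fin m → Prog V V) → Prog V V
  | 0, _ => pure acc
  | m + 1, f => do
      let x ← f 0
      let acc' ← add acc x
      sumFrom acc' m (fun i => f i.succ)

/-- The trace. -/
def trace {m : ℕ} (A : Matrix (Fin m) (Fin m) V) : Prog V V := do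
  let zero ← lit 0
  sumFrom zero m (fun i => pure (A i i))

/-! ### Elementary implementation of the matrix computations

Products are computed by the definition; determinants and inverses by the Faddeev–LeVerrier
recursion
`M₀ = 0`, `c₀ = 1`, `M_{k+1} = A * M_k + c_k • 1`, `c_{k+1} = - tr (A * M_{k+1}) / (k + 1)`,
for which `det A = (-1)^m c_m` and `A⁻¹ = - M_m / c_m`. -/

def mulElem {a b c : ℕ} (A : Matrix (Fin a) (Fin b) V) (B : Matrix (Fin b) (Fin c) V) :
    Prog V (Matrix (Fin a) (Fin c) V) := do
  let zero ← lit 0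
  buildMatrix a c (fun i k => sumFrom zero b (fun j => mul (A i j) (B j k)))

/-- Step `k` of the recursion: the triple `(M_k, A * M_k, c_k)`. -/
def leverrier {m : ℕ} (A : Matrix (Fin m) (Fin m) V) :
    ℕ → Prog V (Matrix (Fin m) (Fin m) V × Matrix (Fin m) (Fin m) V × V)
  | 0 => do
      let zero ← lit 0
      let one ← lit 1
      pure (fun _ _ => zero, fun _ _ => zero, one)
  | k + 1 => do
      let (_, N, c) ← leverrier A k
      let M ← buildMatrix m m (fun i j => if i = j then add (N i j) c else pure (N i j))
      let N' ← mulElem A M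
      let t ← trace N'
      let k' ← lit (k + 1)
      let q ← div t k'
      let zero ← lit 0
      let c' ← sub zero q
      pure (M, N', c')

def detElem {m : ℕ} (A : Matrix (Fin m) (Fin m) V) : Prog V V := do
  let (_, _, c) ← leverrier A m
  if m % 2 = 0 then pure c
  else do
    let zero ← lit 0
    sub zero c

def invElem {m : ℕ} (A : Matrix (Fin m) (Fin m) V) : Prog V (Matrix (Fin m) (Fin m) V) := do
  let (M, _, c) ← leverrier A m
  let zero ← lit 0
  let c' ← sub zero c
  buildMatrix m m (fun i j => div (M i j) c')

/-- Replace every matrix computation by its elementary implementation; the result uses literals,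
arithmetic operations and comparisons only. -/
def Prog.expand {α : Type} : Prog V α → Prog V α
  | .ret a => .ret a
  | .diverge => .diverge
  | .lit c k => .lit c (fun x => (k x).expand)
  | .arith o x y k => .arith o x y (fun v => (k v).expand)
  | .le x y k => .le x y (fun b => (k b).expand)
  | .matMul A B k => (mulElem A B).bind (fun C => (k C).expand)
  | .matDet A k => (detElem A).bind (fun x => (k x).expand)
  | .matInv A k => (invElem A).bind (fun C => (k C).expand)

/-! ### The algorithm -/

/-- An element of `b :: l` with the largest value of `f` (the first one), where `v` is the value at
`b`. -/
def argmaxFrom {β : Type} (f : β → Prog V V) : β → V → List β → Prog V (β × V)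
  | b, v, [] => pure (b, v)
  | b, v, c :: l => do
      let w ← f c
      let isLe ← leq w v
      if isLe then argmaxFrom f b v l else argmaxFrom f c w l

/-- The first maximizer of `f` on a list with its value; `none` for the empty list. -/
def argmax {β : Type} (f : β → Prog V V) : List β → Prog V (Option (β × V))
  | [] => pure none
  | b :: l => do
      let v ← f b
      let r ← argmaxFrom f b v l
      pure (some r)

variable {d n : ℕ}

/-- The submatrix formed by the columns in the list `S`. -/
def cols (U : Matrix (Fin d) (Fin n) V) (S : List (Fin n)) : Matrix (Fin d) (Fin S.length) V :=
  U.submatrix id S.get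

/-- With `UZ = U * Z`, compute `U_S Z_S U_Sᵀ` as a sum of rank-one products of columns. -/
def weightedGram (U UZ : Matrix (Fin d) (Fin n) V) :
    List (Fin n) → Prog V (Matrix (Fin d) (Fin d) V)
  | [] => do
      let zero ← lit 0
      pure (fun _ _ => zero)
  | j :: S => do
      let G ← weightedGram U UZ S
      let R ← matMul (cols UZ [j]) (cols U [j]).transpose
      buildMatrix d d (fun i k => add (G i k) (R i k))

/-- With `W = (U Z Uᵀ)⁻¹` and `UZ = U * Z`, compute `det (U_Sᵀ (U Z Uᵀ)⁻¹ U_S Z_S)`. -/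
def subdet (U UZ : Matrix (Fin d) (Fin n) V) (W : Matrix (Fin d) (Fin d) V) (S : List (Fin n)) :
    Prog V V := do
  let A ← matMul (cols U S).transpose W
  let B ← matMul A (cols UZ S)
  matDet B

/-- The rank of `U_T`, found by extending an independent list `S` of columns by those columns of `T`
that keep its Gram determinant nonzero. -/
def rankFrom (U UZ : Matrix (Fin d) (Fin n) V) (W : Matrix (Fin d) (Fin d) V) :
    List (Fin n) → List (Fin n) → Prog V ℕ
  | S, [] => pure S.length
  | S, j :: T =>
      if S.length < d then do
        let x ← subdet U UZ W (j :: S)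
        let zero ← lit 0
        let isLe ← leq x zero
        if isLe then rankFrom U UZ W S T else rankFrom U UZ W (j :: S) T
      else pure S.length

/-- The nearest integer to `t ∈ [0, m]`, found by comparing `t` with `0 + 1/2, 1 + 1/2, …`; the
search starts at `k`, has `m` candidates after `k` left, and `half` is `1/2`. -/
def nearestFrom (t half : V) : ℕ → ℕ → Prog V ℕ
  | 0, k => pure k
  | m + 1, k => do
      let c ← lit k
      let s ← add c half
      let isLe ← leq t s
      if isLe then pure k else nearestFrom t half m (k + 1)

/-- Greedy selection: add to `G`, one at a time, `k` elements of `T` that maximize the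
subdeterminant. -/
def greedy (U UZ : Matrix (Fin d) (Fin n) V) (W : Matrix (Fin d) (Fin d) V) (T : List (Fin n)) :
    ℕ → List (Fin n) → Prog V (List (Fin n))
  | 0, G => pure G
  | k + 1, G => do
      let best ← argmax (fun i => subdet U UZ W (i :: G)) (T.filter (fun i => i ∉ G))
      match best with
      | none => pure G
      | some (i, _) => greedy U UZ W T k (i :: G)

/-- Local search: make the best exchange `D - i + j` as long as it increases the subdeterminant by a
factor larger than 2.  The first argument bounds the number of passes through the (unbounded) loop
that are unrolled; the program does not return if it is too small. -/
def localSearch (U UZ : Matrix (Fin d) (Fin n) V) (W : Matrix (Fin d) (Fin d) V)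
    (T : List (Fin n)) : ℕ → List (Fin n) → Prog V (List (Fin n))
  | 0, _ => .diverge
  | fuel + 1, D => do
      let cur ← subdet U UZ W D
      let best ← argmax (fun e : Fin n × Fin n => subdet U UZ W (e.2 :: D.erase e.1))
        (D.product (T.filter (fun j => j ∉ D)))
      match best with
      | none => pure D
      | some ((i, j), v) => do
          let two ← lit 2
          let bound ← mul two cur
          let isLe ← leq v bound
          if isLe then pure D else localSearch U UZ W T fuel (j :: D.erase i)

/-- Greedy selection of `p` columns in `T` followed by local search. -/
def detLocalOpt (fuel : ℕ) (U UZ : Matrix (Fin d) (Fin n) V) (W : Matrix (Fin d) (Fin d) V)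
    (T : List (Fin n)) (p : ℕ) : Prog V (List (Fin n)) := do
  let G ← greedy U UZ W T p []
  localSearch U UZ W T fuel G

/-- The approximation algorithm for the sum of the eigenvalues below `1/2` of
`U_T Z_T U_Tᵀ (U Z Uᵀ)⁻¹`. -/
def approxSmallEigenSum (fuel : ℕ) (U : Matrix (Fin d) (Fin n) V) (z : Fin n → V)
    (T : List (Fin n)) : Prog V V := do
  let UZ ← buildMatrix d n (fun i j => mul (U i j) (z j))
  let M ← weightedGram U UZ (List.finRange n)
  let W ← matInv M
  let MT ← weightedGram U UZ T
  let X ← matMul MT W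
  let t ← trace X
  let one ← lit 1
  let two ← lit 2
  let half ← div one two
  let p ← nearestFrom t half d 0
  let r ← rankFrom U UZ W [] T
  if p = r then lit 0
  else if p = 0 then pure t
  else do
    let D ← detLocalOpt fuel U UZ W T p
    let A ← matMul (cols U D).transpose W
    let B ← matMul A (cols U D)
    let B' ← matInv B
    let C ← matMul (cols U D) B'
    let P ← matMul C A
    let zero ← lit 0
    let Q ← buildMatrix d d (fun i j => sub (if i = j then one else zero) (P i j))
    let Y ← matMul Q X
    trace Y

end Programs

/-! ### The spectrum and the size of rational numbers -/

/-- The eigenvalues of `U_T Z_T U_Tᵀ (U Z Uᵀ)⁻¹`, listed with their algebraic multiplicities.  (For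
`U` of full row rank and `z > 0` this matrix is similar to a symmetric one, so there are `d`.) -/
noncomputable def relSpectrum {d n : ℕ} (U : Matrix (Fin d) (Fin n) ℝ) (z : Fin n → ℝ)
    (T : Finset (Fin n)) : Multiset ℝ :=
  let UT : Matrix (Fin d) T ℝ := U.submatrix id (fun j => j.1)
  let ZT : Matrix T T ℝ := Matrix.diagonal (fun j => z j.1)
  (UT * ZT * UT.transpose * (U * Matrix.diagonal z * U.transpose)⁻¹).charpoly.roots

/-- The sum of the elements below `1/2`. -/
noncomputable def smallSum (μ : Multiset ℝ) : ℝ := (μ.filter (fun x => x < 1 / 2)).sum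

/-- The number of bits of the numerator and the denominator of `q` in lowest terms. -/
def bitLength (q : ℚ) : ℕ := q.num.natAbs.size + q.den.size

/-- `x` is a rational number that can be written with at most `b` bits. -/
def HasBits (x : ℝ) (b : ℕ) : Prop := ∃ q : ℚ, (q : ℝ) = x ∧ bitLength q ≤ b

end FrameScaling

namespace FrameScaling

/-! ### Sequential composition -/

section Metatheory

variable {K : Type} [Field K] [LinearOrder K] {V α β γ : Type}

/-! Whitening removes `U` and `z`. Since `(U Z Uᵀ)⁻¹` factors as `RᵀR`, and `R` may still be
rotated, `V = R U √Z` can be chosen with `V Vᵀ = 1` and `V_T V_Tᵀ = diag μ` (`exists_isWhitening`).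
Then every `μ i` lies in `[0, 1]`, the algorithm's `Δ(S)` is the Gram determinant `sqVol V S`, and
its output is `∑ (1 - w i) μ i`, where `w` is the diagonal of the orthogonal projection onto the
span of the columns in `D`. The hypothesis on `μ` makes the trace round to the number `p` of
eigenvalues at least `1/2`.

Lower bound: `w` has entries in `[0, 1]` and sum `p`, so it removes least when it sits on the `p`
large eigenvalues (`smallPart_le_sum`). Upper bound: expanding determinants gives `∑_{j ∈ T} Δ(D +
j) = Δ(D) ∑ (1 - w i) μ i` (`sum_sqVol_cons`), so it is enough to bound each `Δ(D + j)`. Among the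
`p + 1` columns of `D + j` some combination is orthogonal to all large eigendirections, which forces
`1 ≤ μ_s tr G⁻¹` for their Gram matrix `G` (`one_le_smallPart_mul_trace`). By Cramer's rule `tr G⁻¹`
is the sum of the principal minors `Δ(D)` and `Δ(D - i + j)` divided by `Δ(D + j)`, and local
optimality bounds these by `2 Δ(D)`. Hence `Δ(D + j) ≤ (2p + 1) μ_s Δ(D)`, and there are at most `n`
choices of `j`.

Running time: by the same identity a greedy step loses at most a factor `2n`, so greedy ends with `Δ
≥ (2n)^(-p)`. Every exchange more than doubles `Δ`, which never exceeds `1` (`sqVol_le_one`), so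
there are `O(d log n)` exchanges, each examining at most `dn` pairs.

Strong polynomiality has two parts. `Prog.expand_run` replaces each matrix instruction by elementary
code with the same value and polynomial cost; the Faddeev–LeVerrier recursion is correct because it
generates the coefficients of the adjugate of `X - A`. Bit lengths are controlled by keeping each
matrix over one common denominator. Each subdeterminant is computed anew from the same three
matrices, so loops do not accumulate bits, and only a bounded number of matrix operations are ever
nested. -/

theorem bind_def (p : Prog V α) (f : α → Prog V β) : p >>= f = p.bind f := rfl

theorem Prog.bind_assoc (p : Prog V α) (f : α → Prog V β) (g : β → Prog V γ) :
    (p.bind f).bind g = p.bind (fun a => (f a).bind g) := by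
  induction p with
  | ret a => rfl
  | diverge => rfl
  | lit c k ih => simp only [Prog.bind, ih]
  | arith o x y k ih => simp only [Prog.bind, ih]
  | le x y k ih => simp only [Prog.bind, ih]
  | matMul A B k ih => simp only [Prog.bind, ih]
  | matDet A k ih => simp only [Prog.bind, ih]
  | matInv A k ih => simp only [Prog.bind, ih]

/-- Sequential composition of execution results. -/
def seqRun (r : Option (α × List (Event K))) (f : α → Option (β × List (Event K))) :
    Option (β × List (Event K)) :=
  r.bind (fun x => (f x.1).map (fun y => (y.1, x.2 ++ y.2)))

theorem seqRun_map_cons {K : Type} (r : Option (α × List (Event K)))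
    (f : α → Option (β × List (Event K))) (e : Event K) :
    seqRun (r.map (fun x => (x.1, e :: x.2))) f
      = (seqRun r f).map (fun x => (x.1, e :: x.2)) := by
  cases r with
  | none => rfl
  | some x => cases h : f x.1 <;> simp [seqRun, h]

theorem Prog.run_bind (p : Prog K α) (f : α → Prog K β) :
    (p.bind f).run = seqRun p.run (fun a => (f a).run) := by
  induction p with
  | ret a => cases h : (f a).run <;> simp [Prog.bind, Prog.run, seqRun, h]
  | diverge => rfl
  | lit c k ih => simp only [Prog.bind, Prog.run, ih, seqRun_map_cons]
  | arith o x y k ih =>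
    simp only [Prog.bind, Prog.run]
    cases o.eval x y with
    | none => rfl
    | some v => simp only [ih, seqRun_map_cons]
  | le x y k ih => simp only [Prog.bind, Prog.run, ih, seqRun_map_cons]
  | matMul A B k ih => simp only [Prog.bind, Prog.run, ih, seqRun_map_cons]
  | matDet A k ih => simp only [Prog.bind, Prog.run, ih, seqRun_map_cons]
  | matInv A k ih =>
    simp only [Prog.bind, Prog.run]
    split_ifs
    · rfl
    · simp only [ih, seqRun_map_cons]

theorem Prog.expand_bind (p : Prog V α) (f : α → Prog V β) :
    (p.bind f).expand = p.expand.bind (fun a => (f a).expand) := by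
  induction p with
  | ret a => rfl
  | diverge => rfl
  | lit c k ih => simp only [Prog.bind, Prog.expand, ih]
  | arith o x y k ih => simp only [Prog.bind, Prog.expand, ih]
  | le x y k ih => simp only [Prog.bind, Prog.expand, ih]
  | matMul A B k ih => simp only [Prog.bind, Prog.expand, ih, Prog.bind_assoc]
  | matDet A k ih => simp only [Prog.bind, Prog.expand, ih, Prog.bind_assoc]
  | matInv A k ih => simp only [Prog.bind, Prog.expand, ih, Prog.bind_assoc]

/-! ### Total correctness with instruction counts -/

/-- `p` returns a result with property `Q`, executing at most `c` instructions, all with events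
satisfying `ok`. -/
def Succeeds (ok : Event K → Prop) (c : ℕ) (p : Prog K α) (Q : α → Prop) : Prop :=
  ∃ a L, p.run = some (a, L) ∧ Q a ∧ L.length ≤ c ∧ ∀ e ∈ L, ok e

/-- If `p` returns, then the result has property `Q` and all events satisfy `ok`. -/
def Ensures (ok : Event K → Prop) (p : Prog K α) (Q : α → Prop) : Prop :=
  ∀ a L, p.run = some (a, L) → Q a ∧ ∀ e ∈ L, ok e

variable {ok : Event K → Prop} {c c' : ℕ} {p : Prog K α} {Q Q' : α → Prop}

theorem Succeeds.mono (h : Succeeds ok c p Q) (hc : c ≤ c') (hQ : ∀ a, Q a → Q' a) :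
    Succeeds ok c' p Q' := by
  obtain ⟨a, L, h1, h2, h3, h4⟩ := h
  exact ⟨a, L, h1, hQ a h2, h3.trans hc, h4⟩

theorem Succeeds.bind {f : α → Prog K β} {R : β → Prop} (h : Succeeds ok c p Q)
    (hf : ∀ a, Q a → Succeeds ok c' (f a) R) : Succeeds ok (c + c') (p >>= f) R := by
  obtain ⟨a, L, h1, h2, h3, h4⟩ := h
  obtain ⟨b, L', h1', h2', h3', h4'⟩ := hf a h2
  refine ⟨b, L ++ L', ?_, h2', ?_, ?_⟩
  · rw [bind_def, Prog.run_bind, h1]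
    simp [seqRun, h1']
  · simpa using Nat.add_le_add h3 h3'
  · intro e he
    rcases List.mem_append.mp he with he | he
    exacts [h4 e he, h4' e he]

theorem Succeeds.pure {a : α} (h : Q a) : Succeeds ok 0 (pure a : Prog K α) Q :=
  ⟨a, [], rfl, h, le_rfl, by simp⟩

/-- Lets a branch that returns early absorb the unused part of the instruction budget. -/
theorem Succeeds.pure_le {a : α} (h : Q a) : Succeeds ok c (Pure.pure a : Prog K α) Q :=
  (Succeeds.pure h).mono (Nat.zero_le c) fun _ => id

theorem Succeeds.lit (k : ℕ) (hok : ok (.scalar (k : K))) :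
    Succeeds ok 1 (FrameScaling.lit k) (fun x : K => x = k) :=
  ⟨(k : K), [.scalar (k : K)], rfl, rfl, le_rfl, by simpa using hok⟩

theorem Succeeds.add (x y : K) (hok : ok (.scalar (x + y))) :
    Succeeds ok 1 (FrameScaling.add x y) (fun v => v = x + y) :=
  ⟨_, [.scalar (x + y)], rfl, rfl, le_rfl, by simpa using hok⟩

theorem Succeeds.sub (x y : K) (hok : ok (.scalar (x - y))) :
    Succeeds ok 1 (FrameScaling.sub x y) (fun v => v = x - y) :=
  ⟨_, [.scalar (x - y)], rfl, rfl, le_rfl, by simpa using hok⟩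

theorem Succeeds.mul (x y : K) (hok : ok (.scalar (x * y))) :
    Succeeds ok 1 (FrameScaling.mul x y) (fun v => v = x * y) :=
  ⟨_, [.scalar (x * y)], rfl, rfl, le_rfl, by simpa using hok⟩

theorem Succeeds.div (x y : K) (hy : y ≠ 0) (hok : ok (.scalar (x / y))) :
    Succeeds ok 1 (FrameScaling.div x y) (fun v => v = x / y) :=
  ⟨_, [.scalar (x / y)], by simp [FrameScaling.div, Prog.run, ArithOp.eval, hy], rfl, le_rfl,
    by simpa using hok⟩

theorem Succeeds.leq (x y : K) (hok : ok .compare) :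
    Succeeds ok 1 (FrameScaling.leq x y) (fun b => b = decide (x ≤ y)) :=
  ⟨_, [.compare], rfl, rfl, le_rfl, by simpa using hok⟩

theorem Succeeds.matMul {a b c : ℕ} (A : Matrix (Fin a) (Fin b) K) (B : Matrix (Fin b) (Fin c) K)
    (hok : ok (.matrix (max a (max b c)))) :
    Succeeds ok 1 (FrameScaling.matMul A B) (fun C => C = A * B) :=
  ⟨_, [.matrix (max a (max b c))], rfl, rfl, le_rfl, by simpa using hok⟩

theorem Succeeds.matDet {m : ℕ} (A : Matrix (Fin m) (Fin m) K) (hok : ok (.matrix m)) :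
    Succeeds ok 1 (FrameScaling.matDet A) (fun x => x = A.det) :=
  ⟨_, [.matrix m], rfl, rfl, le_rfl, by simpa using hok⟩

theorem Succeeds.matInv {m : ℕ} (A : Matrix (Fin m) (Fin m) K) (hA : A.det ≠ 0)
    (hok : ok (.matrix m)) :
    Succeeds ok 1 (FrameScaling.matInv A) (fun C => C = A⁻¹) :=
  ⟨_, [.matrix m], by simp [FrameScaling.matInv, Prog.run, hA], rfl, le_rfl, by simpa using hok⟩

/-! ### Partial correctness -/

theorem Ensures.mono (h : Ensures ok p Q) (hQ : ∀ a, Q a → Q' a) : Ensures ok p Q' :=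
  fun a L hr => ⟨hQ a (h a L hr).1, (h a L hr).2⟩

theorem Ensures.bind {f : α → Prog K β} {R : β → Prop} (h : Ensures ok p Q)
    (hf : ∀ a, Q a → Ensures ok (f a) R) : Ensures ok (p.bind f) R := by
  intro b L hr
  rw [Prog.run_bind] at hr
  cases hp : p.run with
  | none => simp [hp, seqRun] at hr
  | some x =>
    obtain ⟨a, L1⟩ := x
    cases hfa : (f a).run with
    | none => simp [hp, seqRun, hfa] at hr
    | some y =>
      obtain ⟨b', L2⟩ := y
      simp only [hp, seqRun, Option.bind_some, hfa, Option.map_some, Option.some.injEq,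
        Prod.mk.injEq] at hr
      obtain ⟨rfl, rfl⟩ := hr
      have h1 := h a L1 hp
      have h2 := hf a h1.1 b' L2 hfa
      refine ⟨h2.1, fun e he => ?_⟩
      rcases List.mem_append.mp he with he | he
      exacts [h1.2 e he, h2.2 e he]

theorem Ensures.ret {a : α} (h : Q a) : Ensures ok (.ret a : Prog K α) Q := by
  intro b L hr
  simp only [Prog.run, Option.some.injEq, Prod.mk.injEq] at hr
  obtain ⟨rfl, rfl⟩ := hr
  exact ⟨h, by simp⟩

/-! ### Elementary programs -/

/-- The program contains no matrix computation: expansion does not change it. -/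
def IsElementary (p : Prog V α) : Prop := p.expand = p

theorem IsElementary.bind {p : Prog V α} {f : α → Prog V β} (hp : IsElementary p)
    (hf : ∀ a, IsElementary (f a)) : IsElementary (p >>= f) := by
  unfold IsElementary at *
  rw [bind_def, Prog.expand_bind, hp]
  simp only [hf]

theorem IsElementary.pure (a : α) : IsElementary (pure a : Prog V α) := rfl
theorem IsElementary.lit (k : ℕ) : IsElementary (FrameScaling.lit k : Prog V V) := rfl
theorem IsElementary.add (x y : V) : IsElementary (FrameScaling.add x y) := rfl
theorem IsElementary.sub (x y : V) : IsElementary (FrameScaling.sub x y) := rfl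
theorem IsElementary.mul (x y : V) : IsElementary (FrameScaling.mul x y) := rfl
theorem IsElementary.div (x y : V) : IsElementary (FrameScaling.div x y) := rfl

theorem IsElementary.forFin : ∀ (m : ℕ) (f : Fin m → Prog V β), (∀ i, IsElementary (f i)) →
    IsElementary (forFin m f)
  | 0, _, _ => .pure _
  | m + 1, _, h => (h 0).bind fun _ => (IsElementary.forFin m _ fun i => h i.succ).bind
      fun _ => .pure _

theorem IsElementary.buildMatrix (a b : ℕ) (f : Fin a → Fin b → Prog V V)
    (h : ∀ i j, IsElementary (f i j)) : IsElementary (buildMatrix a b f) :=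
  .forFin _ _ fun i => .forFin _ _ fun j => h i j

theorem IsElementary.sumFrom : ∀ (m : ℕ) (acc : V) (f : Fin m → Prog V V),
    (∀ i, IsElementary (f i)) → IsElementary (sumFrom acc m f)
  | 0, _, _, _ => .pure _
  | m + 1, _, _, h => (h 0).bind fun _ => (IsElementary.add _ _).bind
      fun _ => IsElementary.sumFrom m _ _ fun i => h i.succ

theorem IsElementary.trace {m : ℕ} (A : Matrix (Fin m) (Fin m) V) : IsElementary (trace A) :=
  (IsElementary.lit 0).bind fun _ => .sumFrom _ _ _ fun _ => .pure _

theorem IsElementary.mulElem {a b c : ℕ} (A : Matrix (Fin a) (Fin b) V)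
    (B : Matrix (Fin b) (Fin c) V) : IsElementary (mulElem A B) :=
  (IsElementary.lit 0).bind fun _ => .buildMatrix _ _ _ fun _ _ => .sumFrom _ _ _ fun _ => .mul _ _

theorem IsElementary.leverrier {m : ℕ} (A : Matrix (Fin m) (Fin m) V) :
    ∀ k, IsElementary (leverrier A k)
  | 0 => (IsElementary.lit 0).bind fun _ => (IsElementary.lit 1).bind fun _ => .pure _
  | k + 1 => (IsElementary.leverrier A k).bind fun x => by
      refine IsElementary.bind (.buildMatrix _ _ _ fun i j => ?_) fun M => ?_
      · split_ifs
        exacts [.add _ _, .pure _]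
      · exact (IsElementary.mulElem _ _).bind fun _ => (IsElementary.trace _).bind fun _ =>
          (IsElementary.lit _).bind fun _ => (IsElementary.div _ _).bind fun _ =>
          (IsElementary.lit _).bind fun _ => (IsElementary.sub _ _).bind fun _ => .pure _

theorem IsElementary.detElem {m : ℕ} (A : Matrix (Fin m) (Fin m) V) : IsElementary (detElem A) :=
  (IsElementary.leverrier A m).bind fun x => by
    dsimp only
    split_ifs
    exacts [.pure _, (IsElementary.lit _).bind fun _ => .sub _ _]

theorem IsElementary.invElem {m : ℕ} (A : Matrix (Fin m) (Fin m) V) : IsElementary (invElem A) :=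
  (IsElementary.leverrier A m).bind fun _ => (IsElementary.lit _).bind fun _ =>
    (IsElementary.sub _ _).bind fun _ => .buildMatrix _ _ _ fun _ _ => .div _ _

/-! ### Loops -/

theorem Succeeds.forFin {c : ℕ} : ∀ (m : ℕ) (f : Fin m → Prog K β) (R : Fin m → β → Prop),
    (∀ i, Succeeds ok c (f i) (R i)) →
    Succeeds ok (m * c) (forFin m f) (fun g => ∀ i, R i (g i))
  | 0, _, _, _ => by
      rw [Nat.zero_mul]
      exact Succeeds.pure fun i => i.elim0
  | m + 1, f, R, h => by
      rw [show (m + 1) * c = c + (m * c + 0) by ring]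
      refine (h 0).bind fun x hx => ?_
      refine (Succeeds.forFin m _ (fun i => R i.succ) fun i => h i.succ).bind fun g hg => ?_
      exact .pure (Fin.cases hx hg)

theorem Succeeds.buildMatrix {c : ℕ} (a b : ℕ) (f : Fin a → Fin b → Prog K K)
    (M : Matrix (Fin a) (Fin b) K) (h : ∀ i j, Succeeds ok c (f i j) (fun x => x = M i j)) :
    Succeeds ok (a * (b * c)) (buildMatrix a b f) (fun A => A = M) :=
  (Succeeds.forFin a _ _ fun i => Succeeds.forFin b _ _ fun j => h i j).mono le_rfl
    fun _ hA => funext fun i => funext fun j => hA i j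

theorem Succeeds.sumFrom {c : ℕ} (hok : ∀ x, ok (.scalar x)) :
    ∀ (m : ℕ) (acc : K) (f : Fin m → Prog K K) (v : Fin m → K),
    (∀ i, Succeeds ok c (f i) (fun x => x = v i)) →
    Succeeds ok (m * (c + 1)) (sumFrom acc m f) (fun x => x = acc + ∑ i, v i)
  | 0, acc, _, _, _ => by
      rw [Nat.zero_mul]
      exact Succeeds.pure (by simp)
  | m + 1, acc, f, v, h => by
      rw [show (m + 1) * (c + 1) = c + (1 + m * (c + 1)) by ring]
      refine (h 0).bind fun x hx => ?_
      refine (Succeeds.add _ _ (hok _)).bind fun y hy => ?_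
      refine (Succeeds.sumFrom hok m y _ (fun i => v i.succ) fun i => h i.succ).mono le_rfl ?_
      rintro a rfl
      rw [hy, hx, Fin.sum_univ_succ, add_assoc]

theorem Succeeds.trace (hok : ∀ x, ok (.scalar x)) {m : ℕ} (A : Matrix (Fin m) (Fin m) K) :
    Succeeds ok (m + 1) (trace A) (fun x => x = A.trace) := by
  rw [show m + 1 = 1 + m * (0 + 1) by ring]
  refine (Succeeds.lit 0 (hok _)).bind fun z hz => ?_
  refine (Succeeds.sumFrom hok m z _ (fun i => A i i) fun i => .pure rfl).mono le_rfl ?_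
  rintro a rfl
  simp [hz, Matrix.trace]

theorem Succeeds.mulElem (hok : ∀ x, ok (.scalar x)) {a b c : ℕ} (A : Matrix (Fin a) (Fin b) K)
    (B : Matrix (Fin b) (Fin c) K) :
    Succeeds ok (1 + a * (c * (b * 2))) (mulElem A B) (fun C => C = A * B) := by
  refine (Succeeds.lit 0 (hok _)).bind fun z hz => ?_
  refine Succeeds.buildMatrix _ _ _ _ fun i k => ?_
  refine (Succeeds.sumFrom hok b z _ (fun j => A i j * B j k) fun j =>
    Succeeds.mul _ _ (hok _)).mono le_rfl ?_
  rintro a rfl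
  simp [hz, Matrix.mul_apply]

end Metatheory

end FrameScaling

namespace FrameScaling

/-! ### Correctness of the Faddeev–LeVerrier recursion -/

section Leverrier

open Polynomial
open scoped Matrix

variable {K : Type} [Field K] {m : ℕ}

/-- Jacobi's formula for the characteristic polynomial. -/
theorem derivative_charpoly (A : Matrix (Fin m) (Fin m) K) :
    derivative A.charpoly = (Matrix.adjugate A.charmatrix).trace := by
  classical
  have hd : ∀ i j, derivative (A.charmatrixᵀ i j) = (1 : Matrix (Fin m) (Fin m) K[X]) i j := by
    intro i j
    by_cases h : i = j
    · subst h; simp [Matrix.charmatrix_apply_eq]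
    · simp [h, Ne.symm h]
  -- `Matrix.adjugate_def` is stated through Cramer determinants of the transpose. After
  -- transposing, both sides are sums over the same permutations, with the factor at `i` replaced by
  -- its derivative.
  rw [Matrix.charpoly, ← Matrix.det_transpose, Matrix.det_apply', derivative_sum]
  have h1 : ∀ i : Fin m, (Matrix.adjugate A.charmatrix) i i
      = ∑ σ : Equiv.Perm (Fin m), (↑(↑(Equiv.Perm.sign σ) : ℤ) : K[X]) *
        ((∏ j ∈ Finset.univ.erase i, A.charmatrixᵀ (σ j) j) *
          (1 : Matrix (Fin m) (Fin m) K[X]) (σ i) i) := by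
    intro i
    rw [Matrix.adjugate_def, Matrix.of_apply, Matrix.cramer_apply, Matrix.det_apply']
    refine Finset.sum_congr rfl fun σ _ => ?_
    rw [← Finset.prod_erase_mul _ _ (Finset.mem_univ i)]
    congr 2
    · refine Finset.prod_congr rfl fun j hj => ?_
      rw [Matrix.updateCol_ne (Finset.ne_of_mem_erase hj)]
    · rw [Matrix.updateCol_self, Matrix.one_apply, Pi.single_apply]
  simp only [Matrix.trace, Matrix.diag_apply, h1]
  rw [Finset.sum_comm]
  refine Finset.sum_congr rfl fun σ _ => ?_
  rw [← Finset.mul_sum, derivative_mul, derivative_intCast, zero_mul, zero_add,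
    derivative_prod_finset]
  simp only [hd]

/-- The matrix coefficients of the adjugate of the characteristic matrix. -/
noncomputable def adjCoeff (A : Matrix (Fin m) (Fin m) K) (j : ℕ) : Matrix (Fin m) (Fin m) K :=
  (matPolyEquiv (Matrix.adjugate A.charmatrix)).coeff j

/-- This is `(X - A) adj(X - A) = χ_A(X)`, read as an identity of polynomials with matrix
coefficients. Comparing coefficients produces the recursion. -/
theorem X_sub_C_mul_adj (A : Matrix (Fin m) (Fin m) K) :
    (X - C A) * matPolyEquiv (Matrix.adjugate A.charmatrix)
      = A.charpoly.map (algebraMap K (Matrix (Fin m) (Fin m) K)) := by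
  rw [← Matrix.matPolyEquiv_charmatrix, ← map_mul, Matrix.mul_adjugate, ← Matrix.charpoly]
  exact matPolyEquiv_smul_one _

theorem mul_adjCoeff_zero (A : Matrix (Fin m) (Fin m) K) :
    A * adjCoeff A 0 = -(A.charpoly.coeff 0 • (1 : Matrix (Fin m) (Fin m) K)) := by
  have h := congrArg (fun p => p.coeff 0) (X_sub_C_mul_adj A)
  simp only [sub_mul, coeff_sub, coeff_map, mul_coeff_zero, coeff_X_zero, zero_mul,
    coeff_C_zero, zero_sub, Algebra.algebraMap_eq_smul_one] at h
  rw [← h, neg_neg, adjCoeff]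

theorem mul_adjCoeff_succ (A : Matrix (Fin m) (Fin m) K) (j : ℕ) :
    adjCoeff A j = A * adjCoeff A (j + 1)
      + A.charpoly.coeff (j + 1) • (1 : Matrix (Fin m) (Fin m) K) := by
  have h := congrArg (fun p => p.coeff (j + 1)) (X_sub_C_mul_adj A)
  simp only [sub_mul, coeff_sub, coeff_map, coeff_C_mul, coeff_X_mul,
    Algebra.algebraMap_eq_smul_one] at h
  rw [← h, adjCoeff, adjCoeff]
  abel

/-- No degree bound for the adjugate is needed: its coefficients vanish eventually, and above the
degree of the characteristic polynomial the recursion carries this vanishing down to index `m`. -/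
theorem adjCoeff_eq_zero (A : Matrix (Fin m) (Fin m) K) (j : ℕ) (hj : m ≤ j) :
    adjCoeff A j = 0 := by
  have hbig : ∀ i, adjCoeff A ((matPolyEquiv (Matrix.adjugate A.charmatrix)).natDegree + 1 + i)
      = 0 := fun i => coeff_eq_zero_of_natDegree_lt (by omega)
  have hdeg : ∀ i, m < i → A.charpoly.coeff i = 0 := fun i hi =>
    coeff_eq_zero_of_natDegree_lt (by rw [Matrix.charpoly_natDegree_eq_dim]; simpa using hi)
  have hstep : ∀ k j, m ≤ j → adjCoeff A (j + k) = 0 → adjCoeff A j = 0 := by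
    intro k
    induction k with
    | zero => intro j _ h; simpa using h
    | succ k ih =>
      intro j hj h
      rw [mul_adjCoeff_succ, ih (j + 1) (by omega) (by rw [← h]; congr 1; omega),
        hdeg (j + 1) (by omega)]
      simp
  exact hstep ((matPolyEquiv (Matrix.adjugate A.charmatrix)).natDegree + 1) j hj
    (by rw [add_comm]; exact hbig j)

theorem trace_adjCoeff (A : Matrix (Fin m) (Fin m) K) (j : ℕ) :
    (adjCoeff A j).trace = (j + 1) * A.charpoly.coeff (j + 1) := by
  have h := congrArg (fun p => p.coeff j) (derivative_charpoly A)
  simp only [coeff_derivative, Matrix.trace, Matrix.diag_apply, finsetSum_coeff] at h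
  rw [mul_comm, h, Matrix.trace]
  simp [adjCoeff, matPolyEquiv_coeff_apply]

/-- Jacobi's formula inserted into the trace of the recursion. At `j = m - (k + 1)` the factor `m -
j` is `k + 1`, which is why the algorithm divides by it. -/
theorem trace_mul_adjCoeff (A : Matrix (Fin m) (Fin m) K) (j : ℕ) :
    (A * adjCoeff A j).trace = -((m - j : K) * A.charpoly.coeff j) := by
  cases j with
  | zero => simp [mul_adjCoeff_zero, Matrix.trace_neg, Matrix.trace_smul, mul_comm]
  | succ j =>
    have h := congrArg Matrix.trace (mul_adjCoeff_succ A j)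
    rw [Matrix.trace_add, trace_adjCoeff, Matrix.trace_smul, Matrix.trace_one] at h
    simp only [smul_eq_mul, Fintype.card_fin] at h
    push_cast
    linear_combination -h

theorem det_eq_coeff_zero (A : Matrix (Fin m) (Fin m) K) :
    A.det = (-1) ^ m * A.charpoly.coeff 0 := by
  rw [Matrix.det_eq_sign_charpoly_coeff, Fintype.card_fin]

end Leverrier

/-! ### Correctness and cost of the elementary matrix computations. -/

section ExpandCorrect

variable {K : Type} [Field K] [LinearOrder K] [CharZero K] {m : ℕ}

/-- The recursion reads the coefficients from the top down, starting from the vanishing coefficient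
of the adjugate at `m` and the leading coefficient `1` of the characteristic polynomial. The `4` in
the cost counts the two literals, the division and the subtraction of a step. -/
theorem Succeeds.leverrier {ok : Event K → Prop} (hok : ∀ x, ok (.scalar x))
    (A : Matrix (Fin m) (Fin m) K) : ∀ k, k ≤ m →
    Succeeds ok (2 + k * (m * (m * 1) + (1 + m * (m * (m * 2)) + (m + 1 + 4)))) (leverrier A k)
      (fun r => r = (adjCoeff A (m - k), A * adjCoeff A (m - k), A.charpoly.coeff (m - k)))
  | 0, _ => by
      rw [Nat.zero_mul]
      refine (Succeeds.lit 0 (hok _)).bind (c' := 1) fun z hz => ?_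
      refine (Succeeds.lit 1 (hok _)).bind (c' := 0) fun o ho => ?_
      have h1 : A.charpoly.coeff m = 1 := by
        have := A.charpoly_monic
        rwa [Polynomial.Monic, Polynomial.leadingCoeff, Matrix.charpoly_natDegree_eq_dim,
          Fintype.card_fin] at this
      refine .pure ?_
      rw [Nat.sub_zero, adjCoeff_eq_zero A m le_rfl, h1, hz, ho, Matrix.mul_zero]
      simp only [Nat.cast_zero, Nat.cast_one]
      rfl
  | k + 1, hk => by
      have hm : m - k = m - (k + 1) + 1 := by omega
      rw [Nat.succ_mul, ← Nat.add_assoc]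
      refine (Succeeds.leverrier hok A k (by omega)).bind ?_
      rintro _ rfl
      refine (Succeeds.buildMatrix (c := 1) _ _ _ (adjCoeff A (m - (k + 1)))
        fun i j => ?_).bind ?_
      · have hB := mul_adjCoeff_succ A (m - (k + 1))
        rw [← hm] at hB
        rw [hB]
        split_ifs with h
        · refine (Succeeds.add _ _ (hok _)).mono le_rfl ?_
          rintro _ rfl
          simp [h]
        · refine (Succeeds.pure (Q := fun x => x = _) ?_).mono zero_le_one fun _ => id
          simp [h]
      rintro _ rfl
      refine (Succeeds.mulElem hok _ _).bind ?_
      rintro _ rfl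
      refine (Succeeds.trace hok _).bind ?_
      rintro _ rfl
      refine (Succeeds.lit (k + 1) (hok _)).bind (c' := 3) ?_
      rintro _ rfl
      -- Characteristic zero is essential here: the recursion divides by `1, …, m`.
      have hk0 : ((k + 1 : ℕ) : K) ≠ 0 := by exact_mod_cast k.succ_ne_zero
      refine (Succeeds.div _ _ hk0 (hok _)).bind (c' := 2) ?_
      rintro _ rfl
      refine (Succeeds.lit 0 (hok _)).bind (c' := 1) ?_
      rintro _ rfl
      refine (Succeeds.sub _ _ (hok _)).bind (c' := 0) ?_
      rintro _ rfl
      refine .pure ?_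
      congr 2
      have hc : ((m - (k + 1) : ℕ) : K) = m - (k + 1 : ℕ) := Nat.cast_sub hk
      rw [trace_mul_adjCoeff, hc]
      field_simp
      ring

theorem Succeeds.detElem {ok : Event K → Prop} (hok : ∀ x, ok (.scalar x))
    (A : Matrix (Fin m) (Fin m) K) :
    Succeeds ok (2 + m * (m * (m * 1) + (1 + m * (m * (m * 2)) + (m + 1 + 4))) + 2) (detElem A)
      (fun x => x = A.det) := by
  refine (Succeeds.leverrier hok A m le_rfl).bind ?_
  rintro _ rfl
  have h := det_eq_coeff_zero A
  split_ifs with hm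
  · refine (Succeeds.pure (Q := fun x => x = _) ?_).mono (Nat.zero_le _) fun _ => id
    rw [h, (Nat.even_iff.mpr hm).neg_one_pow, one_mul, Nat.sub_self]
  · refine (Succeeds.lit 0 (hok _)).bind (c' := 1) ?_
    rintro _ rfl
    refine (Succeeds.sub _ _ (hok _)).mono le_rfl ?_
    rintro _ rfl
    rw [h, (Nat.odd_iff.mpr (Nat.mod_two_ne_zero.mp hm)).neg_one_pow, Nat.sub_self]
    simp

theorem Succeeds.invElem {ok : Event K → Prop} (hok : ∀ x, ok (.scalar x))
    (A : Matrix (Fin m) (Fin m) K) (hA : A.det ≠ 0) :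
    Succeeds ok (2 + m * (m * (m * 1) + (1 + m * (m * (m * 2)) + (m + 1 + 4))) +
        (1 + (1 + m * (m * 1)))) (invElem A) (fun C => C = A⁻¹) := by
  refine (Succeeds.leverrier hok A m le_rfl).bind ?_
  rintro _ rfl
  refine (Succeeds.lit 0 (hok _)).bind ?_
  rintro _ rfl
  refine (Succeeds.sub _ _ (hok _)).bind ?_
  rintro _ rfl
  rw [Nat.sub_self]
  have hc : A.charpoly.coeff 0 ≠ 0 := fun h => hA (by rw [det_eq_coeff_zero, h, mul_zero])
  have hc' : ((0 : ℕ) : K) - A.charpoly.coeff 0 ≠ 0 := by simpa using hc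
  refine Succeeds.buildMatrix _ _ _ _ fun i j => ?_
  refine (Succeeds.div _ _ hc' (hok _)).mono le_rfl ?_
  rintro _ rfl
  have hinv : A⁻¹ = (-A.charpoly.coeff 0)⁻¹ • adjCoeff A 0 := by
    refine Matrix.inv_eq_right_inv ?_
    rw [Matrix.mul_smul, mul_adjCoeff_zero, ← neg_smul, smul_smul,
      inv_mul_cancel₀ (neg_ne_zero.mpr hc), one_smul]
  rw [hinv, Matrix.smul_apply, smul_eq_mul, Nat.cast_zero, zero_sub, div_eq_inv_mul]

/-- Only comparisons and scalar operations. -/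
def Event.NoMatrix : Event K → Prop
  | .matrix _ => False
  | _ => True

/-- Matrix computations involve only matrices with at most `M` rows and columns. -/
def Event.DimLE (M : ℕ) : Event K → Prop
  | .matrix k => k ≤ M
  | _ => True

/-- A bound for the number of elementary operations of a matrix computation on matrices of side
at most `M`. -/
def elemCost (M : ℕ) : ℕ := 2 + M * (M * M + (1 + M * (M * (M * 2)) + (M + 1 + 4))) + (2 + M * M)
  + M * (M * (M * 2))

/-- Structural induction on the program. The given successful run supplies what the elementary code
needs: the dimension bounds from its events, and the nonsingularity of each inverted matrix from its
having returned. -/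
theorem Prog.expand_run {α : Type} {M : ℕ} : ∀ (p : Prog K α) (a : α) (L : List (Event K)),
    p.run = some (a, L) → (∀ e ∈ L, e.DimLE M) →
    Succeeds Event.NoMatrix (L.length * elemCost M) p.expand (fun b => b = a) := by
  have hok : ∀ x : K, Event.NoMatrix (.scalar x) := fun _ => trivial
  have hone : 1 ≤ elemCost M := by unfold elemCost; omega
  have hmat : ∀ {c : ℕ}, c ≤ elemCost M → ∀ l : List (Event K), ∀ e : Event K,
      c + l.length * elemCost M ≤ (e :: l).length * elemCost M := by
    intro c hc l e
    rw [List.length_cons, Nat.succ_mul]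
    omega
  intro p
  induction p with
  | ret a =>
    intro b L h _
    simp only [Prog.run, Option.some.injEq, Prod.mk.injEq] at h
    exact ⟨a, [], rfl, h.1, by simp, by simp⟩
  | diverge => intro b L h; simp [Prog.run] at h
  | lit c k ih =>
    intro b L h hL
    simp only [Prog.run, Option.map_eq_some_iff] at h
    obtain ⟨⟨b', l⟩, h1, h2⟩ := h
    obtain ⟨rfl, rfl⟩ := Prod.mk.inj h2
    refine Succeeds.mono ?_ (hmat hone l _) fun _ => id
    refine (Succeeds.lit c (hok _)).bind ?_
    rintro _ rfl
    exact ih _ _ _ h1 fun e he => hL e (List.mem_cons_of_mem _ he)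
  | arith o x y k ih =>
    intro b L h hL
    simp only [Prog.run] at h
    cases hv : o.eval x y with
    | none => simp [hv] at h
    | some v =>
      simp only [hv, Option.map_eq_some_iff] at h
      obtain ⟨⟨b', l⟩, h1, h2⟩ := h
      obtain ⟨rfl, rfl⟩ := Prod.mk.inj h2
      refine Succeeds.mono ?_ (hmat hone l _) fun _ => id
      obtain ⟨a, E, h3, h4, h5, h6⟩ := ih _ _ _ h1 fun e he => hL e (List.mem_cons_of_mem _ he)
      refine ⟨a, .scalar v :: E, by simp [Prog.expand, Prog.run, hv, h3], h4, by simp; omega, ?_⟩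
      exact List.forall_mem_cons.mpr ⟨hok v, h6⟩
  | le x y k ih =>
    intro b L h hL
    simp only [Prog.run, Option.map_eq_some_iff] at h
    obtain ⟨⟨b', l⟩, h1, h2⟩ := h
    obtain ⟨rfl, rfl⟩ := Prod.mk.inj h2
    refine Succeeds.mono ?_ (hmat hone l _) fun _ => id
    refine (Succeeds.leq x y trivial).bind ?_
    rintro _ rfl
    exact ih _ _ _ h1 fun e he => hL e (List.mem_cons_of_mem _ he)
  | @matMul r s t A B k ih =>
    intro b L h hL
    simp only [Prog.run, Option.map_eq_some_iff] at h
    obtain ⟨⟨b', l⟩, h1, h2⟩ := h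
    obtain ⟨rfl, rfl⟩ := Prod.mk.inj h2
    have hd : max r (max s t) ≤ M := hL _ List.mem_cons_self
    have hr : r ≤ M := (le_max_left _ _).trans hd
    have hs : s ≤ M := (le_max_left _ _).trans ((le_max_right _ _).trans hd)
    have ht : t ≤ M := (le_max_right _ _).trans ((le_max_right _ _).trans hd)
    have hcost : 1 + r * (t * (s * 2)) ≤ elemCost M := by
      have : r * (t * (s * 2)) ≤ M * (M * (M * 2)) := by gcongr
      unfold elemCost
      omega
    refine Succeeds.mono ?_ (hmat hcost l _) fun _ => id
    refine (Succeeds.mulElem hok A B).bind ?_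
    rintro _ rfl
    exact ih _ _ _ h1 fun e he => hL e (List.mem_cons_of_mem _ he)
  | @matDet m A k ih =>
    intro b L h hL
    simp only [Prog.run, Option.map_eq_some_iff] at h
    obtain ⟨⟨b', l⟩, h1, h2⟩ := h
    obtain ⟨rfl, rfl⟩ := Prod.mk.inj h2
    have hd : m ≤ M := hL _ List.mem_cons_self
    have hcost : 2 + m * (m * (m * 1) + (1 + m * (m * (m * 2)) + (m + 1 + 4))) + 2 ≤ elemCost M := by
      have : m * (m * (m * 1) + (1 + m * (m * (m * 2)) + (m + 1 + 4))) ≤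
          M * (M * M + (1 + M * (M * (M * 2)) + (M + 1 + 4))) := by
        rw [Nat.mul_one]; gcongr
      unfold elemCost
      omega
    refine Succeeds.mono ?_ (hmat hcost l _) fun _ => id
    refine (Succeeds.detElem hok A).bind ?_
    rintro _ rfl
    exact ih _ _ _ h1 fun e he => hL e (List.mem_cons_of_mem _ he)
  | @matInv m A k ih =>
    intro b L h hL
    simp only [Prog.run] at h
    split_ifs at h with hA
    simp only [Option.map_eq_some_iff] at h
    obtain ⟨⟨b', l⟩, h1, h2⟩ := h
    obtain ⟨rfl, rfl⟩ := Prod.mk.inj h2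
    have hd : m ≤ M := hL _ List.mem_cons_self
    have hcost : 2 + m * (m * (m * 1) + (1 + m * (m * (m * 2)) + (m + 1 + 4))) +
        (1 + (1 + m * (m * 1))) ≤ elemCost M := by
      have : m * (m * (m * 1) + (1 + m * (m * (m * 2)) + (m + 1 + 4))) ≤
          M * (M * M + (1 + M * (M * (M * 2)) + (M + 1 + 4))) := by
        rw [Nat.mul_one]; gcongr
      have : m * (m * 1) ≤ M * M := by rw [Nat.mul_one]; gcongr
      unfold elemCost
      omega
    refine Succeeds.mono ?_ (hmat hcost l _) fun _ => id
    refine (Succeeds.invElem hok A hA).bind ?_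
    rintro _ rfl
    exact ih _ _ _ h1 fun e he => hL e (List.mem_cons_of_mem _ he)

end ExpandCorrect

end FrameScaling

namespace FrameScaling

open scoped Matrix

/-! ### Projections onto column spaces and Gram determinants -/

section Projection

variable {d m n : ℕ}

/-- The orthogonal projection onto the column space of a matrix of full column rank. -/
noncomputable def colProj (A : Matrix (Fin d) (Fin m) ℝ) : Matrix (Fin d) (Fin d) ℝ :=
  A * (Aᵀ * A)⁻¹ * Aᵀ

theorem colProj_transpose (A : Matrix (Fin d) (Fin m) ℝ) : (colProj A)ᵀ = colProj A := by
  simp [colProj, Matrix.transpose_mul, Matrix.transpose_nonsing_inv, Matrix.mul_assoc]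

theorem colProj_mul_self {A : Matrix (Fin d) (Fin m) ℝ} (hA : (Aᵀ * A).det ≠ 0) :
    colProj A * colProj A = colProj A := by
  have h : (Aᵀ * A) * (Aᵀ * A)⁻¹ = 1 := Matrix.mul_nonsing_inv _ (isUnit_iff_ne_zero.mpr hA)
  calc colProj A * colProj A = A * (Aᵀ * A)⁻¹ * ((Aᵀ * A) * (Aᵀ * A)⁻¹) * Aᵀ := by
        simp only [colProj, Matrix.mul_assoc]
    _ = colProj A := by rw [h, Matrix.mul_one, colProj]

theorem trace_colProj {A : Matrix (Fin d) (Fin m) ℝ} (hA : (Aᵀ * A).det ≠ 0) :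
    (colProj A).trace = m := by
  rw [colProj, Matrix.mul_assoc, Matrix.trace_mul_comm, Matrix.mul_assoc,
    Matrix.nonsing_inv_mul _ (isUnit_iff_ne_zero.mpr hA), Matrix.trace_one, Fintype.card_fin]

/-- The diagonal entry of a symmetric idempotent matrix is a sum of squares. -/
theorem diag_eq_sum_sq {P : Matrix (Fin m) (Fin m) ℝ} (hT : Pᵀ = P) (hP : P * P = P) (i : Fin m) :
    P i i = ∑ k, P i k ^ 2 := by
  conv_lhs => rw [← hP, Matrix.mul_apply]
  refine Finset.sum_congr rfl fun k _ => ?_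
  rw [sq, ← Matrix.transpose_apply P i k, hT]

theorem diag_nonneg_of_idem {P : Matrix (Fin m) (Fin m) ℝ} (hT : Pᵀ = P) (hP : P * P = P)
    (i : Fin m) : 0 ≤ P i i := by
  rw [diag_eq_sum_sq hT hP]
  positivity

theorem diag_le_one_of_idem {P : Matrix (Fin m) (Fin m) ℝ} (hT : Pᵀ = P) (hP : P * P = P)
    (i : Fin m) : P i i ≤ 1 := by
  have h1 : P i i ^ 2 ≤ P i i := by
    conv_rhs => rw [diag_eq_sum_sq hT hP]
    exact Finset.single_le_sum (f := fun k => P i k ^ 2) (fun k _ => sq_nonneg _)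
      (Finset.mem_univ i)
  nlinarith

/-- The squared distance of `v` to the column space of `A`. -/
noncomputable def residual (A : Matrix (Fin d) (Fin m) ℝ) (v : Fin d → ℝ) : ℝ :=
  v ⬝ᵥ ((1 - colProj A) *ᵥ v)

/-- The part removed is `(Aᵀv)ᵀ (AᵀA)⁻¹ (Aᵀv)`, a positive semidefinite form; full column rank is
not needed. -/
theorem residual_le (A : Matrix (Fin d) (Fin m) ℝ) (v : Fin d → ℝ) : residual A v ≤ v ⬝ᵥ v := by
  have h : v ⬝ᵥ (colProj A *ᵥ v) = (Aᵀ *ᵥ v) ⬝ᵥ ((Aᵀ * A)⁻¹ *ᵥ (Aᵀ *ᵥ v)) := by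
    rw [colProj, Matrix.mul_assoc, ← Matrix.mulVec_mulVec, Matrix.dotProduct_mulVec,
      ← Matrix.mulVec_transpose, ← Matrix.mulVec_mulVec]
  have hpsd : (Aᵀ * A)⁻¹.PosSemidef := by
    have := Matrix.posSemidef_conjTranspose_mul_self A
    rw [Matrix.conjTranspose_eq_transpose_of_trivial] at this
    exact this.inv
  have := hpsd.dotProduct_mulVec_nonneg (Aᵀ *ᵥ v)
  rw [star_trivial, ← h] at this
  rw [residual, Matrix.sub_mulVec, dotProduct_sub, Matrix.one_mulVec]
  linarith

/-- The Schur complement of the old Gram matrix in the new one is the squared distance from the new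
column to the span of the old ones. -/
theorem det_gram_succ (B : Matrix (Fin d) (Fin (m + 1)) ℝ)
    (hA : ((B.submatrix id Fin.succ)ᵀ * B.submatrix id Fin.succ).det ≠ 0) :
    (Bᵀ * B).det = ((B.submatrix id Fin.succ)ᵀ * B.submatrix id Fin.succ).det *
      residual (B.submatrix id Fin.succ) (fun i => B i 0) := by
  set A := B.submatrix id Fin.succ with hAdef
  -- The new column, of index `0`, is moved to the last block so that the invertible Gram matrix is
  -- the upper left one.
  let e : Fin m ⊕ PUnit.{1} ≃ Fin (m + 1) :=
    ((finSuccEquiv m).trans (Equiv.optionEquivSumPUnit _)).symm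
  have e1 : ∀ k, e (Sum.inl k) = k.succ := fun k => by simp [e]
  have e2 : ∀ u, e (Sum.inr u) = 0 := fun k => by simp [e]
  let c : Matrix (Fin d) PUnit.{1} ℝ := B.submatrix id fun _ => 0
  have hB : (Bᵀ * B).submatrix e e = Matrix.fromBlocks (Aᵀ * A) (Aᵀ * c) (cᵀ * A) (cᵀ * c) := by
    ext i j
    rcases i with i | i <;> rcases j with j | j <;>
      simp [Matrix.mul_apply, e1, e2, c, hAdef]
  let _ : Invertible (Aᵀ * A) := Matrix.invertibleOfIsUnitDet _ (isUnit_iff_ne_zero.mpr hA)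
  rw [← Matrix.det_submatrix_equiv_self e, hB, Matrix.det_fromBlocks₁₁, Matrix.invOf_eq_nonsing_inv]
  congr 1
  rw [Matrix.det_unique]
  have : cᵀ * c - cᵀ * A * (Aᵀ * A)⁻¹ * (Aᵀ * c) = cᵀ * ((1 - colProj A) * c) := by
    simp only [colProj, Matrix.sub_mul, Matrix.mul_sub, Matrix.one_mul, Matrix.mul_assoc]
  rw [this]
  rfl

/-- `∑ v_jᵀ M v_j` is the trace of `M ∑ v_j v_jᵀ`, and the second factor is `diag μ`. -/
theorem sum_dotProduct_mulVec (V : Matrix (Fin d) (Fin n) ℝ) (M : Matrix (Fin d) (Fin d) ℝ)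
    (T : Finset (Fin n)) (μ : Fin d → ℝ)
    (hT : ∀ i k, ∑ j ∈ T, V i j * V k j = if i = k then μ i else 0) :
    ∑ j ∈ T, (fun i => V i j) ⬝ᵥ (M *ᵥ fun i => V i j) = ∑ i, M i i * μ i := by
  simp only [dotProduct, Matrix.mulVec, Finset.mul_sum]
  rw [Finset.sum_comm]
  refine Finset.sum_congr rfl fun i _ => ?_
  rw [Finset.sum_comm]
  have : ∀ k, ∑ j ∈ T, V i j * (M i k * V k j) = M i k * (if i = k then μ i else 0) := by
    intro k
    rw [← hT, Finset.mul_sum]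
    exact Finset.sum_congr rfl fun j _ => by ring
  simp [this]

end Projection

/-! ### Principal minors of `VᵀV` -/

section Minor

variable {d n : ℕ} (V : Matrix (Fin d) (Fin n) ℝ)

/-- The squared volume spanned by the columns of `V` listed in `S`. -/
noncomputable def sqVol (S : List (Fin n)) : ℝ := ((cols V S)ᵀ * cols V S).det

variable {V} {S S' : List (Fin n)} {j : Fin n}

theorem gram_posSemidef (S : List (Fin n)) : ((cols V S)ᵀ * cols V S).PosSemidef := by
  have := Matrix.posSemidef_conjTranspose_mul_self (cols V S)
  rwa [Matrix.conjTranspose_eq_transpose_of_trivial] at this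

theorem sqVol_nonneg (S : List (Fin n)) : 0 ≤ sqVol V S := (gram_posSemidef S).det_nonneg

theorem gram_posDef (h : 0 < sqVol V S) : ((cols V S)ᵀ * cols V S).PosDef :=
  (gram_posSemidef S).posDef_iff_det_ne_zero.mpr h.ne'

/-- The Gram matrix of a sublist is a principal submatrix of a positive definite matrix. -/
theorem sqVol_pos_of_sublist (h : 0 < sqVol V S) (hS : S'.Sublist S) : 0 < sqVol V S' := by
  obtain ⟨f, hf⟩ := List.sublist_iff_exists_fin_orderEmbedding_get_eq.mp hS
  have h1 : (cols V S')ᵀ * cols V S' = ((cols V S)ᵀ * cols V S).submatrix f f := by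
    ext i j
    simp only [Matrix.mul_apply, Matrix.transpose_apply, cols, Matrix.submatrix_apply, hf]
  rw [sqVol, h1]
  exact ((gram_posDef h).submatrix f.injective).det_pos

theorem nodup_of_sqVol_pos (h : 0 < sqVol V S) : S.Nodup := by
  rw [List.nodup_iff_injective_get]
  intro i k hik
  by_contra hne
  refine h.ne' (Matrix.det_zero_of_row_eq hne ?_)
  ext l
  simp only [Matrix.mul_apply, Matrix.transpose_apply, cols, Matrix.submatrix_apply, hik]

theorem sqVol_nil : sqVol V [] = 1 := Matrix.det_fin_zero

theorem sqVol_cons (h : 0 < sqVol V S) :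
    sqVol V (j :: S) = sqVol V S * residual (cols V S) (fun i => V i j) :=
  det_gram_succ (m := S.length) (cols V (j :: S)) h.ne'

/-- The diagonal of the projection onto the span of the columns in `S`. -/
noncomputable def weight (V : Matrix (Fin d) (Fin n) ℝ) (S : List (Fin n)) (i : Fin d) : ℝ :=
  colProj (cols V S) i i

theorem weight_nonneg (h : 0 < sqVol V S) (i : Fin d) : 0 ≤ weight V S i :=
  diag_nonneg_of_idem (colProj_transpose _) (colProj_mul_self h.ne') i

theorem weight_le_one (h : 0 < sqVol V S) (i : Fin d) : weight V S i ≤ 1 :=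
  diag_le_one_of_idem (colProj_transpose _) (colProj_mul_self h.ne') i

theorem sum_weight (h : 0 < sqVol V S) : ∑ i, weight V S i = S.length :=
  trace_colProj h.ne'

/-- Sums base times squared height over `T`; the heights add up to `tr((1 - P) diag μ)`. This ties
determinants to the output: it bounds the greedy steps from below and the output from above, and it
settles the case where `p` is the rank. -/
theorem sum_sqVol_cons (h : 0 < sqVol V S) (T : Finset (Fin n)) (μ : Fin d → ℝ)
    (hT : ∀ i k, ∑ j ∈ T, V i j * V k j = if i = k then μ i else 0) :
    ∑ j ∈ T, sqVol V (j :: S) = sqVol V S * ∑ i, (1 - weight V S i) * μ i := by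
  simp only [sqVol_cons h, ← Finset.mul_sum, residual]
  rw [sum_dotProduct_mulVec V _ T μ hT]
  simp [weight]

/-- If `V Vᵀ = 1`, the columns of `V` have norm at most one. -/
theorem col_sq_le_one (hV : V * Vᵀ = 1) (j : Fin n) :
    (fun i => V i j) ⬝ᵥ (fun i => V i j) ≤ 1 := by
  refine diag_le_one_of_idem (P := Vᵀ * V) ?_ ?_ j
  · simp [Matrix.transpose_mul]
  · rw [Matrix.mul_assoc, ← Matrix.mul_assoc V, hV, Matrix.one_mul]

/-- Hadamard's inequality for columns of norm at most one. It is the ceiling that stops the local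
search. -/
theorem sqVol_le_one (hV : V * Vᵀ = 1) : ∀ S : List (Fin n), sqVol V S ≤ 1
  | [] => sqVol_nil.le
  | j :: S => by
      rcases (sqVol_nonneg (V := V) (j :: S)).eq_or_lt with h | h
      · rw [← h]; exact zero_le_one
      · have hS := sqVol_pos_of_sublist h (List.sublist_cons_self j S)
        rw [sqVol_cons hS]
        have h1 := sqVol_le_one hV S
        have h2 := (residual_le (cols V S) _).trans (col_sq_le_one hV j)
        nlinarith

theorem sum_univ_mul (hV : V * Vᵀ = 1) (i k : Fin d) :
    ∑ j ∈ Finset.univ, V i j * V k j = if i = k then 1 else 0 := by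
  rw [← Matrix.one_apply, ← hV, Matrix.mul_apply]
  rfl

/-- Independent sets have at most `d` elements; those with `d` elements are maximal. -/
theorem length_le_of_sqVol_pos (h : 0 < sqVol V S) : S.length ≤ d := by
  have h1 := sum_weight h
  have h2 : ∑ i, weight V S i ≤ ∑ _i : Fin d, (1 : ℝ) :=
    Finset.sum_le_sum fun i _ => weight_le_one h i
  simp only [Finset.sum_const, Finset.card_univ, Fintype.card_fin, nsmul_eq_mul, mul_one] at h2
  rw [h1] at h2
  exact_mod_cast h2

theorem sqVol_cons_eq_zero_of_length (hS : S.length = d) (j : Fin n) :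
    sqVol V (j :: S) = 0 := by
  by_contra hne
  have := length_le_of_sqVol_pos ((sqVol_nonneg (V := V) (j :: S)).lt_of_ne' hne)
  simp [hS] at this

end Minor

end FrameScaling

namespace FrameScaling

open scoped Matrix

/-! ### Large and small eigenvalues -/

section Spectrum

variable {d n : ℕ}

/-- The number of entries that are at least `1/2`. -/
noncomputable def bigCount (μ : Fin d → ℝ) : ℕ := (Finset.univ.filter fun i => 1 / 2 ≤ μ i).card

/-- The sum of the entries below `1/2`. -/
noncomputable def smallPart (μ : Fin d → ℝ) : ℝ := ∑ i, if 1 / 2 ≤ μ i then 0 else μ i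

theorem bigCount_eq_sum (μ : Fin d → ℝ) : (bigCount μ : ℝ) = ∑ i, if 1 / 2 ≤ μ i then 1 else 0 := by
  simp [bigCount]

theorem smallSum_map (μ : Fin d → ℝ) : smallSum (Finset.univ.val.map μ) = smallPart μ := by
  have h : smallPart μ = ∑ i with μ i < 1 / 2, μ i := by
    rw [smallPart, Finset.sum_filter]
    exact Finset.sum_congr rfl fun i _ => by simp only [← not_le, ite_not]
  rw [smallSum, Multiset.filter_map, h]
  simp only [Finset.sum, Finset.filter_val, Function.comp_def]

/-- The distance from `x ∈ [0, 1]` to its rounding is the smaller of `x` and `1 - x`, hence at most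
`2 x (1 - x)`, because the larger one is at least `1/2`. So the nearest integer to the trace counts
the large eigenvalues. -/
theorem abs_sum_sub_bigCount_lt {μ : Fin d → ℝ} (h0 : ∀ i, 0 ≤ μ i) (h1 : ∀ i, μ i ≤ 1)
    (h : ∑ i, μ i * (1 - μ i) < 1 / 4) : |∑ i, μ i - bigCount μ| < 1 / 2 := by
  rw [bigCount_eq_sum, ← Finset.sum_sub_distrib]
  refine (Finset.abs_sum_le_sum_abs _ _).trans_lt ?_
  have : ∑ i, |μ i - if 1 / 2 ≤ μ i then 1 else 0| ≤ ∑ i, 2 * (μ i * (1 - μ i)) := by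
    refine Finset.sum_le_sum fun i _ => ?_
    have := h0 i
    have := h1 i
    split_ifs with hi
    · rw [abs_le]; constructor <;> nlinarith
    · rw [sub_zero, abs_of_nonneg (h0 i)]; nlinarith
  rw [← Finset.mul_sum] at this
  linarith

/-- Weight `bigCount μ` with entries at most one removes most of `∑ μ i` when placed on the large
entries. -/
theorem smallPart_le_sum {μ w : Fin d → ℝ} (hw0 : ∀ i, 0 ≤ w i)
    (hw1 : ∀ i, w i ≤ 1) (hw : ∑ i, w i = bigCount μ) :
    smallPart μ ≤ ∑ i, (1 - w i) * μ i := by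
  -- Comparing with the threshold `1/2` makes the inequality termwise; the left-hand sides sum to
  -- zero because both weightings have total `bigCount μ`.
  have h : ∑ i, 1 / 2 * ((if 1 / 2 ≤ μ i then 1 else 0) - w i) ≤
      ∑ i, ((1 - w i) * μ i - if 1 / 2 ≤ μ i then 0 else μ i) := by
    refine Finset.sum_le_sum fun i _ => ?_
    have := hw0 i
    have := hw1 i
    split_ifs with hi <;> nlinarith
  rw [← Finset.mul_sum, Finset.sum_sub_distrib, Finset.sum_sub_distrib, ← bigCount_eq_sum, hw] at h
  rw [smallPart]
  linarith

theorem smallPart_nonneg {μ : Fin d → ℝ} (h0 : ∀ i, 0 ≤ μ i) : 0 ≤ smallPart μ :=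
  Finset.sum_nonneg fun i _ => by split_ifs; exacts [le_rfl, h0 i]

theorem le_smallPart {μ : Fin d → ℝ} (h0 : ∀ i, 0 ≤ μ i) {i : Fin d} (hi : ¬ 1 / 2 ≤ μ i) :
    μ i ≤ smallPart μ := by
  have := Finset.single_le_sum (f := fun i => if 1 / 2 ≤ μ i then 0 else μ i)
    (fun i _ => by split_ifs; exacts [le_rfl, h0 i]) (Finset.mem_univ i)
  rwa [if_neg hi] at this

open scoped MatrixOrder in
theorem exists_eq_transpose_mul_self {m : ℕ} {A : Matrix (Fin m) (Fin m) ℝ} (hA : A.PosSemidef) :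
    ∃ B : Matrix (Fin m) (Fin m) ℝ, A = Bᵀ * B := by
  obtain ⟨B, hB⟩ := CStarAlgebra.nonneg_iff_eq_star_mul_self.mp hA.nonneg
  exact ⟨B, by rw [hB, Matrix.star_eq_conjTranspose,
    Matrix.conjTranspose_eq_transpose_of_trivial]⟩

/-- A positive semidefinite matrix is bounded by its trace. -/
theorem dotProduct_mulVec_le_trace {m : ℕ} {A : Matrix (Fin m) (Fin m) ℝ} (hA : A.PosSemidef)
    (x : Fin m → ℝ) : x ⬝ᵥ (A *ᵥ x) ≤ A.trace * (x ⬝ᵥ x) := by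
  obtain ⟨B, rfl⟩ := exists_eq_transpose_mul_self hA
  have h1 : x ⬝ᵥ ((Bᵀ * B) *ᵥ x) = ∑ i, (∑ j, B i j * x j) ^ 2 := by
    rw [← Matrix.mulVec_mulVec, Matrix.dotProduct_mulVec, ← Matrix.mulVec_transpose,
      Matrix.transpose_transpose]
    simp [dotProduct, Matrix.mulVec, sq]
  have h2 : (Bᵀ * B).trace * (x ⬝ᵥ x) = ∑ i, (∑ j, B i j ^ 2) * ∑ j, x j ^ 2 := by
    rw [← Finset.sum_mul]
    congr 1
    · rw [Finset.sum_comm]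
      simp [Matrix.trace, Matrix.mul_apply, sq]
    · simp [dotProduct, sq]
  rw [h1, h2]
  -- Cauchy–Schwarz for each row of the factor `B`.
  exact Finset.sum_le_sum fun i _ => Finset.sum_mul_sq_le_sq_mul_sq _ _ _

variable {V : Matrix (Fin d) (Fin n) ℝ} {μ : Fin d → ℝ} {T : Finset (Fin n)}

/-- This is `‖V_Tᵀ y‖² = yᵀ (V_T V_Tᵀ) y` with the middle matrix diagonal. -/
theorem sum_dotProduct_sq (hT : ∀ i k, ∑ j ∈ T, V i j * V k j = if i = k then μ i else 0)
    (y : Fin d → ℝ) : ∑ j ∈ T, (∑ i, V i j * y i) ^ 2 = ∑ i, μ i * y i ^ 2 := by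
  have h : ∀ j, (∑ i, V i j * y i) ^ 2 = ∑ i, ∑ k, y i * y k * (V i j * V k j) := by
    intro j
    rw [sq, Finset.sum_mul_sum]
    exact Finset.sum_congr rfl fun i _ => Finset.sum_congr rfl fun k _ => by ring
  simp only [h]
  rw [Finset.sum_comm]
  refine Finset.sum_congr rfl fun i _ => ?_
  rw [Finset.sum_comm]
  simp only [← Finset.mul_sum, hT]
  simp only [mul_ite, mul_zero, Finset.sum_ite_eq, Finset.mem_univ, if_true]
  ring

theorem eigenvalue_nonneg (hT : ∀ i k, ∑ j ∈ T, V i j * V k j = if i = k then μ i else 0)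
    (i : Fin d) : 0 ≤ μ i := by
  have := hT i i
  rw [if_pos rfl] at this
  rw [← this]
  exact Finset.sum_nonneg fun j _ => mul_self_nonneg _

theorem eigenvalue_le_one (hV : V * Vᵀ = 1)
    (hT : ∀ i k, ∑ j ∈ T, V i j * V k j = if i = k then μ i else 0) (i : Fin d) : μ i ≤ 1 := by
  have h := hT i i
  have h' := sum_univ_mul hV i i
  rw [if_pos rfl] at h h'
  rw [← h, ← h']
  exact Finset.sum_le_sum_of_subset_of_nonneg (Finset.subset_univ _)
    fun j _ _ => mul_self_nonneg _

/-- If `D` cannot be extended inside `T`, the right-hand side vanishes and so does `smallPart μ`.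
This justifies the output `0` when `p` is the rank. -/
theorem smallPart_mul_sqVol_le (hT : ∀ i k, ∑ j ∈ T, V i j * V k j = if i = k then μ i else 0)
    {D : List (Fin n)} (hD : 0 < sqVol V D) (hp : D.length = bigCount μ) :
    smallPart μ * sqVol V D ≤ ∑ j ∈ T, sqVol V (j :: D) := by
  rw [sum_sqVol_cons hD T μ hT, mul_comm]
  refine mul_le_mul_of_nonneg_left ?_ hD.le
  exact smallPart_le_sum (weight_nonneg hD) (weight_le_one hD) (by rw [sum_weight hD, hp])

/-- Since `μ i ≤ 1`, the factor `∑ (1 - w i) μ i` is at least `∑ μ i - |G|`. The trace exceeds `p -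
1/2` and `|G| ≤ p - 1`, which leaves `1/2`. -/
theorem half_le_sum_weight (hV : V * Vᵀ = 1)
    (hT : ∀ i k, ∑ j ∈ T, V i j * V k j = if i = k then μ i else 0)
    (h : ∑ i, μ i * (1 - μ i) < 1 / 4)
    {G : List (Fin n)} (hG : 0 < sqVol V G) (hp : G.length < bigCount μ) :
    1 / 2 * sqVol V G ≤ ∑ j ∈ T, sqVol V (j :: G) := by
  rw [sum_sqVol_cons hG T μ hT, mul_comm]
  refine mul_le_mul_of_nonneg_left ?_ hG.le
  have h1 := abs_sum_sub_bigCount_lt (eigenvalue_nonneg hT) (eigenvalue_le_one hV hT) h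
  have h2 : ∑ i, (μ i - weight V G i) ≤ ∑ i, (1 - weight V G i) * μ i := by
    refine Finset.sum_le_sum fun i _ => ?_
    nlinarith [weight_nonneg hG i, eigenvalue_le_one hV hT i]
  rw [Finset.sum_sub_distrib, sum_weight hG] at h2
  have h3 : (G.length : ℝ) + 1 ≤ bigCount μ := by exact_mod_cast hp
  have := (abs_lt.mp h1).1
  linarith

/-! ### Local optima -/

theorem sqVol_ofFn {m : ℕ} (f : Fin m → Fin n) :
    sqVol V (List.ofFn f) = ((V.submatrix id f)ᵀ * V.submatrix id f).det := by
  rw [sqVol, ← Matrix.det_submatrix_equiv_self (finCongr (List.length_ofFn (f := f)).symm)]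
  congr 1
  ext i j
  simp [Matrix.mul_apply, cols]

/-- Deleting the row and column of the `k`-th element of `D` from the Gram matrix of `D + j` leaves
the Gram matrix of an exchange, so diagonal cofactors are the quantities compared by the local
search. -/
theorem adjugate_gram_succ (j : Fin n) (D : List (Fin n)) (hD : D.Nodup) (k : Fin D.length) :
    Matrix.adjugate ((cols V (j :: D))ᵀ * cols V (j :: D)) k.succ k.succ =
      sqVol V (j :: D.erase (D.get k)) := by
  have hl : (j :: D.erase (D.get k)).length = D.length := by
    rw [List.length_cons, List.length_erase_of_mem (List.get_mem _ _)]
    have := k.pos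
    omega
  -- Skipping index `k + 1` preserves the order, so this is an equality of lists and not merely a
  -- permutation.
  have h : j :: D.erase (D.get k) =
      List.ofFn fun x : Fin D.length => (j :: D).get (k.succ.succAbove x) := by
    rw [List.Nodup.erase_get hD] at hl ⊢
    refine List.ext_getElem (by simpa using hl) fun i h1 h2 => ?_
    rw [List.getElem_ofFn]
    cases i with
    | zero =>
      have : k.succ.succAbove ⟨0, by simpa using h2⟩ = (0 : Fin (D.length + 1)) := by
        rw [Fin.succAbove_of_castSucc_lt _ _ (by simp [Fin.lt_def])]
        rfl
      rw [this]
      rfl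
    | succ i =>
      rw [List.getElem_cons_succ, List.getElem_eraseIdx]
      split_ifs with hi
      · rw [Fin.succAbove_of_castSucc_lt _ _ (by simpa [Fin.lt_def] using hi)]
        rfl
      · rw [Fin.succAbove_of_le_castSucc _ _ (by simpa [Fin.le_def] using hi)]
        rfl
  rw [h, sqVol_ofFn]
  rw [Matrix.adjugate_fin_succ_eq_det_submatrix]
  rw [← two_mul, pow_mul]
  simp
  rfl

theorem adjugate_gram_zero (j : Fin n) (D : List (Fin n)) :
    Matrix.adjugate ((cols V (j :: D))ᵀ * cols V (j :: D)) (0 : Fin (D.length + 1))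
      (0 : Fin (D.length + 1)) = sqVol V D := by
  rw [Matrix.adjugate_fin_succ_eq_det_submatrix]
  simp
  rfl

/-- More columns than large eigenvalues means that some vector `y` in their span lives on small
eigendirections. There the form `V_S V_Sᵀ ≤ V_T V_Tᵀ` is at most `smallPart μ`, so the Gram matrix
has a small eigenvalue and its inverse a large trace. -/
theorem one_le_smallPart_mul_trace
    (hT : ∀ i k, ∑ j ∈ T, V i j * V k j = if i = k then μ i else 0)
    {S : List (Fin n)} (hS : 0 < sqVol V S) (hST : ∀ j ∈ S, j ∈ T) (hp : bigCount μ < S.length) :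
    1 ≤ smallPart μ * (((cols V S)ᵀ * cols V S)⁻¹).trace := by
  have hnd := nodup_of_sqVol_pos hS
  have hμ0 := eigenvalue_nonneg hT
  have hG := gram_posDef hS
  set A := cols V S with hA
  set G := Aᵀ * A with hGdef
  -- a combination of the columns in `S` orthogonal to all eigenvectors of large eigenvalues
  obtain ⟨c, hc0, hc⟩ : ∃ c : Fin S.length → ℝ, c ≠ 0 ∧
      ∀ i, 1 / 2 ≤ μ i → (A *ᵥ c) i = 0 := by
    let f : (Fin S.length → ℝ) →ₗ[ℝ] ({i : Fin d // 1 / 2 ≤ μ i} → ℝ) :=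
      (LinearMap.funLeft ℝ ℝ Subtype.val).comp A.mulVecLin
    -- Dimension count: `bigCount μ` linear conditions on more than `bigCount μ` coefficients.
    have hf : LinearMap.ker f ≠ ⊥ := LinearMap.ker_ne_bot_of_finrank_lt (by
      rw [Module.finrank_fintype_fun_eq_card, Module.finrank_fintype_fun_eq_card,
        Fintype.card_subtype, Fintype.card_fin]
      exact hp)
    obtain ⟨c, hcm, hc0⟩ := (Submodule.ne_bot_iff _).mp hf
    exact ⟨c, hc0, fun i hi => congrFun (LinearMap.mem_ker.mp hcm) ⟨i, hi⟩⟩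
  set y := A *ᵥ c with hy
  set g := G *ᵥ c with hg
  have hgy : g = Aᵀ *ᵥ y := by rw [hg, hGdef, hy, Matrix.mulVec_mulVec]
  have hGc : 0 < c ⬝ᵥ g := by
    have := hG.dotProduct_mulVec_pos hc0
    rwa [star_trivial] at this
  have hyy : y ⬝ᵥ y = c ⬝ᵥ g := by
    rw [hgy, hy, Matrix.dotProduct_mulVec, ← Matrix.mulVec_transpose, dotProduct_comm]
  -- Enlarging `S` to `T` adds squares; then `‖V_Tᵀ y‖² = ∑ μ i (y i)²`, where only small `μ i`
  -- contribute, each at most `smallPart μ`.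
  have hgg : g ⬝ᵥ g ≤ smallPart μ * (c ⬝ᵥ g) := by
    have h1 : g ⬝ᵥ g = ∑ j ∈ S.toFinset, (∑ i, V i j * y i) ^ 2 := by
      rw [List.sum_toFinset _ hnd, ← Fin.sum_univ_fun_getElem, hgy]
      refine Finset.sum_congr rfl fun k _ => ?_
      rw [← sq]
      rfl
    have h2 : ∑ j ∈ S.toFinset, (∑ i, V i j * y i) ^ 2 ≤ ∑ j ∈ T, (∑ i, V i j * y i) ^ 2 :=
      Finset.sum_le_sum_of_subset_of_nonneg (fun j hj => hST j (List.mem_toFinset.mp hj))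
        fun _ _ _ => sq_nonneg _
    rw [h1, ← hyy]
    refine h2.trans ?_
    rw [sum_dotProduct_sq hT, dotProduct, Finset.mul_sum]
    refine Finset.sum_le_sum fun i _ => ?_
    by_cases hi : 1 / 2 ≤ μ i
    · rw [hc i hi]; simp
    · rw [← sq]
      exact mul_le_mul_of_nonneg_right (le_smallPart hμ0 hi) (sq_nonneg _)
  have hinv : c ⬝ᵥ g = g ⬝ᵥ (G⁻¹ *ᵥ g) := by
    have : G⁻¹ *ᵥ g = c := by
      rw [hg, Matrix.mulVec_mulVec, Matrix.nonsing_inv_mul _ (isUnit_iff_ne_zero.mpr hG.det_pos.ne'),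
        Matrix.one_mulVec]
    rw [this, dotProduct_comm]
  have hle := dotProduct_mulVec_le_trace hG.inv.posSemidef g
  rw [← hinv] at hle
  have hs := smallPart_nonneg hμ0
  have htr : 0 ≤ G⁻¹.trace := hG.inv.posSemidef.trace_nonneg
  -- Since `c ⬝ᵥ g = gᵀ G⁻¹ g`, the trace bound for `G⁻¹` and the bound on `g ⬝ᵥ g` close a loop;
  -- cancelling the positive `c ⬝ᵥ g` gives the claim.
  have h3 : c ⬝ᵥ g ≤ smallPart μ * G⁻¹.trace * (c ⬝ᵥ g) :=
    calc c ⬝ᵥ g ≤ G⁻¹.trace * (g ⬝ᵥ g) := hle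
      _ ≤ G⁻¹.trace * (smallPart μ * (c ⬝ᵥ g)) := mul_le_mul_of_nonneg_left hgg htr
      _ = _ := by ring
  by_contra hlt
  push Not at hlt
  nlinarith

/-- The key property of local optima. -/
theorem sqVol_cons_le_of_localOpt
    (hT : ∀ i k, ∑ j ∈ T, V i j * V k j = if i = k then μ i else 0)
    {D : List (Fin n)} (hD : 0 < sqVol V D) (hDT : ∀ j ∈ D, j ∈ T) (hp : D.length = bigCount μ)
    (hopt : ∀ i ∈ D, ∀ j ∈ T, j ∉ D → sqVol V (j :: D.erase i) ≤ 2 * sqVol V D)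
    {j : Fin n} (hj : j ∈ T) :
    sqVol V (j :: D) ≤ (2 * D.length + 1) * smallPart μ * sqVol V D := by
  have hs := smallPart_nonneg (eigenvalue_nonneg hT)
  -- A dependent extension, in particular `j ∈ D`, has volume zero. From here on `j` is a genuine
  -- candidate for an exchange.
  rcases (sqVol_nonneg (V := V) (j :: D)).eq_or_lt with h | h
  · rw [← h]
    positivity
  have hnd := nodup_of_sqVol_pos h
  rw [List.nodup_cons] at hnd
  have h1 := one_le_smallPart_mul_trace hT h
    (by simpa using ⟨hj, hDT⟩) (by rw [List.length_cons, hp]; omega)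
  have h2 : (((cols V (j :: D))ᵀ * cols V (j :: D))⁻¹).trace =
      (sqVol V (j :: D))⁻¹ * ((cols V (j :: D))ᵀ * cols V (j :: D)).adjugate.trace := by
    rw [Matrix.inv_def, Matrix.trace_smul, Ring.inverse_eq_inv', smul_eq_mul]
    rfl
  have h3 : ((cols V (j :: D))ᵀ * cols V (j :: D)).adjugate.trace ≤
      (2 * D.length + 1) * sqVol V D := by
    -- Cofactor at `0` removes `j` and leaves `Δ(D)`; the others remove an element of `D` and are
    -- exchanges, each at most `2 Δ(D)` by local optimality.
    have : ((cols V (j :: D))ᵀ * cols V (j :: D)).adjugate.trace =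
        sqVol V D + ∑ k : Fin D.length, sqVol V (j :: D.erase (D.get k)) := by
      rw [← adjugate_gram_zero j D]
      simp only [← adjugate_gram_succ j D hnd.2]
      exact Fin.sum_univ_succ (n := D.length) _
    rw [this]
    have h4 : ∑ k : Fin D.length, sqVol V (j :: D.erase (D.get k)) ≤
        ∑ _k : Fin D.length, 2 * sqVol V D :=
      Finset.sum_le_sum fun k _ => hopt _ (List.get_mem _ _) j hj hnd.1
    rw [Finset.sum_const, Finset.card_univ, Fintype.card_fin, nsmul_eq_mul] at h4
    linarith
  rw [h2] at h1
  have h5 : sqVol V (j :: D) ≤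
      smallPart μ * ((cols V (j :: D))ᵀ * cols V (j :: D)).adjugate.trace := by
    have := mul_le_mul_of_nonneg_right h1 h.le
    rw [one_mul] at this
    refine this.trans_eq ?_
    field_simp
  calc _ ≤ _ := h5
    _ ≤ smallPart μ * ((2 * D.length + 1) * sqVol V D) := mul_le_mul_of_nonneg_left h3 hs
    _ = _ := by ring

end Spectrum
end FrameScaling

namespace FrameScaling

open scoped Matrix

/-! ### Whitening -/

section Whitening

variable {d n : ℕ}

/-- The matrix `U_T Z_T U_Tᵀ`. -/
def gramOn (U : Matrix (Fin d) (Fin n) ℝ) (z : Fin n → ℝ) (T : Finset (Fin n)) :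
    Matrix (Fin d) (Fin d) ℝ := fun i k => ∑ j ∈ T, U i j * z j * U k j

/-- `V = R U √Z` has orthonormal rows, and its columns in `T` have Gram matrix `diag μ`. -/
structure IsWhitening (U : Matrix (Fin d) (Fin n) ℝ) (z : Fin n → ℝ) (T : Finset (Fin n))
    (R : Matrix (Fin d) (Fin d) ℝ) (V : Matrix (Fin d) (Fin n) ℝ) (μ : Fin d → ℝ) : Prop where
  z_pos : ∀ j, 0 < z j
  det_ne : (gramOn U z Finset.univ).det ≠ 0
  factor : Rᵀ * R = (gramOn U z Finset.univ)⁻¹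
  V_apply : ∀ i j, V i j = (R * U) i j * √(z j)
  diag : R * gramOn U z T * Rᵀ = Matrix.diagonal μ

theorem gramOn_univ (U : Matrix (Fin d) (Fin n) ℝ) (z : Fin n → ℝ) :
    U * Matrix.diagonal z * Uᵀ = gramOn U z Finset.univ := by
  ext i k
  rw [Matrix.mul_apply]
  simp [Matrix.mul_diagonal, gramOn]

theorem gramOn_eq (U : Matrix (Fin d) (Fin n) ℝ) (z : Fin n → ℝ) (T : Finset (Fin n)) :
    (U.submatrix id (fun j : T => j.1)) * Matrix.diagonal (fun j : T => z j.1) *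
      (U.submatrix id (fun j : T => j.1))ᵀ = gramOn U z T := by
  ext i k
  rw [Matrix.mul_apply]
  simp only [Matrix.mul_diagonal, gramOn, Matrix.submatrix_apply, id, Matrix.transpose_apply]
  exact Finset.sum_coe_sort T fun j => U i j * z j * U k j

theorem gramOn_univ_posDef {U : Matrix (Fin d) (Fin n) ℝ} {z : Fin n → ℝ} (hU : U.rank = d)
    (hz : ∀ j, 0 < z j) : (gramOn U z Finset.univ).PosDef := by
  rw [← gramOn_univ, ← Matrix.conjTranspose_eq_transpose_of_trivial]
  refine (Matrix.PosDef.diagonal hz).mul_mul_conjTranspose_same ?_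
  rw [Matrix.vecMul_injective_iff, linearIndependent_iff_card_eq_finrank_span, Fintype.card_fin,
    Set.finrank, ← Matrix.rank_eq_finrank_span_row, hU]

theorem gramOn_transpose (U : Matrix (Fin d) (Fin n) ℝ) (z : Fin n → ℝ) (T : Finset (Fin n)) :
    (gramOn U z T)ᵀ = gramOn U z T := by
  ext i k
  exact Finset.sum_congr rfl fun j _ => by ring

/-- Simultaneous diagonalization: a factor `B` of the inverse Gram matrix turns `U Z Uᵀ` into the
identity, and an orthogonal `E` then diagonalizes the image of `U_T Z_T U_Tᵀ` without disturbing
this. -/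
theorem exists_isWhitening {U : Matrix (Fin d) (Fin n) ℝ} {z : Fin n → ℝ} (hU : U.rank = d)
    (hz : ∀ j, 0 < z j) (T : Finset (Fin n)) : ∃ R V μ, IsWhitening U z T R V μ := by
  have hM := gramOn_univ_posDef hU hz
  obtain ⟨B, hB⟩ := exists_eq_transpose_mul_self hM.inv.posSemidef
  have hN : (B * gramOn U z T * Bᵀ).IsHermitian := by
    rw [Matrix.IsHermitian, Matrix.conjTranspose_eq_transpose_of_trivial]
    simp only [Matrix.transpose_mul, Matrix.transpose_transpose, gramOn_transpose, Matrix.mul_assoc]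
  let E : Matrix (Fin d) (Fin d) ℝ := hN.eigenvectorUnitary
  have hE : E * Eᵀ = 1 := by
    have := Unitary.coe_mul_star_self hN.eigenvectorUnitary
    rwa [Unitary.coe_star, Matrix.star_eq_conjTranspose, Matrix.conjTranspose_eq_transpose_of_trivial] at this
  have hdiag : Eᵀ * (B * gramOn U z T * Bᵀ) * E = Matrix.diagonal hN.eigenvalues := by
    have := hN.conjStarAlgAut_star_eigenvectorUnitary
    rw [Unitary.conjStarAlgAut_star_apply, Matrix.star_eq_conjTranspose,
      Matrix.conjTranspose_eq_transpose_of_trivial] at this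
    exact this
  refine ⟨Eᵀ * B, fun i j => (Eᵀ * B * U) i j * √(z j), hN.eigenvalues, hz, hM.det_pos.ne', ?_,
    fun _ _ => rfl, ?_⟩
  · rw [Matrix.transpose_mul, Matrix.transpose_transpose, Matrix.mul_assoc, ← Matrix.mul_assoc E,
      hE, Matrix.one_mul, hB]
  · rw [← hdiag]
    simp only [Matrix.transpose_mul, Matrix.transpose_transpose, Matrix.mul_assoc]

variable {U : Matrix (Fin d) (Fin n) ℝ} {z : Fin n → ℝ} {T : Finset (Fin n)}
  {R : Matrix (Fin d) (Fin d) ℝ} {V : Matrix (Fin d) (Fin n) ℝ} {μ : Fin d → ℝ}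

theorem IsWhitening.sum_mul (h : IsWhitening U z T R V μ) (S : Finset (Fin n)) (i k : Fin d) :
    ∑ j ∈ S, V i j * V k j = (R * gramOn U z S * Rᵀ) i k := by
  have h1 : ∀ j, V i j * V k j = ∑ b, ∑ a, R i a * (U a j * z j * U b j) * R k b := by
    intro j
    rw [h.V_apply, h.V_apply, show ∀ x y s : ℝ, x * s * (y * s) = x * (s * s) * y by intros; ring,
      Real.mul_self_sqrt (h.z_pos j).le, Matrix.mul_apply, Matrix.mul_apply, Finset.mul_sum]
    refine Finset.sum_congr rfl fun b _ => ?_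
    rw [Finset.sum_mul, Finset.sum_mul]
    exact Finset.sum_congr rfl fun a _ => by ring
  simp only [h1, Matrix.mul_apply, gramOn, Matrix.transpose_apply, Finset.mul_sum, Finset.sum_mul]
  rw [Finset.sum_comm]
  refine Finset.sum_congr rfl fun b _ => ?_
  rw [Finset.sum_comm]

theorem IsWhitening.sum_mul_eq (h : IsWhitening U z T R V μ) (i k : Fin d) :
    ∑ j ∈ T, V i j * V k j = if i = k then μ i else 0 := by
  rw [h.sum_mul, h.diag, Matrix.diagonal_apply]

/-- For square matrices `Rᵀ (R M) = 1` gives `(R M) Rᵀ = 1`. -/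
theorem IsWhitening.mul_transpose (h : IsWhitening U z T R V μ) : V * Vᵀ = 1 := by
  have h1 : Rᵀ * (R * gramOn U z Finset.univ) = 1 := by
    rw [← Matrix.mul_assoc, h.factor,
      Matrix.nonsing_inv_mul _ (isUnit_iff_ne_zero.mpr h.det_ne)]
  have h2 := mul_eq_one_comm.mp h1
  ext i k
  rw [← h2, ← h.sum_mul, Matrix.mul_apply]
  rfl

/-- `charpoly (A B) = charpoly (B A)` moves the factor `R` to the front and leaves the diagonal
matrix, so multiplicities are respected. -/
theorem IsWhitening.relSpectrum_eq (h : IsWhitening U z T R V μ) :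
    relSpectrum U z T = Finset.univ.val.map μ := by
  rw [relSpectrum]
  rw [gramOn_univ, gramOn_eq, ← h.factor, ← Matrix.mul_assoc, Matrix.charpoly_mul_comm,
    ← Matrix.mul_assoc, h.diag, Matrix.charpoly_diagonal]
  exact Polynomial.roots_multiset_prod_X_sub_C (Finset.univ.val.map μ) ▸ by
    rw [Multiset.map_map]; rfl

theorem IsWhitening.trace_eq (h : IsWhitening U z T R V μ) :
    (gramOn U z T * (gramOn U z Finset.univ)⁻¹).trace = ∑ i, μ i := by
  rw [← h.factor, ← Matrix.mul_assoc, Matrix.trace_mul_comm, ← Matrix.mul_assoc, h.diag,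
    Matrix.trace_diagonal]

/-- The matrix `U_Sᵀ W U_S`. -/
noncomputable def innerGram (U : Matrix (Fin d) (Fin n) ℝ) (W : Matrix (Fin d) (Fin d) ℝ)
    (S : List (Fin n)) : Matrix (Fin S.length) (Fin S.length) ℝ := (cols U S)ᵀ * W * cols U S

theorem IsWhitening.cols_eq (h : IsWhitening U z T R V μ) (S : List (Fin n)) :
    cols V S = R * cols U S * Matrix.diagonal fun k => √(z (S.get k)) := by
  ext i k
  rw [Matrix.mul_diagonal, cols, Matrix.submatrix_apply, h.V_apply]
  rfl

theorem IsWhitening.gram_eq (h : IsWhitening U z T R V μ) (S : List (Fin n)) :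
    (cols V S)ᵀ * cols V S = (Matrix.diagonal fun k => √(z (S.get k))) *
      innerGram U (gramOn U z Finset.univ)⁻¹ S * Matrix.diagonal fun k => √(z (S.get k)) := by
  rw [h.cols_eq, innerGram, ← h.factor]
  simp only [Matrix.transpose_mul, Matrix.diagonal_transpose, Matrix.mul_assoc]

/-- The determinant is insensitive to placing `Z` on one side instead of `√Z` on both, so the
algorithm obtains whitened volumes without square roots. -/
theorem IsWhitening.det_eq (h : IsWhitening U z T R V μ) (S : List (Fin n)) :
    ((cols U S)ᵀ * (gramOn U z Finset.univ)⁻¹ *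
      cols (fun i j => U i j * z j : Matrix (Fin d) (Fin n) ℝ) S).det = sqVol V S := by
  have h1 : cols (fun i j => U i j * z j : Matrix (Fin d) (Fin n) ℝ) S =
      cols U S * Matrix.diagonal fun k => z (S.get k) := by
    ext i k
    rw [Matrix.mul_diagonal]
    rfl
  have h2 : (Matrix.diagonal fun k => z (S.get k)) =
      (Matrix.diagonal fun k => √(z (S.get k))) * Matrix.diagonal fun k => √(z (S.get k)) := by
    rw [Matrix.diagonal_mul_diagonal]
    congr 1
    ext k
    rw [Real.mul_self_sqrt (h.z_pos _).le]
  rw [h1, h2, ← Matrix.mul_assoc, ← Matrix.mul_assoc, sqVol, h.gram_eq, innerGram, Matrix.det_mul,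
    Matrix.det_mul, Matrix.det_mul, Matrix.det_mul]
  ring

theorem IsWhitening.innerGram_det_ne (h : IsWhitening U z T R V μ) {S : List (Fin n)}
    (hS : 0 < sqVol V S) : (innerGram U (gramOn U z Finset.univ)⁻¹ S).det ≠ 0 := by
  intro h0
  refine hS.ne' ?_
  rw [sqVol, h.gram_eq, Matrix.det_mul, Matrix.det_mul, h0]
  ring

/-- Rescaling the columns by `√z` does not change their span, so the diagonal factors cancel. -/
theorem IsWhitening.colProj_eq (h : IsWhitening U z T R V μ) (S : List (Fin n)) :
    colProj (cols V S) =
      R * cols U S * (innerGram U (gramOn U z Finset.univ)⁻¹ S)⁻¹ * (cols U S)ᵀ * Rᵀ := by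
  have hD : IsUnit (Matrix.diagonal fun k => √(z (S.get k))).det := by
    rw [Matrix.det_diagonal, isUnit_iff_ne_zero]
    exact Finset.prod_ne_zero_iff.mpr fun k _ => (Real.sqrt_pos.mpr (h.z_pos _)).ne'
  rw [colProj, h.gram_eq, Matrix.mul_inv_rev, Matrix.mul_inv_rev, h.cols_eq]
  set D := Matrix.diagonal fun k => √(z (S.get k)) with hDdef
  have h1 : D * D⁻¹ = 1 := Matrix.mul_nonsing_inv _ hD
  have h2 : D⁻¹ * Dᵀ = 1 := by
    rw [hDdef, Matrix.diagonal_transpose, ← hDdef]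
    exact Matrix.nonsing_inv_mul _ hD
  simp only [Matrix.transpose_mul, Matrix.mul_assoc]
  rw [← Matrix.mul_assoc D D⁻¹, h1, Matrix.one_mul, ← Matrix.mul_assoc D⁻¹ Dᵀ, h2, Matrix.one_mul]

/-- Conjugation by `R` turns the algorithm's oblique projection into the orthogonal projection onto
the whitened columns; the trace is invariant. -/
theorem IsWhitening.output_eq (h : IsWhitening U z T R V μ) (S : List (Fin n)) :
    ((1 - cols U S * (innerGram U (gramOn U z Finset.univ)⁻¹ S)⁻¹ *
      ((cols U S)ᵀ * (gramOn U z Finset.univ)⁻¹)) *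
      (gramOn U z T * (gramOn U z Finset.univ)⁻¹)).trace = ∑ i, (1 - weight V S i) * μ i := by
  have h1 : ∑ i, (1 - weight V S i) * μ i = ((1 - colProj (cols V S)) * Matrix.diagonal μ).trace := by
    simp [Matrix.trace, Matrix.mul_diagonal, weight]
  rw [h1, h.colProj_eq, ← h.diag]
  set G := (innerGram U (gramOn U z Finset.univ)⁻¹ S)⁻¹
  rw [← h.factor, ← Matrix.mul_assoc (gramOn U z T), ← Matrix.mul_assoc, Matrix.trace_mul_comm]
  congr 1
  simp only [Matrix.sub_mul, Matrix.mul_sub, Matrix.one_mul, Matrix.mul_assoc]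

end Whitening

end FrameScaling

namespace FrameScaling

open scoped Matrix

/-! ### The algorithm terminates with a good approximation -/

section Maximization

variable {K : Type} [Field K] [LinearOrder K] {β : Type} {ok : Event K → Prop} {c : ℕ}

theorem Succeeds.argmaxFrom (hcmp : ok .compare) (f : β → Prog K K) (F : β → K) :
    ∀ (l : List β) (b : β), (∀ x ∈ l, Succeeds ok c (f x) (fun v => v = F x)) →
    Succeeds ok (l.length * (c + 1)) (argmaxFrom f b (F b) l)
      (fun r => r.1 ∈ b :: l ∧ r.2 = F r.1 ∧ ∀ x ∈ b :: l, F x ≤ F r.1)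
  | [], b, _ => by
      refine .pure_le ?_
      simp
  | x :: l, b, h => by
      rw [List.length_cons, show (l.length + 1) * (c + 1) = c + (1 + l.length * (c + 1)) by ring]
      refine (h x List.mem_cons_self).bind ?_
      rintro _ rfl
      refine (Succeeds.leq _ _ hcmp).bind ?_
      rintro _ rfl
      have hl : ∀ y ∈ l, Succeeds ok c (f y) (fun v => v = F y) :=
        fun y hy => h y (List.mem_cons_of_mem _ hy)
      by_cases hle : F x ≤ F b
      · simp only [hle, decide_true, if_true]
        refine (Succeeds.argmaxFrom hcmp f F l b hl).mono le_rfl ?_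
        rintro r ⟨h1, h2, h3⟩
        simp only [List.mem_cons, forall_eq_or_imp] at h1 h3 ⊢
        exact ⟨by tauto, h2, h3.1, hle.trans h3.1, h3.2⟩
      · simp only [hle, decide_false]
        refine (Succeeds.argmaxFrom hcmp f F l x hl).mono le_rfl ?_
        rintro r ⟨h1, h2, h3⟩
        simp only [List.mem_cons, forall_eq_or_imp] at h1 h3 ⊢
        exact ⟨by tauto, h2, (not_le.mp hle).le.trans h3.1, h3.1, h3.2⟩

theorem Succeeds.argmax (hcmp : ok .compare) (f : β → Prog K K) (F : β → K) (l : List β)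
    (h : ∀ x ∈ l, Succeeds ok c (f x) (fun v => v = F x)) :
    Succeeds ok (l.length * (c + 1)) (argmax f l)
      (fun r => (l = [] ∧ r = none) ∨ ∃ b ∈ l, r = some (b, F b) ∧ ∀ x ∈ l, F x ≤ F b) := by
  cases l with
  | nil => exact .pure_le (Or.inl ⟨rfl, rfl⟩)
  | cons b l =>
    refine Succeeds.mono (c := c + (l.length * (c + 1) + 0)) ?_
      (by rw [List.length_cons, Nat.succ_mul]; omega) fun _ => id
    refine (h b List.mem_cons_self).bind ?_
    rintro _ rfl
    refine (Succeeds.argmaxFrom hcmp f F l b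
      fun y hy => h y (List.mem_cons_of_mem _ hy)).bind ?_
    rintro ⟨r, v⟩ ⟨h1, h2, h3⟩
    obtain rfl : v = F r := h2
    exact .pure (Or.inr ⟨r, h1, rfl, h3⟩)

end Maximization

section Algorithm

variable {d n : ℕ} {U : Matrix (Fin d) (Fin n) ℝ} {z : Fin n → ℝ} {T : Finset (Fin n)}
  {R : Matrix (Fin d) (Fin d) ℝ} {V : Matrix (Fin d) (Fin n) ℝ} {μ : Fin d → ℝ}

/-- Summing rank-one products keeps `n` out of the matrix dimensions. The bound `max d 1` instead of
`d` allows for single columns when `d = 0`. -/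
theorem Succeeds.weightedGram (U UZ : Matrix (Fin d) (Fin n) ℝ) : ∀ S : List (Fin n),
    Succeeds (Event.DimLE (max d 1)) (1 + S.length * (1 + d * (d * 1))) (weightedGram U UZ S)
      (fun G => G = fun i k => (S.map fun j => UZ i j * U k j).sum)
  | [] => by
      rw [List.length_nil, Nat.zero_mul]
      refine (Succeeds.lit 0 trivial).bind ?_
      rintro _ rfl
      exact .pure (by ext i k; simp)
  | j :: S => by
      rw [List.length_cons, Nat.succ_mul, ← Nat.add_assoc]
      refine (Succeeds.weightedGram U UZ S).bind ?_
      rintro _ rfl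
      refine (Succeeds.matMul _ _ ?_).bind ?_
      · change max d (max 1 d) ≤ max d 1
        omega
      rintro _ rfl
      refine Succeeds.buildMatrix _ _ _ _ fun i k => (Succeeds.add _ _ trivial).mono le_rfl ?_
      rintro _ rfl
      rw [Matrix.mul_apply, List.map_cons, List.sum_cons, add_comm]
      congr 1
      exact Fin.sum_univ_one _

theorem IsWhitening.subdet_succeeds (h : IsWhitening U z T R V μ) {S : List (Fin n)}
    (hS : S.length ≤ d) :
    Succeeds (Event.DimLE (max d 1)) 3
      (subdet U (fun i j => U i j * z j) (gramOn U z Finset.univ)⁻¹ S) (fun x => x = sqVol V S) := by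
  refine (Succeeds.matMul _ _ ?_).bind (c' := 2) ?_
  · change max S.length (max d d) ≤ max d 1
    omega
  rintro _ rfl
  refine (Succeeds.matMul _ _ ?_).bind (c' := 1) ?_
  · change max S.length (max d S.length) ≤ max d 1
    omega
  rintro _ rfl
  refine (Succeeds.matDet _ ?_).mono le_rfl ?_
  · change S.length ≤ max d 1
    omega
  rintro _ rfl
  exact h.det_eq S

theorem sqVol_cons_of_mem {S : List (Fin n)} {j : Fin n} (hj : j ∈ S) : sqVol V (j :: S) = 0 := by
  by_contra hne
  have := nodup_of_sqVol_pos ((sqVol_nonneg (V := V) (j :: S)).lt_of_ne' hne)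
  exact (List.nodup_cons.mp this).1 hj

theorem sqVol_cons_eq_zero_mono {S S' : List (Fin n)} (hS : S.Sublist S') {j : Fin n}
    (hj : sqVol V (j :: S) = 0) : sqVol V (j :: S') = 0 := by
  by_contra hne
  exact (sqVol_pos_of_sublist ((sqVol_nonneg (V := V) (j :: S')).lt_of_ne' hne)
    (hS.cons_cons j)).ne' hj

/-- A column rejected once stays dependent on every larger list, so the final list is a maximal
independent one. That maximality, rather than the numerical rank, is what the analysis uses. -/
theorem IsWhitening.rankFrom_succeeds (h : IsWhitening U z T R V μ) :
    ∀ (L S : List (Fin n)), 0 < sqVol V S →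
    Succeeds (Event.DimLE (max d 1)) (L.length * 5)
      (rankFrom U (fun i j => U i j * z j) (gramOn U z Finset.univ)⁻¹ S L)
      (fun r => ∃ S', 0 < sqVol V S' ∧ S'.length = r ∧ S.Sublist S' ∧
        ∀ j ∈ L, sqVol V (j :: S') = 0)
  | [], S, hS => by
      refine .pure_le ?_
      exact ⟨S, hS, rfl, List.Sublist.refl _, by simp⟩
  | j :: L, S, hS => by
      have hSd := length_le_of_sqVol_pos hS
      change Succeeds _ _ (if S.length < d then _ else _) _
      split_ifs with hlt
      · rw [List.length_cons, show (L.length + 1) * 5 = 3 + (1 + (1 + L.length * 5)) by ring]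
        refine (h.subdet_succeeds (by simpa using hlt)).bind ?_
        rintro _ rfl
        refine (Succeeds.lit 0 trivial).bind ?_
        rintro _ rfl
        refine (Succeeds.leq _ _ trivial).bind ?_
        rintro _ rfl
        by_cases hj : sqVol V (j :: S) ≤ ((0 : ℕ) : ℝ)
        · simp only [hj, decide_true, if_true]
          refine (h.rankFrom_succeeds L S hS).mono le_rfl ?_
          rintro r ⟨S', h1, h2, h3, h4⟩
          refine ⟨S', h1, h2, h3, List.forall_mem_cons.mpr ⟨?_, h4⟩⟩
          exact sqVol_cons_eq_zero_mono h3 (le_antisymm (by simpa using hj) (sqVol_nonneg _))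
        · simp only [hj, decide_false]
          refine (h.rankFrom_succeeds L (j :: S) (by simpa using hj)).mono le_rfl ?_
          rintro r ⟨S', h1, h2, h3, h4⟩
          refine ⟨S', h1, h2, (List.sublist_cons_self j S).trans h3,
            List.forall_mem_cons.mpr ⟨sqVol_cons_of_mem (h3.subset List.mem_cons_self), h4⟩⟩
      · refine .pure_le ?_
        exact ⟨S, hS, rfl, List.Sublist.refl _,
          -- Stopping at `d` independent columns loses nothing, and it keeps determinants of side at
          -- most `d`.
          fun j _ => sqVol_cons_eq_zero_of_length (by omega) j⟩

/-- The distance is strictly below `1/2`, so no tie occurs and `t ≤ k + 1/2` first holds at `k = p`.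
-/
theorem Succeeds.nearestFrom {ok : Event ℝ → Prop} (hok : ∀ x, ok (.scalar x))
    (hcmp : ok .compare) {t : ℝ} {p : ℕ} (ht : |t - p| < 1 / 2) :
    ∀ m k, k ≤ p → p ≤ k + m →
    Succeeds ok (m * 3) (nearestFrom t (1 / 2 : ℝ) m k) (fun r => r = p)
  | 0, k, hk, hp => .pure_le (by omega)
  | m + 1, k, hk, hp => by
      rw [abs_lt] at ht
      rw [show (m + 1) * 3 = 1 + (1 + (1 + m * 3)) by ring]
      refine (Succeeds.lit k (hok _)).bind ?_
      rintro _ rfl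
      refine (Succeeds.add _ _ (hok _)).bind ?_
      rintro _ rfl
      refine (Succeeds.leq _ _ hcmp).bind ?_
      rintro _ rfl
      rcases hk.eq_or_lt with rfl | hlt
      · have : t ≤ k + 1 / 2 := by linarith
        simp only [this, decide_true, if_true]
        exact .pure_le rfl
      · have h1 : (k : ℝ) + 1 ≤ p := by exact_mod_cast hlt
        have : ¬ t ≤ k + 1 / 2 := by linarith
        simp only [this, decide_false]
        exact Succeeds.nearestFrom hok hcmp (abs_lt.mpr ht) m (k + 1) hlt (by omega)

/-- Averaging: at most `n` extensions have total volume at least half that of `G`. -/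
theorem IsWhitening.exists_greedy (h : IsWhitening U z T R V μ)
    (hμ : ∑ i, μ i * (1 - μ i) < 1 / 4) {G : List (Fin n)} (hG : 0 < sqVol V G)
    (hp : G.length < bigCount μ) : ∃ j ∈ T, sqVol V G ≤ 2 * n * sqVol V (j :: G) := by
  by_contra! hne
  have h1 := half_le_sum_weight h.mul_transpose h.sum_mul_eq hμ hG hp
  have hTn : (T.card : ℝ) ≤ n := by
    have := Finset.card_le_univ T
    rw [Fintype.card_fin] at this
    exact_mod_cast this
  have hT : T.Nonempty := by
    by_contra hT
    rw [Finset.not_nonempty_iff_eq_empty] at hT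
    rw [hT, Finset.sum_empty] at h1
    linarith
  have h2 : ∑ j ∈ T, 2 * n * sqVol V (j :: G) < ∑ _j ∈ T, sqVol V G :=
    Finset.sum_lt_sum_of_nonempty hT hne
  rw [← Finset.mul_sum, Finset.sum_const, nsmul_eq_mul] at h2
  nlinarith

/-- Invariant: `Δ(G) ≥ (2n)^(-|G|)`. It keeps `G` independent and quantifies how good the start of
the local search is. The `4` is a subdeterminant plus a comparison. -/
theorem IsWhitening.greedy_succeeds {L : List (Fin n)} (h : IsWhitening U z L.toFinset R V μ)
    (hL : L.Nodup) (hμ : ∑ i, μ i * (1 - μ i) < 1 / 4) :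
    ∀ (k : ℕ) (G : List (Fin n)), G.length + k = bigCount μ → (∀ j ∈ G, j ∈ L) →
    1 ≤ (2 * n : ℝ) ^ G.length * sqVol V G →
    Succeeds (Event.DimLE (max d 1)) (k * (n * 4))
      (greedy U (fun i j => U i j * z j) (gramOn U z Finset.univ)⁻¹ L k G)
      (fun D => D.length = bigCount μ ∧ (∀ j ∈ D, j ∈ L) ∧
        1 ≤ (2 * n : ℝ) ^ D.length * sqVol V D)
  | 0, G, hk, hGL, hG => .pure_le ⟨hk, hGL, hG⟩
  | k + 1, G, hk, hGL, hG => by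
      have hGpos : 0 < sqVol V G := by
        by_contra hneg
        have : (2 * n : ℝ) ^ G.length * sqVol V G ≤ 0 :=
          mul_nonpos_of_nonneg_of_nonpos (by positivity) (not_lt.mp hneg)
        linarith
      obtain ⟨j, hjT, hj⟩ := h.exists_greedy hμ hGpos (by omega)
      have hjpos : 0 < sqVol V (j :: G) := by
        by_contra hneg
        have : 2 * n * sqVol V (j :: G) ≤ 0 :=
          mul_nonpos_of_nonneg_of_nonpos (by positivity) (not_lt.mp hneg)
        linarith
      -- The averaged element is not already in `G`, since its extension has positive volume; so the
      -- filtered candidate list is nonempty.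
      have hjG := (List.nodup_cons.mp (nodup_of_sqVol_pos hjpos)).1
      have hjl : j ∈ L.filter (fun i => i ∉ G) := by
        simpa [hjG] using hjT
      have hlen : (j :: G).length ≤ d := length_le_of_sqVol_pos hjpos
      have hlist : (L.filter (fun i => i ∉ G)).length * (3 + 1) ≤ n * 4 := by
        have := (List.length_filter_le (fun i => decide (i ∉ G)) L).trans hL.length_le_card
        rw [Fintype.card_fin] at this
        omega
      rw [show (k + 1) * (n * 4) = n * 4 + k * (n * 4) by ring]
      refine ((Succeeds.argmax trivial _ (fun i => sqVol V (i :: G)) _ fun i _ =>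
        h.subdet_succeeds hlen).mono hlist fun _ => id).bind ?_
      rintro r (⟨h1, -⟩ | ⟨b, hb, rfl, hmax⟩)
      · rw [h1] at hjl
        simp at hjl
      · refine h.greedy_succeeds hL hμ k (b :: G) (by simp only [List.length_cons]; omega)
          (List.forall_mem_cons.mpr ⟨(List.mem_filter.mp hb).1, hGL⟩) ?_
        rw [List.length_cons, pow_succ, mul_assoc]
        refine hG.trans (mul_le_mul_of_nonneg_left ?_ (by positivity))
        exact hj.trans (mul_le_mul_of_nonneg_left (hmax j hjl) (by positivity))

/-- The number `k` is a potential: `Δ(D) ≥ 2^(-k)`, every exchange more than doubles `Δ`, and `Δ ≤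
1`, so at most `k` exchanges occur before the final test. -/
theorem IsWhitening.localSearch_succeeds {L : List (Fin n)} (h : IsWhitening U z L.toFinset R V μ)
    (hL : L.Nodup) : ∀ (k fuel : ℕ) (D : List (Fin n)), k < fuel → (∀ j ∈ D, j ∈ L) →
    1 ≤ 2 ^ k * sqVol V D →
    Succeeds (Event.DimLE (max d 1)) ((k + 1) * (3 + (d * n * 4 + 3)))
      (localSearch U (fun i j => U i j * z j) (gramOn U z Finset.univ)⁻¹ L fuel D)
      (fun D' => D'.length = D.length ∧ (∀ j ∈ D', j ∈ L) ∧ 0 < sqVol V D' ∧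
        ∀ i ∈ D', ∀ j ∈ L, j ∉ D' → sqVol V (j :: D'.erase i) ≤ 2 * sqVol V D')
  | _, 0, _, hk, _, _ => absurd hk (Nat.not_lt_zero _)
  | k, fuel + 1, D, hk, hDL, hD => by
      have hDpos : 0 < sqVol V D := by
        by_contra hneg
        have : 2 ^ k * sqVol V D ≤ 0 :=
          mul_nonpos_of_nonneg_of_nonpos (by positivity) (not_lt.mp hneg)
        linarith
      have hlen : D.length ≤ d := length_le_of_sqVol_pos hDpos
      have herase : ∀ i ∈ D, ∀ j : Fin n, (j :: D.erase i).length = D.length := by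
        intro i hi j
        rw [List.length_cons, List.length_erase_of_mem hi]
        have := List.length_pos_of_mem hi
        omega
      have hlist : (D.product (L.filter (fun j => j ∉ D))).length * (3 + 1) ≤ d * n * 4 := by
        have h1 := (List.length_filter_le (fun i => decide (i ∉ D)) L).trans hL.length_le_card
        rw [Fintype.card_fin] at h1
        rw [show (D.product (L.filter (fun j => j ∉ D))).length = _ from List.length_product ..]
        exact Nat.mul_le_mul_right 4 (Nat.mul_le_mul hlen h1)
      rw [show (k + 1) * (3 + (d * n * 4 + 3)) =
        3 + (d * n * 4 + (1 + (1 + (1 + k * (3 + (d * n * 4 + 3)))))) by ring]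
      refine (h.subdet_succeeds hlen).bind ?_
      rintro _ rfl
      refine ((Succeeds.argmax trivial _ (fun e => sqVol V (e.2 :: D.erase e.1)) _ fun e he => ?_
        ).mono hlist fun _ => id).bind ?_
      · have := List.pair_mem_product.mp (show (e.1, e.2) ∈ _ from he)
        exact h.subdet_succeeds (by rw [herase _ this.1]; exact hlen)
      rintro r (⟨h1, rfl⟩ | ⟨⟨i, j⟩, hb, rfl, hmax⟩)
      · refine .pure_le ⟨rfl, hDL, hDpos, fun i hi j hj hjD => ?_⟩
        have : (i, j) ∈ D.product (L.filter (fun j => j ∉ D)) :=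
          List.pair_mem_product.mpr ⟨hi, List.mem_filter.mpr ⟨hj, by simpa using hjD⟩⟩
        rw [h1] at this
        simp at this
      · obtain ⟨hi, hj⟩ := List.pair_mem_product.mp hb
        refine (Succeeds.lit 2 trivial).bind ?_
        rintro _ rfl
        refine (Succeeds.mul _ _ trivial).bind ?_
        rintro _ rfl
        refine (Succeeds.leq _ _ trivial).bind ?_
        rintro _ rfl
        dsimp only
        by_cases hle : sqVol V (j :: D.erase i) ≤ ((2 : ℕ) : ℝ) * sqVol V D
        · simp only [hle, decide_true, if_true]
          refine .pure_le ⟨rfl, hDL, hDpos, fun i' hi' j' hj' hjD' => ?_⟩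
          have hmem : (i', j') ∈ D.product (L.filter (fun j => j ∉ D)) :=
            List.pair_mem_product.mpr ⟨hi', List.mem_filter.mpr ⟨hj', by simpa using hjD'⟩⟩
          simpa using (hmax _ hmem).trans hle
        · simp only [hle, decide_false]
          have hgt : 2 * sqVol V D < sqVol V (j :: D.erase i) := by simpa using hle
          have hle1 := sqVol_le_one h.mul_transpose (j :: D.erase i)
          cases k with
          -- Here `Δ(D) ≥ 1` already, so an exchange would exceed the ceiling.
          | zero => rw [pow_zero, one_mul] at hD; linarith
          | succ k =>
            refine (h.localSearch_succeeds hL k fuel (j :: D.erase i) (by omega) ?_ ?_).mono le_rfl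
              ?_
            · exact List.forall_mem_cons.mpr ⟨(List.mem_filter.mp hj).1,
                fun x hx => hDL x (List.mem_of_mem_erase hx)⟩
            · refine hD.trans ?_
              rw [pow_succ, mul_assoc]
              exact mul_le_mul_of_nonneg_left hgt.le (by positivity)
            · rintro D' ⟨h1, h2⟩
              exact ⟨h1.trans (herase i hi j), h2⟩

end Algorithm

end FrameScaling

namespace FrameScaling

open scoped Matrix

/-! ### The whole algorithm -/

section Total

/-- A bound for the number of instructions executed by the algorithm. -/
def totalCost (d n : ℕ) : ℕ :=
  d * (n * 1) + ((1 + n * (1 + d * (d * 1))) + (1 + ((1 + n * (1 + d * (d * 1))) + (1 + ((d + 1) +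
    (1 + (1 + (1 + (d * 3 + (n * 5 + (d * (n * 4) +
      (d * (Nat.log 2 n + 2) + 1) * (3 + (d * n * 4 + 3)) +
        (1 + (1 + (1 + (1 + (1 + (1 + (d * (d * 1) + (1 + (d + 1))))))))))))))))))))

variable {d n : ℕ} {U : Matrix (Fin d) (Fin n) ℝ} {z : Fin n → ℝ} {L : List (Fin n)}
  {R : Matrix (Fin d) (Fin d) ℝ} {V : Matrix (Fin d) (Fin n) ℝ} {μ : Fin d → ℝ}

theorem bigCount_le (μ : Fin d → ℝ) : bigCount μ ≤ d :=
  (Finset.card_filter_le _ _).trans_eq (by simp)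

theorem IsWhitening.detLocalOpt_succeeds (h : IsWhitening U z L.toFinset R V μ) (hL : L.Nodup)
    (hμ : ∑ i, μ i * (1 - μ i) < 1 / 4) {fuel : ℕ} (hfuel : d * (Nat.log 2 n + 2) < fuel) :
    Succeeds (Event.DimLE (max d 1))
      (d * (n * 4) + (d * (Nat.log 2 n + 2) + 1) * (3 + (d * n * 4 + 3)))
      (detLocalOpt fuel U (fun i j => U i j * z j) (gramOn U z Finset.univ)⁻¹ L (bigCount μ))
      (fun D => D.length = bigCount μ ∧ (∀ j ∈ D, j ∈ L) ∧ 0 < sqVol V D ∧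
        ∀ i ∈ D, ∀ j ∈ L, j ∉ D → sqVol V (j :: D.erase i) ≤ 2 * sqVol V D) := by
  have hp := bigCount_le μ
  refine ((h.greedy_succeeds hL hμ (bigCount μ) [] (by simp) (by simp)
    (by simp [sqVol_nil])).mono (Nat.mul_le_mul_right _ hp) fun _ => id).bind ?_
  rintro G ⟨hG, hGL, hGv⟩
  refine (h.localSearch_succeeds hL (d * (Nat.log 2 n + 2)) fuel G hfuel hGL ?_).mono le_rfl ?_
  · refine hGv.trans (mul_le_mul_of_nonneg_right ?_ (sqVol_nonneg _))
    have h1 : n < 2 ^ (Nat.log 2 n + 1) := Nat.lt_pow_succ_log_self (by norm_num) n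
    -- One extra factor of two covers the rounding of the logarithm, the other the `2` in `2n`; this
    -- is the origin of `Nat.log 2 n + 2` in the number of passes.
    have h2 : 2 * n ≤ 2 ^ (Nat.log 2 n + 2) := by rw [pow_succ 2 (Nat.log 2 n + 1)]; omega
    have h3 : (2 * n : ℝ) ≤ 2 ^ (Nat.log 2 n + 2) := by exact_mod_cast h2
    calc (2 * n : ℝ) ^ G.length ≤ (2 ^ (Nat.log 2 n + 2)) ^ G.length :=
          pow_le_pow_left₀ (by positivity) h3 _
      _ ≤ (2 ^ (Nat.log 2 n + 2)) ^ d :=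
          pow_le_pow_right₀ (one_le_pow₀ (by norm_num)) (by rw [hG]; exact hp)
      _ = 2 ^ (d * (Nat.log 2 n + 2)) := by rw [← pow_mul, mul_comm]
  · rintro D ⟨h1, h2⟩
    exact ⟨h1.trans hG, h2⟩

theorem sum_map_eq_gramOn (hL : L.Nodup) :
    (fun i k => (L.map fun j => U i j * z j * U k j).sum) = gramOn U z L.toFinset := by
  ext i k
  exact (List.sum_toFinset _ hL).symm

theorem sum_finRange_eq_gramOn :
    (fun i k => ((List.finRange n).map fun j => U i j * z j * U k j).sum)
      = gramOn U z Finset.univ := by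
  rw [sum_map_eq_gramOn (List.nodup_finRange n), List.toFinset_finRange]

theorem IsWhitening.output_bounds (h : IsWhitening U z L.toFinset R V μ) (hL : L.Nodup)
    {D : List (Fin n)} (hD : 0 < sqVol V D) (hDL : ∀ j ∈ D, j ∈ L) (hp : D.length = bigCount μ)
    (hp0 : bigCount μ ≠ 0)
    (hopt : ∀ i ∈ D, ∀ j ∈ L, j ∉ D → sqVol V (j :: D.erase i) ≤ 2 * sqVol V D) :
    smallPart μ ≤ ∑ i, (1 - weight V D i) * μ i ∧
      ∑ i, (1 - weight V D i) * μ i ≤ (1 + 8 * n * d ^ 2) * smallPart μ := by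
  refine ⟨smallPart_le_sum (weight_nonneg hD) (weight_le_one hD) (by rw [sum_weight hD, hp]), ?_⟩
  have hs := smallPart_nonneg (eigenvalue_nonneg h.sum_mul_eq)
  have h1 : ∑ j ∈ L.toFinset, sqVol V (j :: D) ≤
      ∑ _j ∈ L.toFinset, (2 * D.length + 1) * smallPart μ * sqVol V D :=
    Finset.sum_le_sum fun j hj => sqVol_cons_le_of_localOpt h.sum_mul_eq hD
      (fun j hj => List.mem_toFinset.mpr (hDL j hj)) hp
      (fun i hi j hj => hopt i hi j (List.mem_toFinset.mp hj)) hj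
  rw [sum_sqVol_cons hD _ μ h.sum_mul_eq, Finset.sum_const, nsmul_eq_mul,
    List.toFinset_card_of_nodup hL, ← mul_assoc, mul_comm] at h1
  refine (le_of_mul_le_mul_right h1 hD).trans ?_
  rw [← mul_assoc]
  refine mul_le_mul_of_nonneg_right ?_ hs
  have hd : bigCount μ ≤ d := bigCount_le μ
  have hLn : L.length ≤ n := by simpa using hL.length_le_card
  -- With `1 ≤ p ≤ d` one has `2p + 1 ≤ 3d ≤ 8d²`. This fails for `d = 0`, hence `hp0`.
  have h2 : L.length * (2 * D.length + 1) ≤ n * (8 * d ^ 2) :=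
    Nat.mul_le_mul hLn (by rw [hp]; nlinarith [Nat.pos_of_ne_zero hp0])
  have h3 : ((L.length * (2 * D.length + 1) : ℕ) : ℝ) ≤ ((n * (8 * d ^ 2) : ℕ) : ℝ) := by
    exact_mod_cast h2
  push_cast at h3
  linarith

theorem IsWhitening.algorithm_succeeds (h : IsWhitening U z L.toFinset R V μ) (hL : L.Nodup)
    (hμ : ∑ i, μ i * (1 - μ i) < 1 / 4) {fuel : ℕ} (hfuel : d * (Nat.log 2 n + 2) < fuel) :
    Succeeds (Event.DimLE (max d 1)) (totalCost d n) (approxSmallEigenSum fuel U z L)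
      (fun x => smallPart μ ≤ x ∧ x ≤ (1 + 8 * n * d ^ 2) * smallPart μ) := by
  have hok : ∀ x : ℝ, Event.DimLE (max d 1) (.scalar x) := fun _ => trivial
  have hdd : max d (max d d) ≤ max d 1 := by omega
  have hLn : L.length ≤ n := by simpa using hL.length_le_card
  have hs := smallPart_nonneg (eigenvalue_nonneg h.sum_mul_eq)
  refine (Succeeds.buildMatrix _ _ _ (fun i j => U i j * z j) fun i j =>
    Succeeds.mul _ _ trivial).bind ?_
  rintro _ rfl
  refine ((Succeeds.weightedGram _ _ _).mono (by rw [List.length_finRange]) fun _ => id).bind ?_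
  rintro _ rfl
  rw [sum_finRange_eq_gramOn]
  refine (Succeeds.matInv _ h.det_ne (le_max_left d 1)).bind ?_
  rintro _ rfl
  refine ((Succeeds.weightedGram _ _ _).mono
    (Nat.add_le_add_left (Nat.mul_le_mul_right _ hLn) _) fun _ => id).bind ?_
  rintro _ rfl
  rw [sum_map_eq_gramOn hL]
  refine (Succeeds.matMul _ _ hdd).bind ?_
  rintro _ rfl
  refine (Succeeds.trace hok _).bind ?_
  rintro _ rfl
  rw [h.trace_eq]
  refine (Succeeds.lit 1 trivial).bind ?_
  rintro _ rfl
  refine (Succeeds.lit 2 trivial).bind ?_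
  rintro _ rfl
  refine (Succeeds.div _ _ (by norm_num) trivial).bind ?_
  rintro _ rfl
  rw [Nat.cast_one, Nat.cast_ofNat]
  refine (Succeeds.nearestFrom hok trivial
    (abs_sum_sub_bigCount_lt (eigenvalue_nonneg h.sum_mul_eq)
      (eigenvalue_le_one h.mul_transpose h.sum_mul_eq) hμ) d 0 (Nat.zero_le _)
    (by rw [zero_add]; exact bigCount_le μ)).bind ?_
  rintro _ rfl
  refine ((h.rankFrom_succeeds L [] (by rw [sqVol_nil]; exact one_pos)).mono
    (Nat.mul_le_mul_right _ hLn) fun _ => id).bind ?_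
  rintro r ⟨S, hS, hSr, -, hS0⟩
  split_ifs with h1 h2
  · refine (Succeeds.lit 0 trivial).mono (by omega) ?_
    rintro _ rfl
    -- The maximal independent list found by the rank computation has exactly `p` elements and no
    -- proper extension in `T`.
    have h3 := smallPart_mul_sqVol_le h.sum_mul_eq hS (hSr.trans h1.symm)
    rw [Finset.sum_eq_zero fun j hj => hS0 j (List.mem_toFinset.mp hj)] at h3
    have h4 : smallPart μ = 0 := le_antisymm (nonpos_of_mul_nonpos_left h3 hS) hs
    simp [h4]
  · refine .pure_le ?_
    -- With `p = 0` no eigenvalue is large, so the trace is already the exact answer.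
    have h3 : ∑ i, μ i = smallPart μ := by
      refine Finset.sum_congr rfl fun i _ => ?_
      have := Finset.filter_eq_empty_iff.mp (Finset.card_eq_zero.mp h2) (Finset.mem_univ i)
      rw [if_neg this]
    rw [h3]
    exact ⟨le_rfl, le_mul_of_one_le_left hs (le_add_of_nonneg_right (by positivity))⟩
  · refine (h.detLocalOpt_succeeds hL hμ hfuel).bind ?_
    rintro D ⟨hp, hDL, hD, hopt⟩
    have hDd : D.length ≤ d := length_le_of_sqVol_pos hD
    refine (Succeeds.matMul _ _ (show max D.length (max d d) ≤ max d 1 by omega)).bind ?_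
    rintro _ rfl
    refine (Succeeds.matMul _ _ (show max D.length (max d D.length) ≤ max d 1 by omega)).bind ?_
    rintro _ rfl
    refine (Succeeds.matInv _ (h.innerGram_det_ne hD)
      (show D.length ≤ max d 1 by omega)).bind ?_
    rintro _ rfl
    refine (Succeeds.matMul _ _ (show max d (max D.length D.length) ≤ max d 1 by omega)).bind ?_
    rintro _ rfl
    refine (Succeeds.matMul _ _ (show max d (max D.length d) ≤ max d 1 by omega)).bind ?_
    rintro _ rfl
    refine (Succeeds.lit 0 trivial).bind ?_
    rintro _ rfl
    refine (Succeeds.buildMatrix _ _ _ _ fun i j => Succeeds.sub _ _ trivial).bind ?_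
    rintro _ rfl
    refine (Succeeds.matMul _ _ hdd).bind ?_
    rintro _ rfl
    refine (Succeeds.trace hok _).mono le_rfl ?_
    rintro _ rfl
    have h3 : ∀ P : Matrix (Fin d) (Fin d) ℝ,
        1 - P = fun i j => (if i = j then 1 else ((0 : ℕ) : ℝ)) - P i j := by
      intro P
      ext i j
      simp [Matrix.one_apply]
    rw [← h3, h.output_eq D]
    exact h.output_bounds hL hD hDL hp h2 hopt

end Total

/-! ### Independence of the number of unrolled passes -/

section Fuel

variable {K : Type} [Field K] [LinearOrder K] {α β : Type}

/-- Whenever `p` returns, `q` returns with the same result and the same events, and the same holds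
for their expansions. -/
def Approximates (p q : Prog K α) : Prop :=
  (∀ r, p.run = some r → q.run = some r) ∧ ∀ r, p.expand.run = some r → q.expand.run = some r

theorem Approximates.refl (p : Prog K α) : Approximates p p := ⟨fun _ => id, fun _ => id⟩

theorem seqRun_mono {K : Type} {r r' : Option (α × List (Event K))}
    {f g : α → Option (β × List (Event K))} (hr : ∀ x, r = some x → r' = some x)
    (hf : ∀ a x, f a = some x → g a = some x) (x : β × List (Event K))
    (h : seqRun r f = some x) : seqRun r' g = some x := by
  cases r with
  | none => simp [seqRun] at h
  | some y =>
    rw [hr y rfl]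
    simp only [seqRun, Option.bind_some, Option.map_eq_some_iff] at h ⊢
    obtain ⟨w, hw, rfl⟩ := h
    exact ⟨w, hf _ _ hw, rfl⟩

theorem Approximates.bind {p q : Prog K α} {f g : α → Prog K β} (h : Approximates p q)
    (hf : ∀ a, Approximates (f a) (g a)) : Approximates (p >>= f) (q >>= g) := by
  constructor
  · intro r
    rw [bind_def, bind_def, Prog.run_bind, Prog.run_bind]
    exact seqRun_mono h.1 (fun a => (hf a).1) r
  · intro r
    rw [bind_def, bind_def, Prog.expand_bind, Prog.expand_bind, Prog.run_bind, Prog.run_bind]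
    exact seqRun_mono h.2 (fun a => (hf a).2) r

theorem Approximates.bind_right (p : Prog K α) {f g : α → Prog K β}
    (hf : ∀ a, Approximates (f a) (g a)) : Approximates (p >>= f) (p >>= g) :=
  (Approximates.refl p).bind hf

variable {d n : ℕ}

/-- Fuel enters only through the divergent base case, so more of it can only make a nonreturning run
return. -/
theorem localSearch_approximates (U UZ : Matrix (Fin d) (Fin n) K) (W : Matrix (Fin d) (Fin d) K)
    (T : List (Fin n)) : ∀ (fuel fuel' : ℕ) (D : List (Fin n)), fuel ≤ fuel' →
    Approximates (localSearch U UZ W T fuel D) (localSearch U UZ W T fuel' D)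
  | 0, _, _, _ => ⟨fun r h => by simp [localSearch, Prog.run] at h,
      fun r h => by simp [localSearch, Prog.expand, Prog.run] at h⟩
  | fuel + 1, 0, _, h => absurd h (by omega)
  | fuel + 1, fuel' + 1, D, h => by
      refine .bind_right _ fun cur => .bind_right _ fun best => ?_
      rcases best with _ | ⟨⟨i, j⟩, v⟩
      · exact .refl _
      · refine .bind_right _ fun two => .bind_right _ fun bound => .bind_right _ fun isLe => ?_
        cases isLe
        · exact localSearch_approximates U UZ W T fuel fuel' _ (by omega)
        · exact .refl _

theorem approxSmallEigenSum_approximates (U : Matrix (Fin d) (Fin n) K) (z : Fin n → K)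
    (T : List (Fin n)) {fuel fuel' : ℕ} (h : fuel ≤ fuel') :
    Approximates (approxSmallEigenSum fuel U z T) (approxSmallEigenSum fuel' U z T) := by
  refine .bind_right _ fun UZ => .bind_right _ fun M => .bind_right _ fun W => .bind_right _
    fun MT => .bind_right _ fun X => .bind_right _ fun t => .bind_right _ fun one => .bind_right _
    fun two => .bind_right _ fun half => .bind_right _ fun p => .bind_right _ fun r => ?_
  split_ifs
  · exact .refl _
  · exact .refl _
  · refine Approximates.bind ?_ fun D => .refl _
    exact .bind_right _ fun G => localSearch_approximates U UZ W T fuel fuel' G h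

end Fuel

end FrameScaling

namespace FrameScaling

open scoped Matrix

/-! ### Fractions with a common denominator -/

section Fractions

/-- A positive denominator of at most `B` bits. -/
def IsDen (q B : ℕ) : Prop := 0 < q ∧ q ≤ 2 ^ B

/-- `x` is a fraction with denominator `q`; numerator and denominator are at most `2 ^ B`. -/
def IsFrac (q B : ℕ) (x : ℝ) : Prop := IsDen q B ∧ ∃ a : ℤ, x * q = a ∧ |a| ≤ 2 ^ B

/-- The entries of `M` are fractions with the common denominator `q`. -/
def MatFrac {a b : ℕ} (q B : ℕ) (M : Matrix (Fin a) (Fin b) ℝ) : Prop :=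
  IsDen q B ∧ ∀ i j, IsFrac q B (M i j)

variable {q q' B B' : ℕ} {x y : ℝ}

theorem IsDen.mono (h : IsDen q B) (hB : B ≤ B') : IsDen q B' :=
  ⟨h.1, h.2.trans (Nat.pow_le_pow_right two_pos hB)⟩

theorem IsDen.one : IsDen 1 B := ⟨one_pos, Nat.one_le_two_pow⟩

theorem IsDen.mul (h : IsDen q B) (h' : IsDen q' B') : IsDen (q * q') (B + B') :=
  ⟨Nat.mul_pos h.1 h'.1, by rw [pow_add]; exact Nat.mul_le_mul h.2 h'.2⟩

theorem IsFrac.mono (h : IsFrac q B x) (hB : B ≤ B') : IsFrac q B' x := by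
  obtain ⟨hq, a, ha, hab⟩ := h
  exact ⟨hq.mono hB, a, ha, hab.trans (pow_le_pow_right₀ (by norm_num) hB)⟩

theorem MatFrac.mono {a b : ℕ} {M : Matrix (Fin a) (Fin b) ℝ} (h : MatFrac q B M) (hB : B ≤ B') :
    MatFrac q B' M := ⟨h.1.mono hB, fun i j => (h.2 i j).mono hB⟩

theorem IsFrac.zero (hq : IsDen q B) : IsFrac q B 0 := ⟨hq, 0, by simp, by positivity⟩

theorem IsFrac.one (hq : IsDen q B) : IsFrac q B 1 :=
  ⟨hq, q, by simp, by rw [Nat.abs_cast]; exact_mod_cast hq.2⟩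

theorem IsFrac.natCast {k : ℕ} (hk : k ≤ 2 ^ B) : IsFrac 1 B k :=
  ⟨.one, k, by simp, by rw [Nat.abs_cast]; exact_mod_cast hk⟩

theorem IsFrac.add (hx : IsFrac q B x) (hy : IsFrac q B y) : IsFrac q (B + 1) (x + y) := by
  obtain ⟨hq, a, ha, hab⟩ := hx
  obtain ⟨-, c, hc, hcb⟩ := hy
  refine ⟨hq.mono (Nat.le_succ B), a + c, by rw [add_mul, ha, hc]; push_cast; ring, ?_⟩
  rw [pow_succ]
  have := abs_add_le a c
  omega

theorem IsFrac.neg (hx : IsFrac q B x) : IsFrac q B (-x) := by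
  obtain ⟨hq, a, ha, hab⟩ := hx
  exact ⟨hq, -a, by rw [neg_mul, ha]; push_cast; ring, by rwa [abs_neg]⟩

theorem IsFrac.sub (hx : IsFrac q B x) (hy : IsFrac q B y) : IsFrac q (B + 1) (x - y) := by
  rw [sub_eq_add_neg]
  exact hx.add hy.neg

theorem IsFrac.mul (hx : IsFrac q B x) (hy : IsFrac q' B' y) :
    IsFrac (q * q') (B + B') (x * y) := by
  obtain ⟨hq, a, ha, hab⟩ := hx
  obtain ⟨hq', c, hc, hcb⟩ := hy
  refine ⟨hq.mul hq', a * c, ?_, ?_⟩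
  · push_cast
    rw [← ha, ← hc]
    ring
  · rw [abs_mul, pow_add]
    exact mul_le_mul hab hcb (abs_nonneg _) (by positivity)

/-- Passing to a multiple of the denominator. -/
theorem IsFrac.mul_den {k c : ℕ} (hx : IsFrac q B x) (hk : IsDen k c) :
    IsFrac (q * k) (B + c) x := by
  simpa using hx.mul (IsFrac.one hk)

theorem IsFrac.div_nat {k c : ℕ} (hx : IsFrac q B x) (hk : IsDen k c) :
    IsFrac (q * k) (B + c) (x / k) := by
  have hk0 : (k : ℝ) ≠ 0 := by exact_mod_cast hk.1.ne'
  obtain ⟨hq, a, ha, hab⟩ := hx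
  refine ⟨hq.mul hk, a, ?_, hab.trans (pow_le_pow_right₀ (by norm_num) (Nat.le_add_right _ _))⟩
  push_cast
  rw [← ha]
  field_simp

/-- The quotients of fractions with a common denominator by one of them have a common
denominator. -/
theorem IsFrac.exists_div (hy : IsFrac q B y) (hy0 : y ≠ 0) :
    ∃ p, IsDen p B ∧ ∀ x, IsFrac q B x → IsFrac p B (x / y) := by
  obtain ⟨hq, c, hc, hcb⟩ := hy
  have hq0 : (q : ℝ) ≠ 0 := by exact_mod_cast hq.1.ne'
  have hc0 : c ≠ 0 := by
    rintro rfl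
    simp [hy0, hq0] at hc
  have hcR : (c : ℝ) ≠ 0 := by exact_mod_cast hc0
  have hden : IsDen c.natAbs B := by
    refine ⟨Int.natAbs_pos.mpr hc0, ?_⟩
    rw [Int.abs_eq_natAbs] at hcb
    exact_mod_cast hcb
  -- In `(a/q) / (c/q)` the denominator `q` cancels. The new common denominator is `|c|`, the sign
  -- of `c` goes to the numerator, and no bits are gained.
  refine ⟨c.natAbs, hden, ?_⟩
  rintro x ⟨-, a, ha, hab⟩
  refine ⟨hden, a * c.sign, ?_, ?_⟩
  · have h1 : ((c.natAbs : ℕ) : ℝ) = c * c.sign := by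
      have h2 : ((c.natAbs : ℤ)) = c * c.sign := by rw [Int.mul_sign_self]
      rw [← Int.cast_natCast, h2, Int.cast_mul]
    have hyc : y = c / q := by field_simp; exact hc
    have hxa : x = a / q := by field_simp; exact ha
    rw [h1, hyc, hxa]
    push_cast
    field_simp
  · rw [abs_mul]
    have : |c.sign| = 1 := by rw [Int.abs_sign_of_ne_zero hc0]
    rwa [this, mul_one]

/-- Reduction to lowest terms only shrinks numerator and denominator; a number up to `2 ^ B`
inclusive may need `B + 1` bits. -/
theorem IsFrac.hasBits (h : IsFrac q B x) : HasBits x (2 * B + 2) := by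
  obtain ⟨hq, a, ha, hab⟩ := h
  have hq0 : (q : ℝ) ≠ 0 := by exact_mod_cast hq.1.ne'
  have hqZ : (q : ℤ) ≠ 0 := by exact_mod_cast hq.1.ne'
  refine ⟨(a : ℚ) / ((q : ℤ) : ℚ), ?_, ?_⟩
  · push_cast
    rw [← ha]
    field_simp
  have h1 : ((a : ℚ) / ((q : ℤ) : ℚ)).num.natAbs ≤ 2 ^ B := by
    have hd := Rat.num_dvd a hqZ
    rw [Rat.divInt_eq_div] at hd
    have ha' : a.natAbs ≤ 2 ^ B := by
      rw [Int.abs_eq_natAbs] at hab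
      exact_mod_cast hab
    rcases eq_or_ne a 0 with rfl | ha0
    · simp
    · exact (Nat.le_of_dvd (Int.natAbs_pos.mpr ha0) (Int.natAbs_dvd_natAbs.mpr hd)).trans ha'
  have h2 : ((a : ℚ) / ((q : ℤ) : ℚ)).den ≤ 2 ^ B :=
    (Nat.le_of_dvd hq.1 (by exact_mod_cast Rat.den_dvd a q)).trans hq.2
  have hlt : ∀ m, m ≤ 2 ^ B → m.size ≤ B + 1 := fun m hm =>
    Nat.size_le.mpr (hm.trans_lt (Nat.pow_lt_pow_right (by norm_num) (Nat.lt_succ_self B)))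
  have := hlt _ h1
  have := hlt _ h2
  unfold bitLength
  omega

theorem HasBits.mono {b b' : ℕ} (h : HasBits x b) (hb : b ≤ b') : HasBits x b' := by
  obtain ⟨r, h1, h2⟩ := h
  exact ⟨r, h1, h2.trans hb⟩

/-- Finitely many rational numbers have a common denominator. -/
theorem exists_common_den {ι : Type} [Fintype ι] (f : ι → ℝ) (b : ℕ) (h : ∀ i, HasBits (f i) b) :
    ∃ q, IsDen q (b + b * Fintype.card ι) ∧ ∀ i, IsFrac q (b + b * Fintype.card ι) (f i) := by
  classical
  choose r hr hb using h
  have hden : ∀ i, (r i).den ≤ 2 ^ b := fun i =>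
    (Nat.size_le.mp ((Nat.le_add_left _ _).trans (hb i))).le
  have hnum : ∀ i, (r i).num.natAbs ≤ 2 ^ b := fun i =>
    (Nat.size_le.mp ((Nat.le_add_right _ _).trans (hb i))).le
  have hprod : ∀ s : Finset ι, ∏ i ∈ s, (r i).den ≤ 2 ^ (b * Fintype.card ι) := by
    intro s
    calc ∏ i ∈ s, (r i).den ≤ ∏ _i ∈ s, 2 ^ b := Finset.prod_le_prod' fun i _ => hden i
      _ = 2 ^ (b * s.card) := by rw [Finset.prod_const, pow_mul]
      _ ≤ _ := Nat.pow_le_pow_right two_pos (Nat.mul_le_mul_left _ (Finset.card_le_univ s))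
  have hq : IsDen (∏ i, (r i).den) (b + b * Fintype.card ι) :=
    ⟨Finset.prod_pos fun i _ => (r i).den_pos,
      (hprod _).trans (Nat.pow_le_pow_right two_pos (Nat.le_add_left _ _))⟩
  -- The denominator is the product of all denominators; each numerator is multiplied by those of
  -- the others.
  refine ⟨_, hq, fun i => ⟨hq, (r i).num * ∏ k ∈ Finset.univ.erase i, ((r k).den : ℤ), ?_, ?_⟩⟩
  · rw [← Finset.mul_prod_erase _ _ (Finset.mem_univ i), ← hr i]
    push_cast
    rw [← mul_assoc]
    congr 1
    exact_mod_cast Rat.mul_den_eq_num (r i)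
  · have h2 : |∏ k ∈ Finset.univ.erase i, ((r k).den : ℤ)| ≤ 2 ^ (b * Fintype.card ι) := by
      rw [← Nat.cast_prod, Nat.abs_cast]
      exact_mod_cast hprod _
    have h1 : |(r i).num| ≤ 2 ^ b := by
      rw [Int.abs_eq_natAbs]
      exact_mod_cast hnum i
    rw [abs_mul, pow_add]
    exact mul_le_mul h1 h2 (abs_nonneg _) (by positivity)

end Fractions

/-! ### Bit lengths in elementary programs -/

section Bits

/-- The scalar produced is a fraction of two numbers of absolute value at most `2 ^ B₀`. -/
def Event.Small (B₀ : ℕ) : Event ℝ → Prop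
  | .scalar x => ∃ q, IsFrac q B₀ x
  | _ => True

variable {α β : Type} {B₀ : ℕ}

/-- If the expansion of `p` returns, then the result has property `Q` and all scalars produced are
small. -/
def SmallRun (B₀ : ℕ) (p : Prog ℝ α) (Q : α → Prop) : Prop := Ensures (Event.Small B₀) p.expand Q

theorem SmallRun.mono {p : Prog ℝ α} {Q Q' : α → Prop} (h : SmallRun B₀ p Q)
    (hQ : ∀ a, Q a → Q' a) : SmallRun B₀ p Q' := Ensures.mono h hQ

theorem SmallRun.bind {p : Prog ℝ α} {f : α → Prog ℝ β} {Q : α → Prop} {R : β → Prop}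
    (h : SmallRun B₀ p Q) (hf : ∀ a, Q a → SmallRun B₀ (f a) R) : SmallRun B₀ (p >>= f) R := by
  unfold SmallRun
  rw [bind_def, Prog.expand_bind]
  exact Ensures.bind h hf

theorem SmallRun.pure {a : α} {Q : α → Prop} (h : Q a) : SmallRun B₀ (pure a : Prog ℝ α) Q :=
  Ensures.ret h

theorem SmallRun.of_run {p : Prog ℝ α} {a : α} {E : List (Event ℝ)} {Q : α → Prop}
    (h : p.expand.run = some (a, E)) (ha : Q a) (hE : ∀ e ∈ E, e.Small B₀) : SmallRun B₀ p Q := by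
  intro b E' h'
  rw [h, Option.some.injEq, Prod.mk.injEq] at h'
  obtain ⟨rfl, rfl⟩ := h'
  exact ⟨ha, hE⟩

variable {q B : ℕ} {x y : ℝ}

theorem SmallRun.lit {k : ℕ} (hk : k ≤ 2 ^ B₀) :
    SmallRun B₀ (FrameScaling.lit k) (fun x : ℝ => x = k) :=
  .of_run rfl rfl (by simpa [Event.Small] using ⟨1, IsFrac.natCast hk⟩)

theorem SmallRun.add (hx : IsFrac q B x) (hy : IsFrac q B y) (hB : B + 1 ≤ B₀) :
    SmallRun B₀ (FrameScaling.add x y) (IsFrac q (B + 1)) :=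
  .of_run rfl (hx.add hy) (by simpa [Event.Small] using ⟨q, (hx.add hy).mono hB⟩)

theorem SmallRun.sub (hx : IsFrac q B x) (hy : IsFrac q B y) (hB : B + 1 ≤ B₀) :
    SmallRun B₀ (FrameScaling.sub x y) (IsFrac q (B + 1)) :=
  .of_run rfl (hx.sub hy) (by simpa [Event.Small] using ⟨q, (hx.sub hy).mono hB⟩)

theorem SmallRun.mul {q' B' : ℕ} (hx : IsFrac q B x) (hy : IsFrac q' B' y) (hB : B + B' ≤ B₀) :
    SmallRun B₀ (FrameScaling.mul x y) (IsFrac (q * q') (B + B')) :=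
  .of_run rfl (hx.mul hy) (by simpa [Event.Small] using ⟨_, (hx.mul hy).mono hB⟩)

/-- A division by zero does not return, so the bound is needed only for `y ≠ 0`, and `y ≠ 0` may be
assumed afterwards. Nonvanishing thus need not be proved a second time. -/
theorem SmallRun.div (h : y ≠ 0 → IsFrac q B (x / y)) (hB : B ≤ B₀) :
    SmallRun B₀ (FrameScaling.div x y) (fun v => y ≠ 0 ∧ IsFrac q B v) := by
  by_cases hy : y = 0
  · intro a E hr
    simp [FrameScaling.div, Prog.expand, Prog.run, ArithOp.eval, hy] at hr
  · exact .of_run (a := x / y) (E := [.scalar (x / y)])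
      (by simp [FrameScaling.div, Prog.expand, Prog.run, ArithOp.eval, hy]) ⟨hy, h hy⟩
      (by simpa [Event.Small] using ⟨q, (h hy).mono hB⟩)

theorem SmallRun.leq (x y : ℝ) : SmallRun B₀ (FrameScaling.leq x y) (fun _ => True) :=
  .of_run rfl trivial (by simp [Event.Small])

/-- The elementary code is its own expansion, so its bounds transfer to the single instruction. -/
theorem SmallRun.matMul {a b c : ℕ} {A : Matrix (Fin a) (Fin b) ℝ} {C : Matrix (Fin b) (Fin c) ℝ}
    {Q : Matrix (Fin a) (Fin c) ℝ → Prop} (h : SmallRun B₀ (mulElem A C) Q) :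
    SmallRun B₀ (FrameScaling.matMul A C) Q := by
  rw [SmallRun, IsElementary.mulElem] at h
  exact Ensures.bind h fun _ h => Ensures.ret h

theorem SmallRun.matDet {m : ℕ} {A : Matrix (Fin m) (Fin m) ℝ} {Q : ℝ → Prop}
    (h : SmallRun B₀ (detElem A) Q) : SmallRun B₀ (FrameScaling.matDet A) Q := by
  rw [SmallRun, IsElementary.detElem] at h
  exact Ensures.bind h fun _ h => Ensures.ret h

theorem SmallRun.matInv {m : ℕ} {A : Matrix (Fin m) (Fin m) ℝ}
    {Q : Matrix (Fin m) (Fin m) ℝ → Prop} (h : SmallRun B₀ (invElem A) Q) :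
    SmallRun B₀ (FrameScaling.matInv A) Q := by
  rw [SmallRun, IsElementary.invElem] at h
  exact Ensures.bind h fun _ h => Ensures.ret h

theorem SmallRun.forFin : ∀ (m : ℕ) (f : Fin m → Prog ℝ β) (R : Fin m → β → Prop),
    (∀ i, SmallRun B₀ (f i) (R i)) → SmallRun B₀ (forFin m f) (fun g => ∀ i, R i (g i))
  | 0, _, _, _ => .pure fun i => i.elim0
  | m + 1, _, R, h => (h 0).bind fun _ hx =>
      (SmallRun.forFin m _ (fun i => R i.succ) fun i => h i.succ).bind fun _ hg =>
        .pure (Fin.cases hx hg)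

theorem SmallRun.buildMatrix {a b : ℕ} {f : Fin a → Fin b → Prog ℝ ℝ} {R : ℝ → Prop}
    (h : ∀ i j, SmallRun B₀ (f i j) R) :
    SmallRun B₀ (buildMatrix a b f) (fun M => ∀ i j, R (M i j)) :=
  SmallRun.forFin _ _ _ fun i => SmallRun.forFin _ _ _ fun j => h i j

/-- Over a fixed denominator each addition costs one bit. -/
theorem SmallRun.sumFrom : ∀ (m B : ℕ) (acc : ℝ) (f : Fin m → Prog ℝ ℝ), IsFrac q B acc →
    (∀ i, SmallRun B₀ (f i) (IsFrac q B)) → B + m ≤ B₀ →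
    SmallRun B₀ (sumFrom acc m f) (IsFrac q (B + m))
  | 0, _, _, _, hacc, _, _ => .pure hacc
  | m + 1, B, _, f, hacc, hf, hB => by
      rw [show B + (m + 1) = B + 1 + m by ring] at hB ⊢
      refine (hf 0).bind fun x hx => (SmallRun.add hacc hx (by omega)).bind fun y hy => ?_
      exact SmallRun.sumFrom m (B + 1) y _ hy
        (fun i => (hf i.succ).mono fun _ h => h.mono (Nat.le_succ B)) hB

theorem SmallRun.trace {m : ℕ} {A : Matrix (Fin m) (Fin m) ℝ} (hA : MatFrac q B A)
    (hB : B + m ≤ B₀) : SmallRun B₀ (trace A) (IsFrac q (B + m)) := by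
  refine (SmallRun.lit (Nat.zero_le _)).bind ?_
  rintro _ rfl
  exact SmallRun.sumFrom m B _ _ (by rw [Nat.cast_zero]; exact .zero hA.1)
    (fun i => .pure (hA.2 i i)) hB

theorem SmallRun.mulElem {q' B' a b c : ℕ} {A : Matrix (Fin a) (Fin b) ℝ}
    {C : Matrix (Fin b) (Fin c) ℝ} (hA : MatFrac q B A) (hC : MatFrac q' B' C)
    (hB : B + B' + b ≤ B₀) :
    SmallRun B₀ (mulElem A C) (MatFrac (q * q') (B + B' + b)) := by
  have hden := hA.1.mul hC.1
  refine (SmallRun.lit (Nat.zero_le _)).bind ?_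
  rintro _ rfl
  refine (SmallRun.buildMatrix fun i k => SmallRun.sumFrom b (B + B') _ _
    (by rw [Nat.cast_zero]; exact .zero hden)
    (fun j => SmallRun.mul (hA.2 i j) (hC.2 j k) (by omega)) hB).mono fun M hM => ?_
  exact ⟨hden.mono (Nat.le_add_right _ _), hM⟩

/-- The bit bound after `k` steps of the Faddeev–LeVerrier recursion. -/
def levBits (m B k : ℕ) : ℕ := k * (B + 3 * m + 2)

/-- Step `k` multiplies the denominator by `q`, from the product with `A`, and by `k + 1`, from the
division. The increment `B + 3m + 2` of `levBits` is one bit for adding `c`, `B + m` for the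
product, `m` for the trace, `m` for dividing by `k + 1 ≤ 2 ^ m`, and one for the subtraction. -/
theorem SmallRun.leverrier {m : ℕ} {A : Matrix (Fin m) (Fin m) ℝ} (hA : MatFrac q B A) :
    ∀ k, k ≤ m → levBits m B k ≤ B₀ →
    SmallRun B₀ (leverrier A k) (fun r => MatFrac (q ^ k * k.factorial) (levBits m B k) r.1 ∧
      MatFrac (q ^ k * k.factorial) (levBits m B k) r.2.1 ∧
      IsFrac (q ^ k * k.factorial) (levBits m B k) r.2.2)
  | 0, _, _ => by
      refine (SmallRun.lit (Nat.zero_le _)).bind ?_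
      rintro _ rfl
      refine (SmallRun.lit Nat.one_le_two_pow).bind ?_
      rintro _ rfl
      have h1 : IsDen (q ^ 0 * Nat.factorial 0) (levBits m B 0) := by simpa using IsDen.one
      refine .pure ⟨⟨h1, fun i j => ?_⟩, ⟨h1, fun i j => ?_⟩, ?_⟩
      · simpa using IsFrac.zero h1
      · simpa using IsFrac.zero h1
      · simpa using IsFrac.one h1
  | k + 1, hk, hB => by
      have hlev : levBits m B (k + 1) = levBits m B k + (B + 3 * m + 2) := by
        unfold levBits; ring
      rw [hlev] at hB
      have hden : q ^ (k + 1) * (k + 1).factorial = q * (q ^ k * k.factorial) * (k + 1) := by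
        rw [Nat.factorial_succ]; ring
      have hkm : k + 1 ≤ 2 ^ m := hk.trans Nat.lt_two_pow_self.le
      have hkden : IsDen (k + 1) m := ⟨Nat.succ_pos k, hkm⟩
      rw [hlev, hden]
      refine (SmallRun.leverrier hA k (by omega) (by omega)).bind ?_
      rintro ⟨_, N, c⟩ ⟨-, hN, hc⟩
      set L := levBits m B k
      refine (SmallRun.buildMatrix (R := IsFrac (q ^ k * k.factorial) (L + 1))
        fun i j => ?_).bind fun M hM => ?_
      · split_ifs
        · exact SmallRun.add (hN.2 i j) hc (by omega)
        · exact .pure ((hN.2 i j).mono (Nat.le_succ L))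
      have hM' : MatFrac (q ^ k * k.factorial) (L + 1) M := ⟨hN.1.mono (Nat.le_succ L), hM⟩
      refine (SmallRun.mulElem hA hM' (by omega)).bind fun N' hN' => ?_
      refine (SmallRun.trace hN' (by omega)).bind fun t ht => ?_
      refine (SmallRun.lit (hkm.trans (Nat.pow_le_pow_right two_pos (by omega)))).bind ?_
      rintro _ rfl
      refine (SmallRun.div (fun _ => ht.div_nat hkden) (by omega)).bind ?_
      rintro w ⟨-, hw⟩
      refine (SmallRun.lit (Nat.zero_le _)).bind ?_
      rintro _ rfl
      refine (SmallRun.sub (by rw [Nat.cast_zero]; exact .zero hw.1) hw (by omega)).bind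
        fun c' hc' => ?_
      refine .pure ⟨⟨?_, fun i j => ?_⟩, ⟨?_, fun i j => ?_⟩, hc'.mono (by omega)⟩
      · exact hc'.1.mono (by omega)
      · rw [show q * (q ^ k * k.factorial) * (k + 1) = q ^ k * k.factorial * q * (k + 1) by ring]
        exact (((hM i j).mul_den hA.1).mul_den hkden).mono (by omega)
      · exact hc'.1.mono (by omega)
      · exact ((hN'.2 i j).mul_den hkden).mono (by omega)

theorem SmallRun.detElem {m : ℕ} {A : Matrix (Fin m) (Fin m) ℝ} (hA : MatFrac q B A)
    (hB : levBits m B m + 1 ≤ B₀) :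
    SmallRun B₀ (detElem A) (fun x => ∃ p, IsFrac p (levBits m B m + 1) x) := by
  refine (SmallRun.leverrier hA m le_rfl (by omega)).bind ?_
  rintro ⟨M, N, c⟩ ⟨-, -, hc⟩
  split_ifs
  · exact .pure ⟨_, hc.mono (Nat.le_succ _)⟩
  · refine (SmallRun.lit (Nat.zero_le _)).bind ?_
    rintro _ rfl
    exact (SmallRun.sub (by rw [Nat.cast_zero]; exact .zero hc.1) hc hB).mono fun _ h => ⟨_, h⟩

theorem SmallRun.invElem {m : ℕ} {A : Matrix (Fin m) (Fin m) ℝ} (hA : MatFrac q B A)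
    (hB : levBits m B m + 1 ≤ B₀) :
    SmallRun B₀ (invElem A) (fun C => ∃ p, MatFrac p (levBits m B m + 1) C) := by
  refine (SmallRun.leverrier hA m le_rfl (by omega)).bind ?_
  rintro ⟨M, N, c⟩ ⟨hM, -, hc⟩
  refine (SmallRun.lit (Nat.zero_le _)).bind ?_
  rintro _ rfl
  refine (SmallRun.sub (by rw [Nat.cast_zero]; exact .zero hc.1) hc hB).bind fun c' hc' => ?_
  by_cases h0 : c' = 0
  -- With a zero divisor the program returns only if the matrix has no entries, and then any
  -- denominator serves.
  · refine (SmallRun.buildMatrix fun i j => (SmallRun.div (q := 1) (B := 0)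
      (fun h => absurd h0 h) (Nat.zero_le _)).mono fun _ h => h.1).mono fun C hC => ?_
    exact ⟨1, .one, fun i j => absurd h0 (hC i j)⟩
  · obtain ⟨p, hp, hdiv⟩ := hc'.exists_div h0
    refine (SmallRun.buildMatrix fun i j => SmallRun.div
      (fun _ => hdiv _ ((hM.2 i j).mono (Nat.le_succ _))) hB).mono fun C hC => ?_
    exact ⟨p, hp, fun i j => (hC i j).2⟩

end Bits

end FrameScaling

namespace FrameScaling

open scoped Matrix

/-! ### Bit lengths in the algorithm -/

section AlgorithmBits

variable {s : ℕ}

/-- All bit bounds are powers of one parameter `s`; a matrix product then costs two in the exponent,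
and an inverse or a determinant three (`levBits_le`). -/
theorem pow_add_pow_add_le {i j k a : ℕ} (hs : 2 ≤ s) (hi : i ≤ k) (hj : j ≤ k) (hk : 1 ≤ k)
    (ha : a ≤ s) : s ^ i + s ^ j + a ≤ s ^ (k + 2) := by
  have h1 : s ^ i ≤ s ^ k := Nat.pow_le_pow_right (by omega) hi
  have h2 : s ^ j ≤ s ^ k := Nat.pow_le_pow_right (by omega) hj
  have h3 : s ^ 1 ≤ s ^ k := Nat.pow_le_pow_right (by omega) hk
  have h4 : s ^ k * 4 ≤ s ^ k * s ^ 2 := Nat.mul_le_mul_left _ (Nat.pow_le_pow_left hs 2)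
  rw [pow_one] at h3
  rw [pow_add]
  omega

theorem pow_add_le {i k a : ℕ} (hs : 2 ≤ s) (hi : i ≤ k) (hk : 1 ≤ k) (ha : a ≤ s) :
    s ^ i + a ≤ s ^ (k + 1) := by
  have h1 : s ^ i ≤ s ^ k := Nat.pow_le_pow_right (by omega) hi
  have h3 : s ^ 1 ≤ s ^ k := Nat.pow_le_pow_right (by omega) hk
  have h4 : s ^ k * 2 ≤ s ^ k * s := Nat.mul_le_mul_left _ hs
  rw [pow_one] at h3
  rw [pow_add, pow_one]
  omega

theorem levBits_le {i m : ℕ} (hs : 2 ≤ s) (hi : 3 ≤ i) (hm : m ≤ s) :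
    levBits m (s ^ i) m + 1 ≤ s ^ (i + 3) := by
  have h1 : s ^ 3 ≤ s ^ i := Nat.pow_le_pow_right (by omega) hi
  have h2 : 4 * s ≤ s ^ 3 := by
    have : s * 2 ^ 2 ≤ s * s ^ 2 := Nat.mul_le_mul_left _ (Nat.pow_le_pow_left hs 2)
    linarith [pow_succ' s 2]
  have h3 : levBits m (s ^ i) m ≤ s * (2 * s ^ i) := by
    unfold levBits
    exact Nat.mul_le_mul hm (by omega)
  have h4 : s * (2 * s ^ i) ≤ s * (s * s ^ i) :=
    Nat.mul_le_mul_left _ (Nat.mul_le_mul_right _ hs)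
  have h5 : s * (s * s ^ i) = s ^ (i + 2) := by ring
  have h6 : 1 ≤ s ^ (i + 2) := Nat.one_le_pow _ _ (by omega)
  have h7 : s ^ (i + 2) * 2 ≤ s ^ (i + 2) * s := Nat.mul_le_mul_left _ hs
  have h8 : s ^ (i + 2) * s = s ^ (i + 3) := by ring
  omega

theorem MatFrac.transpose {q B a b : ℕ} {M : Matrix (Fin a) (Fin b) ℝ} (h : MatFrac q B M) :
    MatFrac q B Mᵀ := ⟨h.1, fun i j => h.2 j i⟩

theorem MatFrac.cols {q B a b : ℕ} {M : Matrix (Fin a) (Fin b) ℝ} (h : MatFrac q B M)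
    (S : List (Fin b)) : MatFrac q B (FrameScaling.cols M S) := ⟨h.1, fun _ _ => h.2 _ _⟩

theorem SmallRun.matMul_pow {q q' i j a b c B₀ : ℕ} {A : Matrix (Fin a) (Fin b) ℝ}
    {C : Matrix (Fin b) (Fin c) ℝ} (k : ℕ) (hs : 2 ≤ s) (hA : MatFrac q (s ^ i) A)
    (hC : MatFrac q' (s ^ j) C) (hb : b ≤ s) (hi : i ≤ k) (hj : j ≤ k) (hk : 1 ≤ k)
    (hB : s ^ (k + 2) ≤ B₀) :
    SmallRun B₀ (FrameScaling.matMul A C) (fun M => ∃ p, MatFrac p (s ^ (k + 2)) M) := by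
  have h := pow_add_pow_add_le hs hi hj hk hb
  exact SmallRun.matMul ((SmallRun.mulElem hA hC (h.trans hB)).mono fun _ h' => ⟨_, h'.mono h⟩)

theorem SmallRun.matInv_pow {q i m B₀ : ℕ} {A : Matrix (Fin m) (Fin m) ℝ} (hs : 2 ≤ s)
    (hA : MatFrac q (s ^ i) A) (hm : m ≤ s) (hi : 3 ≤ i) (hB : s ^ (i + 3) ≤ B₀) :
    SmallRun B₀ (FrameScaling.matInv A) (fun M => ∃ p, MatFrac p (s ^ (i + 3)) M) := by
  have h := levBits_le hs hi hm
  exact SmallRun.matInv ((SmallRun.invElem hA (h.trans hB)).mono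
    fun _ ⟨p, hp⟩ => ⟨p, hp.mono h⟩)

variable {d n B₀ : ℕ} {U UZ : Matrix (Fin d) (Fin n) ℝ} {W : Matrix (Fin d) (Fin d) ℝ}

theorem SmallRun.weightedGram {q q' B B' : ℕ} (hU : MatFrac q B U) (hUZ : MatFrac q' B' UZ) :
    ∀ S : List (Fin n), B' + B + 1 + S.length ≤ B₀ →
    SmallRun B₀ (weightedGram U UZ S) (MatFrac (q' * q) (B' + B + 1 + S.length))
  | [], _ => by
      have hden := (hUZ.1.mul hU.1).mono (show B' + B ≤ B' + B + 1 + 0 by omega)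
      refine (SmallRun.lit (Nat.zero_le _)).bind ?_
      rintro _ rfl
      exact .pure ⟨hden, fun i j => by rw [Nat.cast_zero]; exact .zero hden⟩
  | j :: S, h => by
      rw [List.length_cons, ← Nat.add_assoc] at h ⊢
      refine (SmallRun.weightedGram hU hUZ S (by omega)).bind fun G hG => ?_
      refine (SmallRun.matMul (SmallRun.mulElem (hUZ.cols [j]) (hU.cols [j]).transpose
        (show B' + B + 1 ≤ B₀ by omega))).bind fun M hM => ?_
      refine (SmallRun.buildMatrix fun i k => SmallRun.add (hG.2 i k)
        ((hM.2 i k).mono (Nat.le_add_right _ _)) h).mono fun C hC => ?_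
      exact ⟨hG.1.mono (Nat.le_succ _), hC⟩

/-- Subdeterminants are small. -/
def SmallSubdet (B₀ B : ℕ) (U UZ : Matrix (Fin d) (Fin n) ℝ) (W : Matrix (Fin d) (Fin d) ℝ) :
    Prop := ∀ S : List (Fin n), S.length ≤ d →
      SmallRun B₀ (subdet U UZ W S) (fun x => ∃ p, IsFrac p B x)

theorem SmallRun.argmaxFrom {β : Type} (f : β → Prog ℝ ℝ) (R : ℝ → Prop) :
    ∀ (l : List β) (b : β) (v : ℝ), R v → (∀ x ∈ l, SmallRun B₀ (f x) R) →
    SmallRun B₀ (argmaxFrom f b v l) (fun r => r.1 ∈ b :: l ∧ R r.2)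
  | [], b, v, hv, _ => .pure ⟨List.mem_cons_self, hv⟩
  | c :: l, b, v, hv, h => by
      refine (h c List.mem_cons_self).bind fun w hw => (SmallRun.leq _ _).bind fun isLe _ => ?_
      have hl : ∀ x ∈ l, SmallRun B₀ (f x) R := fun x hx => h x (List.mem_cons_of_mem _ hx)
      cases isLe
      · refine (SmallRun.argmaxFrom f R l c w hw hl).mono fun r hr => ⟨?_, hr.2⟩
        exact List.mem_cons_of_mem _ hr.1
      · refine (SmallRun.argmaxFrom f R l b v hv hl).mono fun r hr => ⟨?_, hr.2⟩
        rcases List.mem_cons.mp hr.1 with h' | h'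
        · exact List.mem_cons.mpr (Or.inl h')
        · exact List.mem_cons_of_mem _ (List.mem_cons_of_mem _ h')

/-- Optimality is irrelevant for bit lengths. Membership is kept so that an exchange is known to
preserve the length of the list. -/
theorem SmallRun.argmax {β : Type} (f : β → Prog ℝ ℝ) (R : ℝ → Prop) (l : List β)
    (h : ∀ x ∈ l, SmallRun B₀ (f x) R) :
    SmallRun B₀ (argmax f l) (fun r => ∀ b v, r = some (b, v) → b ∈ l) := by
  cases l with
  | nil => exact .pure (by simp)
  | cons b l =>
    refine (h b List.mem_cons_self).bind fun v hv =>
      (SmallRun.argmaxFrom f R l b v hv fun x hx => h x (List.mem_cons_of_mem _ hx)).bind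
        fun r hr => .pure ?_
    rintro b' v' h'
    rw [Option.some.injEq] at h'
    rw [h'] at hr
    exact hr.1

theorem SmallSubdet.rankFrom {B : ℕ} (h : SmallSubdet B₀ B U UZ W) :
    ∀ L S : List (Fin n), SmallRun B₀ (rankFrom U UZ W S L) (fun _ => True)
  | [], _ => .pure trivial
  | j :: L, S => by
      change SmallRun _ (if S.length < d then _ else _) _
      split_ifs with hlt
      · refine (h (j :: S) hlt).bind fun x _ => ?_
        refine (SmallRun.lit (Nat.zero_le _)).bind fun zero _ => ?_
        refine (SmallRun.leq _ _).bind fun isLe _ => ?_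
        cases isLe
        · exact h.rankFrom L (j :: S)
        · exact h.rankFrom L S
      · exact .pure trivial

/-- `t` is only compared, never computed with, so nothing is assumed about it. -/
theorem SmallRun.nearestFrom {B : ℕ} (hB : B + 1 ≤ B₀) (t : ℝ) {half : ℝ}
    (hhalf : IsFrac 2 B half) :
    ∀ m k, 2 * (k + m) ≤ 2 ^ B → SmallRun B₀ (nearestFrom t half m k) (fun p => p ≤ k + m)
  | 0, k, _ => .pure le_rfl
  | m + 1, k, hk => by
      have hkB : k ≤ 2 ^ B := by omega
      refine (SmallRun.lit (hkB.trans (Nat.pow_le_pow_right two_pos (by omega)))).bind ?_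
      rintro _ rfl
      -- The integer is written over the denominator of `half`, so that the sum stays over `2`.
      have hfrac : IsFrac 2 B (k : ℝ) := by
        refine ⟨hhalf.1, 2 * k, by push_cast; ring, ?_⟩
        rw [abs_of_nonneg (by positivity)]
        have : 2 * k ≤ 2 ^ B := by omega
        exact_mod_cast this
      refine (SmallRun.add hfrac hhalf hB).bind fun c _ => ?_
      refine (SmallRun.leq _ _).bind fun isLe _ => ?_
      cases isLe
      · exact (SmallRun.nearestFrom hB t hhalf m (k + 1) (by omega)).mono fun p hp => by omega
      · exact .pure (by omega)

theorem SmallSubdet.greedy {B : ℕ} (h : SmallSubdet B₀ B U UZ W) (L : List (Fin n)) :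
    ∀ (k : ℕ) (G : List (Fin n)), G.length + k ≤ d →
    SmallRun B₀ (greedy U UZ W L k G) (fun D => D.length ≤ d)
  | 0, _, hG => .pure hG
  | k + 1, G, hG => by
      refine (SmallRun.argmax _ _ _ fun i _ =>
        h (i :: G) (by rw [List.length_cons]; omega)).bind fun best _ => ?_
      rcases best with _ | ⟨i, v⟩
      · exact .pure (by omega)
      · exact h.greedy L k (i :: G) (by rw [List.length_cons]; omega)

/-- Each pass computes from the fixed matrices only, so the bound does not depend on the number of
passes. -/
theorem SmallSubdet.localSearch {B : ℕ} (h : SmallSubdet B₀ B U UZ W) (hB : 2 + B ≤ B₀)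
    (L : List (Fin n)) : ∀ (fuel : ℕ) (D : List (Fin n)), D.length ≤ d →
    SmallRun B₀ (localSearch U UZ W L fuel D) (fun D' => D'.length ≤ d)
  | 0, _, _ => fun _ _ hr => by simp [FrameScaling.localSearch, Prog.expand, Prog.run] at hr
  | fuel + 1, D, hD => by
      have herase : ∀ i ∈ D, ∀ j : Fin n, (j :: D.erase i).length ≤ d := by
        intro i hi j
        rw [List.length_cons, List.length_erase_of_mem hi]
        have := List.length_pos_of_mem hi
        omega
      refine (h D hD).bind fun cur ⟨p, hcur⟩ => ?_
      refine (SmallRun.argmax _ _ _ fun e he =>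
        h (e.2 :: D.erase e.1) (herase _ (List.pair_mem_product.mp
          (show (e.1, e.2) ∈ _ from he)).1 _)).bind fun best hbest => ?_
      rcases best with _ | ⟨⟨i, j⟩, v⟩
      · exact .pure hD
      · have hij := List.pair_mem_product.mp (hbest (i, j) v rfl)
        refine (SmallRun.lit (show 2 ≤ 2 ^ B₀ from
          Nat.pow_le_pow_right (i := 1) two_pos (by omega))).bind ?_
        rintro _ rfl
        refine (SmallRun.mul (IsFrac.natCast (show 2 ≤ 2 ^ 2 by norm_num)) hcur hB).bind
          fun bound _ => ?_
        refine (SmallRun.leq _ _).bind fun isLe _ => ?_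
        cases isLe
        · exact h.localSearch hB L fuel _ (herase i hij.1 j)
        · exact .pure hD

/-- Ledger of exponents of `s`: input `4`, `U Z` `6`, Gram matrices `9`, `W` `12`, `X` `14`; `U_Dᵀ
W` `14`, `U_Dᵀ W U_D` `16`, its inverse `19`, then `21`, `23`, `24`, `26` up to the last product,
and `27` for the final trace. Subdeterminants have exponent `19`. -/
theorem SmallRun.algorithm {z : Fin n → ℝ} {L : List (Fin n)} {q q' : ℕ} (fuel : ℕ) (hs : 2 ≤ s)
    (hd : d + 2 ≤ s) (hn : n ≤ s) (hL : L.Nodup) (hU : MatFrac q (s ^ 4) U)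
    (hz : ∀ j, IsFrac q' (s ^ 4) (z j)) (hq' : IsDen q' (s ^ 4)) (hB : s ^ 27 ≤ B₀) :
    SmallRun B₀ (approxSmallEigenSum fuel U z L) (fun _ => True) := by
  have hLn : L.length ≤ n := by simpa using hL.length_le_card
  have hpow : ∀ i j, i ≤ j → s ^ i ≤ s ^ j := fun i j hij => Nat.pow_le_pow_right (by omega) hij
  have hB' : ∀ i, i ≤ 27 → s ^ i ≤ B₀ := fun i hi => (hpow i 27 hi).trans hB
  have hB2 : 2 ≤ B₀ := hs.trans ((pow_one s).symm.le.trans (hB' 1 (by norm_num)))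
  have hmul : s ^ 4 + s ^ 4 ≤ s ^ 6 :=
    pow_add_pow_add_le (a := 0) hs le_rfl le_rfl (by norm_num) (Nat.zero_le _)
  have hgram : ∀ m, m ≤ n → s ^ 6 + s ^ 4 + 1 + m ≤ s ^ 9 := fun m hm => by
    have h1 := pow_add_pow_add_le (i := 6) (j := 4) (k := 6) (a := 1) hs le_rfl (by norm_num)
      (by norm_num) (by omega)
    have h2 := pow_add_le (i := 8) (k := 8) (a := m) hs le_rfl (by norm_num) (hm.trans hn)
    norm_num at h1 h2
    omega
  refine (SmallRun.buildMatrix fun i j => SmallRun.mul (hU.2 i j) (hz j)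
    (hmul.trans (hB' 6 (by norm_num)))).bind fun UZ hUZ => ?_
  have hUZ' : MatFrac (q * q') (s ^ 6) UZ :=
    ⟨(hU.1.mul hq').mono hmul, fun i j => (hUZ i j).mono hmul⟩
  have hgramB : ∀ S : List (Fin n), S.length ≤ n →
      SmallRun B₀ (FrameScaling.weightedGram U UZ S) (MatFrac (q * q' * q) (s ^ 9)) := fun S hS =>
    (SmallRun.weightedGram hU hUZ' S ((hgram _ hS).trans (hB' 9 (by norm_num)))).mono
      fun _ h => h.mono (hgram _ hS)
  refine (hgramB _ (by rw [List.length_finRange])).bind fun M hM => ?_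
  refine (SmallRun.matInv_pow hs hM (by omega) (by norm_num) (hB' 12 (by norm_num))).bind
    fun W ⟨w, hW⟩ => ?_
  refine (hgramB L hLn).bind fun MT hMT => ?_
  refine (SmallRun.matMul_pow 12 hs hMT hW (by omega) (by norm_num) le_rfl (by norm_num)
    (hB' 14 (by norm_num))).bind fun X ⟨x, hX⟩ => ?_
  refine (SmallRun.trace hX ((pow_add_le hs le_rfl (by norm_num) (by omega)).trans
    (hB' 15 (by norm_num)))).bind fun t _ => ?_
  refine (SmallRun.lit (show 1 ≤ 2 ^ B₀ from Nat.one_le_two_pow)).bind ?_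
  rintro _ rfl
  refine (SmallRun.lit (show 2 ≤ 2 ^ B₀ from
    Nat.pow_le_pow_right (i := 1) two_pos (by omega))).bind ?_
  rintro _ rfl
  have hhalf : IsFrac 2 s (((1 : ℕ) : ℝ) / ((2 : ℕ) : ℝ)) := by
    have h1 : IsFrac 1 0 ((1 : ℕ) : ℝ) := IsFrac.natCast (by norm_num)
    have h2 := h1.div_nat (k := 2) (c := 1) ⟨two_pos, by norm_num⟩
    exact h2.mono (by omega)
  have hsB : s + 1 ≤ B₀ := by
    have := pow_add_le (s := s) (i := 1) (k := 1) (a := 1) hs le_rfl le_rfl (by omega)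
    rw [pow_one] at this
    exact this.trans (hB' 2 (by norm_num))
  refine (SmallRun.div (fun _ => hhalf) (by omega)).bind ?_
  rintro half ⟨-, hhalf'⟩
  have hd2 : 2 * (0 + d) ≤ 2 ^ s := by
    have h1 : d < 2 ^ d := Nat.lt_two_pow_self
    have h2 : 2 ^ (d + 2) ≤ 2 ^ s := Nat.pow_le_pow_right two_pos hd
    rw [pow_add] at h2
    omega
  refine (SmallRun.nearestFrom hsB t hhalf' d 0 hd2).bind fun p hp => ?_
  have hsub : SmallSubdet B₀ (s ^ 19) U UZ W := by
    intro S hS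
    have hds : d ≤ s := by omega
    refine (SmallRun.matMul_pow 12 hs (hU.cols S).transpose hW hds (by norm_num) le_rfl
      (by norm_num) (hB' 14 (by norm_num))).bind fun A ⟨a, hA⟩ => ?_
    refine (SmallRun.matMul_pow 14 hs hA (hUZ'.cols S) hds le_rfl (by norm_num) (by norm_num)
      (hB' 16 (by norm_num))).bind fun C ⟨c, hC⟩ => ?_
    have h := levBits_le hs (show 3 ≤ 16 by norm_num) (hS.trans hds)
    exact SmallRun.matDet ((SmallRun.detElem hC (h.trans (hB' 19 (by norm_num)))).mono
      fun _ ⟨p, hp⟩ => ⟨p, hp.mono h⟩)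
  refine (hsub.rankFrom L []).bind fun r _ => ?_
  split_ifs
  · exact (SmallRun.lit (Nat.zero_le _)).mono fun _ _ => trivial
  · exact .pure trivial
  have hcur : 2 + s ^ 19 ≤ B₀ := by
    have h1 := pow_add_le (i := 19) (k := 19) (a := 2) hs le_rfl (by norm_num) hs
    rw [add_comm]
    exact h1.trans (hB' 20 (by norm_num))
  refine ((hsub.greedy L p [] (by simpa using hp)).bind fun G hG =>
    hsub.localSearch hcur L fuel G hG).bind fun D hD => ?_
  have hds : d ≤ s := by omega
  have hDs : D.length ≤ s := hD.trans hds
  refine (SmallRun.matMul_pow 12 hs (hU.cols D).transpose hW hds (by norm_num) le_rfl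
    (by norm_num) (hB' 14 (by norm_num))).bind fun A ⟨a, hA⟩ => ?_
  refine (SmallRun.matMul_pow 14 hs hA (hU.cols D) hds le_rfl (by norm_num)
    (by norm_num) (hB' 16 (by norm_num))).bind fun C ⟨c, hC⟩ => ?_
  refine (SmallRun.matInv_pow hs hC hDs (by norm_num) (hB' 19 (by norm_num))).bind
    fun C' ⟨c', hC'⟩ => ?_
  refine (SmallRun.matMul_pow 19 hs (hU.cols D) hC' hDs (by norm_num) le_rfl
    (by norm_num) (hB' 21 (by norm_num))).bind fun E ⟨e, hE⟩ => ?_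
  refine (SmallRun.matMul_pow 21 hs hE hA hDs le_rfl (by norm_num)
    (by norm_num) (hB' 23 (by norm_num))).bind fun P ⟨u, hP⟩ => ?_
  refine (SmallRun.lit (Nat.zero_le _)).bind ?_
  rintro _ rfl
  have h24 : s ^ 23 + 1 ≤ s ^ 24 := pow_add_le hs le_rfl (by norm_num) (by omega)
  refine (SmallRun.buildMatrix fun i j => SmallRun.sub (q := u) (B := s ^ 23) ?_ (hP.2 i j)
    (h24.trans (hB' 24 (by norm_num)))).bind fun Q hQ => ?_
  · split_ifs
    · rw [Nat.cast_one]; exact .one hP.1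
    · rw [Nat.cast_zero]; exact .zero hP.1
  have hQ' : MatFrac u (s ^ 24) Q :=
    ⟨hP.1.mono (hpow 23 24 (by norm_num)), fun i j => (hQ i j).mono h24⟩
  refine (SmallRun.matMul_pow 24 hs hQ' hX hds le_rfl (by norm_num)
    (by norm_num) (hB' 26 (by norm_num))).bind fun Y ⟨y, hY⟩ => ?_
  exact (SmallRun.trace hY ((pow_add_le hs le_rfl (by norm_num) hds).trans
    (hB' 27 le_rfl))).mono fun _ _ => trivial

end AlgorithmBits

end FrameScaling

namespace FrameScaling

/-! ### Polynomial bounds -/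

theorem totalCost_le_log {d n : ℕ} (hd : 1 ≤ d) (hn : 2 ≤ n) :
    totalCost d n ≤ 100 * (n * d ^ 2 * Nat.log 2 n) := by
  have hl : 1 ≤ Nat.log 2 n := Nat.log_pos (by norm_num) hn
  unfold totalCost
  generalize Nat.log 2 n = l at hl ⊢
  have h1 : 1 ≤ n * d := Nat.mul_pos (by omega) hd
  have h2 : n * d ≤ n * d ^ 2 := by
    rw [sq]
    exact Nat.mul_le_mul_left _ (Nat.le_mul_of_pos_left d hd)
  have h3 : n * d ^ 2 ≤ n * d ^ 2 * l := Nat.le_mul_of_pos_right _ hl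
  have h4 : d ≤ n * d := Nat.le_mul_of_pos_left d (by omega)
  have h5 : n ≤ n * d := Nat.le_mul_of_pos_right n hd
  have h6 : d ^ 2 ≤ n * d ^ 2 := Nat.le_mul_of_pos_left _ (by omega)
  -- The dominant term: `O(d log n)` passes of the local search with `O(nd)` instructions each.
  have h7 : (d * (l + 2) + 1) * (3 + (d * n * 4 + 3)) ≤ 40 * (n * d ^ 2 * l) := by
    calc (d * (l + 2) + 1) * (3 + (d * n * 4 + 3)) ≤ (d * (l * 4)) * (n * d * 10) := by
          refine Nat.mul_le_mul ?_ (by rw [mul_comm d n]; omega)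
          have : d * 1 ≤ d * l := Nat.mul_le_mul_left d hl
          linarith
      _ = _ := by ring
  have e1 : n * (1 + d * (d * 1)) = n + n * d ^ 2 := by ring
  have e2 : d * (n * 1) = n * d := by ring
  have e3 : d * (n * 4) = 4 * (n * d) := by ring
  have e4 : d * (d * 1) = d ^ 2 := by ring
  rw [e1, e2, e3, e4]
  generalize n * d ^ 2 * l = m at *
  linarith

/-- Since `s ≥ 2`, numerical constants are absorbed into further powers of `s`. -/
theorem totalCost_le_pow (d n : ℕ) : totalCost d n ≤ (n + d + 2) ^ 11 := by
  set s := n + d + 2 with hs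
  have h2 : 2 ≤ s := by omega
  have hd : d ≤ s := by omega
  have hn : n ≤ s := by omega
  have hl : Nat.log 2 n ≤ s := (Nat.log_le_self 2 n).trans hn
  have h : totalCost d n ≤ 2 ^ 7 * s ^ 4 := by
    have h0 : 1 ≤ s ^ 4 := Nat.one_le_pow _ _ (by omega)
    have h1 : s ≤ s ^ 4 := Nat.le_self_pow (by norm_num) s
    have h3 : s ^ 2 ≤ s ^ 4 := Nat.pow_le_pow_right (by omega) (by norm_num)
    have h4 : s ^ 3 ≤ s ^ 4 := Nat.pow_le_pow_right (by omega) (by norm_num)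
    calc totalCost d n ≤ s * (s * 1) + ((1 + s * (1 + s * (s * 1))) + (1 +
          ((1 + s * (1 + s * (s * 1))) + (1 + ((s + 1) +
          (1 + (1 + (1 + (s * 3 + (s * 5 + (s * (s * 4) +
            (s * (s + 2) + 1) * (3 + (s * s * 4 + 3)) +
            (1 + (1 + (1 + (1 + (1 + (1 + (s * (s * 1) + (1 + (s + 1)))))))))))))))))))) := by
          unfold totalCost
          gcongr
      _ ≤ _ := by ring_nf; omega
  calc totalCost d n ≤ 2 ^ 7 * s ^ 4 := h
    _ ≤ s ^ 7 * s ^ 4 := Nat.mul_le_mul_right _ (Nat.pow_le_pow_left h2 7)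
    _ = s ^ 11 := by ring

theorem elemCost_le_pow (d n : ℕ) : elemCost (max d 1) ≤ (n + d + 2) ^ 9 := by
  set s := n + d + 2 with hs
  have h2 : 2 ≤ s := by omega
  have hd : max d 1 ≤ s := by omega
  have h : elemCost (max d 1) ≤ 2 ^ 5 * s ^ 4 := by
    have h0 : 1 ≤ s ^ 4 := Nat.one_le_pow _ _ (by omega)
    have h1 : s ≤ s ^ 4 := Nat.le_self_pow (by norm_num) s
    have h3 : s ^ 2 ≤ s ^ 4 := Nat.pow_le_pow_right (by omega) (by norm_num)
    have h4 : s ^ 3 ≤ s ^ 4 := Nat.pow_le_pow_right (by omega) (by norm_num)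
    calc elemCost (max d 1) ≤ elemCost s := by
          unfold elemCost
          gcongr
      _ ≤ _ := by unfold elemCost; ring_nf; omega
  calc elemCost (max d 1) ≤ 2 ^ 5 * s ^ 4 := h
    _ ≤ s ^ 5 * s ^ 4 := Nat.mul_le_mul_right _ (Nat.pow_le_pow_left h2 5)
    _ = s ^ 9 := by ring

theorem natLog_le {n : ℕ} : (Nat.log 2 n : ℝ) ≤ (Real.log 2)⁻¹ * Real.log n := by
  have := Real.natLog_le_logb n 2
  rw [Real.logb, div_eq_inv_mul] at this
  exact_mod_cast this

theorem totalCost_le {d n : ℕ} (hd : 1 ≤ d) (hn : 2 ≤ n) :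
    (totalCost d n : ℝ) ≤ 100 * (Real.log 2)⁻¹ * (n * d ^ 2 * Real.log n) := by
  have h1 : (totalCost d n : ℝ) ≤ ((100 * (n * d ^ 2 * Nat.log 2 n) : ℕ) : ℝ) :=
    Nat.cast_le.mpr (totalCost_le_log hd hn)
  push_cast at h1
  refine h1.trans ?_
  have h2 : (n * d ^ 2 : ℝ) * Nat.log 2 n ≤ n * d ^ 2 * ((Real.log 2)⁻¹ * Real.log n) :=
    mul_le_mul_of_nonneg_left natLog_le (by positivity)
  linarith

theorem totalCost_mul_elemCost_le (d n : ℕ) :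
    totalCost d n * elemCost (max d 1) ≤ (n + d + 2) ^ 29 := by
  refine (Nat.mul_le_mul (totalCost_le_pow d n) (elemCost_le_pow d n)).trans ?_
  rw [← pow_add]
  exact Nat.pow_le_pow_right (by omega) (by norm_num)

theorem add_mul_card_le {s b c : ℕ} (hs : 2 ≤ s) (hb : b ≤ s) (hc : c ≤ s ^ 2) :
    b + b * c ≤ s ^ 4 := by
  have h1 : b * c ≤ s * s ^ 2 := Nat.mul_le_mul hb hc
  have h2 : s ^ 1 ≤ s ^ 3 := Nat.pow_le_pow_right (by omega) (by norm_num)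
  have h3 : 2 * s ^ 3 ≤ s * s ^ 3 := Nat.mul_le_mul_right _ hs
  have e1 : s * s ^ 2 = s ^ 3 := by ring
  have e2 : s * s ^ 3 = s ^ 4 := by ring
  rw [pow_one] at h2
  omega

theorem two_mul_pow_add_two_le {s : ℕ} (hs : 2 ≤ s) : 2 * s ^ 27 + 2 ≤ s ^ 29 := by
  have h1 : s ^ 1 ≤ s ^ 27 := Nat.pow_le_pow_right (by omega) (by norm_num)
  have h2 : s ^ 27 * 2 ^ 2 ≤ s ^ 27 * s ^ 2 := Nat.mul_le_mul_left _ (Nat.pow_le_pow_left hs 2)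
  rw [← pow_add, show 27 + 2 = 29 by norm_num] at h2
  rw [pow_one] at h1
  linarith

end FrameScaling

/-! ### Assembly of the theorem. -/

open FrameScaling in
theorem mainTheorem7 :
    ∃ (C : ℝ) (k : ℕ), ∀ (d n : ℕ) (U : Matrix (Fin d) (Fin n) ℝ) (z : Fin n → ℝ)
      (T : List (Fin n)),
      U.rank = d → (∀ j, 0 < z j) → T.Nodup →
      ((relSpectrum U z T.toFinset).map (fun x => x * (1 - x))).sum < 1 / 4 →
      ∃ (μ' : ℝ) (log elemLog : List (Event ℝ)),
        -- the algorithm terminates with output `μ'`; its execution with matrix computations as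
        -- single instructions is `log`, and the one in elementary operations is `elemLog`
        (∃ N : ℕ, ∀ fuel : ℕ, N ≤ fuel →
          (approxSmallEigenSum fuel U z T).run = some (μ', log) ∧
          (approxSmallEigenSum fuel U z T).expand.run = some (μ', elemLog)) ∧
        -- approximation guarantee
        smallSum (relSpectrum U z T.toFinset) ≤ μ' ∧
        μ' ≤ (1 + 8 * n * d ^ 2) * smallSum (relSpectrum U z T.toFinset) ∧
        -- the number of matrix computations (and other instructions), on matrices of side `≤ d`
        (1 ≤ d → ∀ m : ℕ, Event.matrix m ∈ log → m ≤ d) ∧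
        (1 ≤ d → 2 ≤ n → (log.length : ℝ) ≤ C * (n * d ^ 2 * Real.log n)) ∧
        -- strongly polynomial: polynomially many elementary operations, and
        -- polynomially bounded bit length of all intermediate quantities
        (∀ m : ℕ, Event.matrix m ∉ elemLog) ∧
        elemLog.length ≤ (n + d + 2) ^ k ∧
        (∀ b : ℕ, (∀ i j, HasBits (U i j) b) → (∀ j, HasBits (z j) b) →
          ∀ x : ℝ, Event.scalar x ∈ elemLog → HasBits x ((n + d + b + 2) ^ k)) := by

  -- The factor `(log 2)⁻¹` converts the binary logarithm. The exponent `29` is dictated by the bit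
  -- lengths, `2 s ^ 27 + 2 ≤ s ^ 29`; the operation count alone needs only `11 + 9 = 20`.
  refine ⟨100 * (Real.log 2)⁻¹, 29, fun d n U z T hU hz hT hμ => ?_⟩
  obtain ⟨R, V, μ, h⟩ := exists_isWhitening hU hz T.toFinset
  rw [h.relSpectrum_eq, smallSum_map]
  rw [h.relSpectrum_eq, Multiset.map_map] at hμ
  set N := d * (Nat.log 2 n + 2) + 1 with hN
  obtain ⟨μ', log, hrun, ⟨hlo, hhi⟩, hlen, hdim⟩ := h.algorithm_succeeds hT hμ (Nat.lt_succ_self _)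
  -- Both executions are fixed at the smallest fuel known to suffice; larger fuel reproduces them
  -- exactly.
  obtain ⟨a, elemLog, hrun', rfl, hlen', hno⟩ := Prog.expand_run _ _ _ hrun hdim
  refine ⟨a, log, elemLog, ⟨N, fun fuel hfuel => ?_⟩, hlo, hhi, ?_, ?_, ?_, ?_, ?_⟩
  · have happ := approxSmallEigenSum_approximates U z T hfuel
    exact ⟨happ.1 _ hrun, happ.2 _ hrun'⟩
  · intro hd m hm
    exact (hdim _ hm).trans (max_le le_rfl hd)
  · exact fun hd hn => (Nat.cast_le.mpr hlen).trans (totalCost_le hd hn)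
  · exact fun m hm => hno _ hm
  · exact (hlen'.trans (Nat.mul_le_mul_right _ hlen)).trans (totalCost_mul_elemCost_le d n)
  · intro b hUb hzb x hx
    obtain ⟨s, hs⟩ : ∃ s, s = n + d + b + 2 := ⟨_, rfl⟩
    rw [← hs]
    have hs2 : 2 ≤ s := by omega
    obtain ⟨q, hq, hUq⟩ := exists_common_den (fun e : Fin d × Fin n => U e.1 e.2) b
      fun e => hUb e.1 e.2
    obtain ⟨q', hq', hzq⟩ := exists_common_den z b hzb
    -- Common denominators for `U` and for `z` cost a factor of the number of entries, which gives
    -- the input exponent `4`.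
    have hcard : b + b * Fintype.card (Fin d × Fin n) ≤ s ^ 4 := by
      refine add_mul_card_le hs2 (by omega) ?_
      rw [Fintype.card_prod, Fintype.card_fin, Fintype.card_fin, sq]
      exact Nat.mul_le_mul (by omega) (by omega)
    have hcard' : b + b * Fintype.card (Fin n) ≤ s ^ 4 := by
      refine add_mul_card_le hs2 (by omega) ?_
      rw [Fintype.card_fin]
      exact (show n ≤ s by omega).trans (Nat.le_self_pow (by norm_num) s)
    obtain ⟨p, hp⟩ := ((SmallRun.algorithm (s := s) N hs2 (by omega) (by omega) hT
      ⟨hq.mono hcard, fun i j => (hUq (i, j)).mono hcard⟩ (fun j => (hzq j).mono hcard')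
      (hq'.mono hcard') le_rfl) a elemLog hrun').2 _ hx
    exact hp.hasBits.mono (two_mul_pow_add_two_le hs2)
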